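/- **Conventions.** Algorithms are programs for a finite-control machine with finitely many one-ended stacks (equivalently, tapes) whose cells hold rational numbers. Each elementary instruction (push a constant, pop, copy the top of a stack to another stack, one arithmetic operation $+,-,\times,/$ on two rationals, one evaluation of the loss function) and each test (is a stack empty? is a number positive?) is one step. The input is the list of the rational numbers in the data set, the output is the list of the requested rational parameters. Let $d\ge 1$ and $n\ge 2$ be fixed integers, $\mathcal X\subseteq\mathbb Q^d$, $\mathcal Q=\{1,\dots,n\}$, and let $\ell:\mathbb Q\to\mathbb Q_{\ge 0}$ be a loss function. Write $\overline{x}=[x^T,1]^T$. Let $\mathcal H$ be the set of $n$-category linear classifiers on $\mathcal X$, i.e. of the functions $h:\mathcal X\to\mathcal Q$ of the form $h(x)=\operatorname{argmax}_{k\in\mathcal Q}(g_k^Tx+b_k)$ with $g_k\in\mathbb Q^d$, $b_k\in\mathbb Q$, where the smallest maximizing index is taken in case of ties. **Single-mode regression.** Given $N\ge 1$ data pairs $(x_i,y_i)\in\mathcal X\times\mathbb Q$, find $v\in\mathbb Q^{d+1}$ that minimizes $\sum_{i=1}^N\ell(y_i-v^T\overline{x}_i)$ over $\mathbb Q^{d+1}$.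 **Error-minimizing PWA regression.** Given $N\ge n(d+1)$ data pairs $(x_i,y_i)\in\mathcal X\times\mathbb Q$, find (the parameters of) a pair $(w,h)$, $w=(w_j)_{j\in\mathcal Q}\in\mathbb Q^{n(d+1)}$, $h\in\mathcal H$, that minimizes $$\frac1N\sum_{i=1}^N\sum_{j\in\mathcal Q}\mathbf 1_{h(x_i)=j}\;\ell(y_i-w_j^T\overline{x}_i)$$ over $\mathbb Q^{n(d+1)}\times\mathcal H$. **Theorem.** Let $T:\mathbb N\to\mathbb N$ be nondecreasing and bounded by a polynomial, and assume that some program solves single-mode regression, for all data sets in $\mathcal X\times\mathbb Q$, in at most $T(N)$ steps on data sets of size $N$ (in particular, a minimizer always exists). Then there is a program that solves error-minimizing PWA regression exactly on all data sets whose points $x_1,\dots,x_N$ are in general position, i.e. such that no hyperplane of $\mathbb Q^d$ contains $x_i$ for more than $d$ indices $i$, and whose number of steps on data sets of size $N$ is at most $T(N)\cdot O\!\left(N^{dn(n-1)/2}\right)$, where the constant in $O(\cdot)$ does not depend on $N$ or on the data; in particular, it is bounded by a polynomial in $N$. -/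

import Mathlib

namespace PWA

/-! ### The machine model

A finite-control machine over `ℚ` with finitely many unbounded stacks whose cells hold rational
numbers (a two-way infinite tape with one head is a pair of stacks).  A machine is given by a finite
structured program, which can mention only finitely many of the stacks `0, 1, 2, …`.  Every executed
instruction and every executed test is one step; one arithmetic operation on two rational
numbers is one step, and so is one evaluation of the loss function. -/

/-- Arithmetic operations on rational numbers (division by zero returns `0`). -/
inductive Op
  | add
  | sub
  | mul
  | div

/-- The value of an arithmetic operation. -/
def Op.eval : Op → ℚ → ℚ → ℚ
  | .add, a, b => a + b
  | .sub, a, b => a - b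
  | .mul, a, b => a * b
  | .div, a, b => a / b

/-- Memory: the contents of every stack, the top of a stack being the head of the list. -/
abbrev Mem := ℕ → List ℚ

/-- The top of stack `i`, or `0` if the stack is empty. -/
def top (s : Mem) (i : ℕ) : ℚ := (s i).headD 0

/-- `s` after `c` has been pushed onto stack `i`. -/
def pushOn (s : Mem) (i : ℕ) (c : ℚ) : Mem := Function.update s i (c :: s i)

/-- `s` after the top of stack `i` has been removed (no effect if the stack is empty). -/
def popOff (s : Mem) (i : ℕ) : Mem := Function.update s i (s i).tail

/-- The tests on which a program can branch. -/
inductive Test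
  | nonempty (i : ℕ)
  | pos (i : ℕ)

/-- Truth of a test: stack `i` is nonempty, or the top of stack `i` is positive. -/
def Test.Holds (s : Mem) : Test → Prop
  | .nonempty i => s i ≠ []
  | .pos i => 0 < top s i

/-- Programs. -/
inductive Prog
  /-- push the constant `c` onto stack `i` -/
  | push (c : ℚ) (i : ℕ)
  /-- remove the top of stack `i` -/
  | pop (i : ℕ)
  /-- push the top of stack `i` onto stack `j` -/
  | copy (i j : ℕ)
  /-- push the value of `o` at the tops of stacks `i` and `j` onto stack `k` -/
  | arith (o : Op) (i j k : ℕ)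
  /-- push the loss of the top of stack `i` onto stack `j` -/
  | loss (i j : ℕ)
  /-- run `p`, then `q` -/
  | seq (p q : Prog)
  /-- if `t` holds run `p`, otherwise run `q` -/
  | branch (t : Test) (p q : Prog)
  /-- while `t` holds run `p` -/
  | loop (t : Test) (p : Prog)

/-- `Exec ℓ p s t s'`: with loss function `ℓ`, the program `p` started in memory `s` halts after
exactly `t` steps, in memory `s'`. -/
inductive Exec (ℓ : ℚ → ℚ) : Prog → Mem → ℕ → Mem → Prop
  | push (c : ℚ) (i : ℕ) (s : Mem) : Exec ℓ (.push c i) s 1 (pushOn s i c)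
  | pop (i : ℕ) (s : Mem) : Exec ℓ (.pop i) s 1 (popOff s i)
  | copy (i j : ℕ) (s : Mem) : Exec ℓ (.copy i j) s 1 (pushOn s j (top s i))
  | arith (o : Op) (i j k : ℕ) (s : Mem) :
      Exec ℓ (.arith o i j k) s 1 (pushOn s k (o.eval (top s i) (top s j)))
  | loss (i j : ℕ) (s : Mem) : Exec ℓ (.loss i j) s 1 (pushOn s j (ℓ (top s i)))
  | seq {p q : Prog} {s s₁ s₂ : Mem} {t₁ t₂ : ℕ} :
      Exec ℓ p s t₁ s₁ → Exec ℓ q s₁ t₂ s₂ → Exec ℓ (.seq p q) s (t₁ + t₂) s₂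
  | branch_true {b : Test} {p q : Prog} {s s₁ : Mem} {t : ℕ} :
      b.Holds s → Exec ℓ p s t s₁ → Exec ℓ (.branch b p q) s (t + 1) s₁
  | branch_false {b : Test} {p q : Prog} {s s₁ : Mem} {t : ℕ} :
      ¬ b.Holds s → Exec ℓ q s t s₁ → Exec ℓ (.branch b p q) s (t + 1) s₁
  | loop_true {b : Test} {p : Prog} {s s₁ s₂ : Mem} {t₁ t₂ : ℕ} :
      b.Holds s → Exec ℓ p s t₁ s₁ → Exec ℓ (.loop b p) s₁ t₂ s₂ →
        Exec ℓ (.loop b p) s (t₁ + t₂ + 1) s₂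
  | loop_false {b : Test} {p : Prog} {s : Mem} :
      ¬ b.Holds s → Exec ℓ (.loop b p) s 1 s

/-- `Computes ℓ p inp out t`: started with `inp` on stack `0` and all other stacks empty, the
program `p` halts after exactly `t` steps with precisely `out` on stack `1`. -/
def Computes (ℓ : ℚ → ℚ) (p : Prog) (inp out : List ℚ) (t : ℕ) : Prop :=
  ∃ s' : Mem, Exec ℓ p (Function.update (fun _ => []) 0 inp) t s' ∧ s' 1 = out

/-! ### The regression problems -/

/-- The extended vector `x̄ = [xᵀ, 1]ᵀ`. -/
def ext {d : ℕ} (x : Fin d → ℚ) : Fin (d + 1) → ℚ := Fin.snoc (α := fun _ => ℚ) x 1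

/-- The data set as a list of rational numbers: `x₁, y₁, x₂, y₂, …`. -/
def encodeData {d N : ℕ} (x : Fin N → Fin d → ℚ) (y : Fin N → ℚ) : List ℚ :=
  (List.ofFn fun i => List.ofFn (x i) ++ [y i]).flatten

/-- The parameters of a PWA model as a list of rational numbers:
`w₁, …, wₙ, h₁, b₁, …, hₙ, bₙ`. -/
def encodeModel {d n : ℕ} (w : Fin n → Fin (d + 1) → ℚ) (g : Fin n → Fin d → ℚ)
    (b : Fin n → ℚ) : List ℚ :=
  (List.ofFn fun j => List.ofFn (w j)).flatten ++
    (List.ofFn fun k => List.ofFn (g k) ++ [b k]).flatten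

/-- The points are in general position: no hyperplane contains more than `d` of them. -/
def GeneralPosition {d N : ℕ} (x : Fin N → Fin d → ℚ) : Prop :=
  ∀ (a : Fin d → ℚ) (c : ℚ), a ≠ 0 →
    (Finset.univ.filter fun i => a ⬝ᵥ x i + c = 0).card ≤ d

/-- The error `∑ᵢ ℓ(yᵢ - vᵀ x̄ᵢ)` of a single affine model. -/
def affineError {d N : ℕ} (ℓ : ℚ → ℚ) (x : Fin N → Fin d → ℚ) (y : Fin N → ℚ)
    (v : Fin (d + 1) → ℚ) : ℚ :=
  ∑ i, ℓ (y i - v ⬝ᵥ ext (x i))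

/-- The program `R` solves single-mode regression on all data sets with inputs in `X`, in at most
`T N` steps on data sets of size `N`. -/
def SolvesRegression {d : ℕ} (X : Set (Fin d → ℚ)) (ℓ : ℚ → ℚ) (R : Prog) (T : ℕ → ℕ) : Prop :=
  ∀ N : ℕ, 1 ≤ N → ∀ (x : Fin N → X) (y : Fin N → ℚ),
    ∃ (v : Fin (d + 1) → ℚ) (t : ℕ),
      Computes ℓ R (encodeData (fun i => (x i : Fin d → ℚ)) y) (List.ofFn v) t ∧ t ≤ T N ∧
      ∀ v' : Fin (d + 1) → ℚ,
        affineError ℓ (fun i => (x i : Fin d → ℚ)) y v ≤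
          affineError ℓ (fun i => (x i : Fin d → ℚ)) y v'

/-- `h(x) = argmax_k (g_kᵀ x + b_k)` for all `x ∈ X`, where among several maximizing categories the
smallest is taken. -/
def IsArgmaxClassifier {d n : ℕ} {X : Set (Fin d → ℚ)} (g : Fin n → Fin d → ℚ) (b : Fin n → ℚ)
    (h : X → Fin n) : Prop :=
  ∀ x : X, IsLeast {k : Fin n | ∀ l : Fin n, g l ⬝ᵥ (x : Fin d → ℚ) + b l ≤
    g k ⬝ᵥ (x : Fin d → ℚ) + b k} (h x)

/-- The class of `n`-category linear classifiers on `X`. -/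
def linearClassifiers {d : ℕ} (X : Set (Fin d → ℚ)) (n : ℕ) : Set (X → Fin n) :=
  {h | ∃ (g : Fin n → Fin d → ℚ) (b : Fin n → ℚ), IsArgmaxClassifier g b h}

/-- The cost `(1/N) ∑ᵢ ∑ⱼ 𝟙[h(xᵢ) = j] ℓ(yᵢ - wⱼᵀ x̄ᵢ)` of a PWA model. -/
def pwaCost {d n N : ℕ} {X : Set (Fin d → ℚ)} (ℓ : ℚ → ℚ) (x : Fin N → X) (y : Fin N → ℚ)
    (w : Fin n → Fin (d + 1) → ℚ) (h : X → Fin n) : ℚ :=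
  1 / (N : ℚ) * ∑ i, ∑ j, (if h (x i) = j then 1 else 0) * ℓ (y i - w j ⬝ᵥ ext (x i : Fin d → ℚ))

/-- `(w, h)` is a global solution of the error-minimizing PWA regression problem. -/
def IsPWASolution {d n N : ℕ} {X : Set (Fin d → ℚ)} (ℓ : ℚ → ℚ) (x : Fin N → X) (y : Fin N → ℚ)
    (w : Fin n → Fin (d + 1) → ℚ) (h : X → Fin n) : Prop :=
  h ∈ linearClassifiers X n ∧
    ∀ (w' : Fin n → Fin (d + 1) → ℚ), ∀ h' ∈ linearClassifiers X n,
      pwaCost ℓ x y w h ≤ pwaCost ℓ x y w' h'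

/-- The program `P` solves the error-minimizing PWA regression problem with `n` modes on all data
sets with inputs in `X` in general position, in at most `τ N` steps on data sets of size `N`: it
returns the parameters of the affine submodels and those of a linear classifier, which together are
a global solution. -/
def SolvesPWA {d : ℕ} (X : Set (Fin d → ℚ)) (n : ℕ) (ℓ : ℚ → ℚ) (P : Prog) (τ : ℕ → ℕ) : Prop :=
  ∀ N : ℕ, n * (d + 1) ≤ N → ∀ (x : Fin N → X) (y : Fin N → ℚ),
    GeneralPosition (fun i => (x i : Fin d → ℚ)) →
    ∃ (w : Fin n → Fin (d + 1) → ℚ) (g : Fin n → Fin d → ℚ) (b : Fin n → ℚ) (h : X → Fin n)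
      (t : ℕ),
      Computes ℓ P (encodeData (fun i => (x i : Fin d → ℚ)) y) (encodeModel w g b) t ∧ t ≤ τ N ∧
      IsArgmaxClassifier g b h ∧ IsPWASolution ℓ x y w h

/-- `T` is bounded by a polynomial. -/
def PolynomiallyBounded (T : ℕ → ℕ) : Prop :=
  ∃ p : Polynomial ℕ, ∀ N : ℕ, T N ≤ p.eval N

end PWA

/-! For a fixed classifier the PWA cost splits into independent single-mode regressions, one per
category (`modelError_eq_sum`), so `R` finds optimal submodels. It remains to enumerate, up to their
effect on the data, all linear classifiers, using only O(N^D) candidates with D = (n-1)(d+1) - 1;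
`exponent_le` gives D ≤ dn(n-1)/2.

Only differences of scores matter, so the last category may have score 0, which leaves D+1
parameters. A labelling of the data by a linear classifier can be realised with strict inequalities
(`exists_strict`), hence its parameters fill the interior of a polyhedral cone. The rows of the cone
are indexed by a data point and a competing category; general position makes the cone pointed. Its
vertices shifted off the walls would be determined by D+1 rows, one factor N too many. The saving
comes from homogeneity: take an extreme ray u, and then a point x at which the rows vanishing on u
are at least 1, chosen so that those equal to 1 still determine the line x + ℚu. Far along this line
every inequality is strict, and D rows determine the line (`exists_unbounded_edge`, `exists_edge`).
A candidate is thus D data points, D pairs of categories, a coordinate and a sign;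
`exists_candidate` says that some candidate reproduces any given labelling. Cramer's rule computes
the line, and a sum of squared ratios is far enough along it.

Each candidate costs O(N + T(N)) steps. To absorb N into T(N), `ListRegression.le_mul_steps` shows
that a regression program must read a fixed proportion of its input: otherwise its answer would be
optimal whatever the unread responses are, which forces ℓ to be constant (`eq_of_dominated`). For
constant ℓ any model is optimal and a constant-time program suffices.

The rest is program verification with step bounds (`Runs`, `Same`). Registers are tops of stacks: an
assignment pushes and nothing relies on what lies underneath. Block 0 contains the stacks of `R`, 1
is scratch, 2 the current point, 3 and 4 the data, 5 the current classifier, 6, 7 and 9 the best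
classifier, submodels and cost, 8 the current cost, 10 the step length, 11 and 12 the line, 13
temporaries, 14 discarded copies. The blocks 20+3j, 21+3j, 22+3j hold the j-th chosen point, the
rest of the j-th loop's list, and the j-th submodel. -/

namespace PWA

/-! ### Executions: frame, transport, locality, determinism -/

variable {ℓ : ℚ → ℚ}

/-- The stacks which a program may change. -/
def Prog.mods : Prog → Set ℕ
  | .push _ i => {i}
  | .pop i => {i}
  | .copy _ j => {j}
  | .arith _ _ _ k => {k}
  | .loss _ j => {j}
  | .seq p q => p.mods ∪ q.mods
  | .branch _ p q => p.mods ∪ q.mods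
  | .loop _ p => p.mods

/-- The stack which a test inspects. -/
def Test.stack : Test → ℕ
  | .nonempty i => i
  | .pos i => i

/-- A number exceeding all stacks mentioned by a program. -/
def Prog.bound : Prog → ℕ
  | .push _ i => i + 1
  | .pop i => i + 1
  | .copy i j => max (i + 1) (j + 1)
  | .arith _ i j k => max (i + 1) (max (j + 1) (k + 1))
  | .loss i j => max (i + 1) (j + 1)
  | .seq p q => max p.bound q.bound
  | .branch b p q => max (b.stack + 1) (max p.bound q.bound)
  | .loop b p => max (b.stack + 1) p.bound

theorem Test.holds_congr {b : Test} {s r : Mem} (h : s b.stack = r b.stack) :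
    b.Holds s ↔ b.Holds r := by
  cases b <;> simp_all [Test.Holds, Test.stack, top]

theorem Exec.eq_of_notMem_mods {p : Prog} {s s' : Mem} {t : ℕ} (h : Exec ℓ p s t s') {i : ℕ}
    (hi : i ∉ p.mods) : s' i = s i := by
  induction h with
  | push | pop | copy | arith | loss =>
    simp only [Prog.mods, Set.mem_singleton_iff] at hi
    simp [pushOn, popOff, hi]
  | seq _ _ ih₁ ih₂ =>
    simp only [Prog.mods, Set.mem_union, not_or] at hi
    rw [ih₂ hi.2, ih₁ hi.1]
  | branch_true _ _ ih => exact ih fun h => hi (Or.inl h)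
  | branch_false _ _ ih => exact ih fun h => hi (Or.inr h)
  | loop_true _ _ _ ih₁ ih₂ => rw [ih₂ hi, ih₁ hi]
  | loop_false => rfl

theorem Exec.one_le {p : Prog} {s s' : Mem} {t : ℕ} (h : Exec ℓ p s t s') : 1 ≤ t := by
  induction h <;> omega

/-- A step pushes at most one cell. This bounds the garbage left behind by the regression program,
hence the cost of clearing it. -/
theorem Exec.length_le {p : Prog} {s s' : Mem} {t : ℕ} (h : Exec ℓ p s t s') (i : ℕ) :
    (s' i).length ≤ (s i).length + t := by
  induction h with
  | push c j s | copy j' j s | arith o j' j'' j s | loss j' j s =>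
    rcases eq_or_ne i j with rfl | hij
    · simp [pushOn]
    · simp [pushOn, hij]
  | pop j s =>
    rcases eq_or_ne i j with rfl | hij
    · simp [popOff]; omega
    · simp [popOff, hij]
  | loop_false => omega
  | seq _ _ h₁ h₂ => omega
  | branch_true _ _ h => omega
  | branch_false _ _ h => omega
  | loop_true _ _ _ h₁ h₂ => omega

/-- An execution does not depend on the stacks which the program does not mention. -/
theorem Exec.transport {p : Prog} {s s' : Mem} {t : ℕ} (h : Exec ℓ p s t s') {K : ℕ} :
    p.bound ≤ K → ∀ {r : Mem}, (∀ i < K, r i = s i) →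
      Exec ℓ p r t (fun i => if i < K then s' i else r i) := by
  induction h with
  | push c j s =>
    intro hK r hr
    simp only [Prog.bound] at hK
    convert Exec.push c j r using 1
    funext i
    rcases eq_or_ne i j with rfl | hij
    · simp [pushOn, hr i (by omega)]; omega
    · by_cases hi : i < K <;> simp [pushOn, hij, hr, hi]
  | pop j s =>
    intro hK r hr
    simp only [Prog.bound] at hK
    convert Exec.pop j r using 1
    funext i
    rcases eq_or_ne i j with rfl | hij
    · simp [popOff, hr i (by omega)]; omega
    · by_cases hi : i < K <;> simp [popOff, hij, hr, hi]
  | copy j' j s =>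
    intro hK r hr
    simp only [Prog.bound] at hK
    convert Exec.copy j' j r using 1
    funext i
    rcases eq_or_ne i j with rfl | hij
    · simp [pushOn, top, hr i (by omega), hr j' (by omega)]; omega
    · by_cases hi : i < K <;> simp [pushOn, hij, hr, hi]
  | arith o j' j'' j s =>
    intro hK r hr
    simp only [Prog.bound] at hK
    convert Exec.arith o j' j'' j r using 1
    funext i
    rcases eq_or_ne i j with rfl | hij
    · simp [pushOn, top, hr i (by omega), hr j' (by omega), hr j'' (by omega)]; omega
    · by_cases hi : i < K <;> simp [pushOn, hij, hr, hi]
  | loss j' j s =>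
    intro hK r hr
    simp only [Prog.bound] at hK
    convert Exec.loss j' j r using 1
    funext i
    rcases eq_or_ne i j with rfl | hij
    · simp [pushOn, top, hr i (by omega), hr j' (by omega)]; omega
    · by_cases hi : i < K <;> simp [pushOn, hij, hr, hi]
  | seq _ _ ih₁ ih₂ =>
    intro hK r hr
    simp only [Prog.bound, max_le_iff] at hK
    convert Exec.seq (ih₁ hK.1 hr) (ih₂ hK.2 fun i hi => by simp [hi]) using 1
    funext i
    by_cases hi : i < K <;> simp [hi]
  | @branch_true b _ _ s _ _ hb _ ih =>
    intro hK r hr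
    simp only [Prog.bound, max_le_iff] at hK
    exact .branch_true ((Test.holds_congr (hr _ (by omega))).2 hb) (ih hK.2.1 hr)
  | @branch_false b _ _ s _ _ hb _ ih =>
    intro hK r hr
    simp only [Prog.bound, max_le_iff] at hK
    exact .branch_false (mt (Test.holds_congr (hr _ (by omega))).1 hb) (ih hK.2.2 hr)
  | loop_true hb _ _ ih₁ ih₂ =>
    intro hK r hr
    have hK' := hK
    simp only [Prog.bound, max_le_iff] at hK'
    convert Exec.loop_true ((Test.holds_congr (hr _ (by omega))).2 hb) (ih₁ hK'.2 hr)
      (ih₂ hK fun i hi => by simp [hi]) using 1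
    funext i
    by_cases hi : i < K <;> simp [hi]
  | loop_false hb =>
    intro hK r hr
    simp only [Prog.bound, max_le_iff] at hK
    convert Exec.loop_false (mt (Test.holds_congr (hr _ (by omega))).1 hb) using 1
    funext i
    by_cases hi : i < K <;> simp [hi, hr]

theorem top_eq_of_take_eq {s r : Mem} {k i : ℕ} (h : (s i).take (k + 1) = (r i).take (k + 1)) :
    top s i = top r i := by
  unfold top
  cases hs : s i <;> cases hr : r i <;> simp_all

theorem take_eq_of_take_eq_add {a b : List ℚ} {k l : ℕ} (h : a.take (k + l) = b.take (k + l)) :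
    a.take k = b.take k := by
  have := congrArg (List.take k) h
  simpa [List.take_take] using this

theorem Test.holds_congr_of_take {b : Test} {s r : Mem} {k : ℕ}
    (h : ∀ i, (s i).take (k + 1) = (r i).take (k + 1)) : b.Holds s ↔ b.Holds r := by
  cases b with
  | nonempty i =>
    have := h i
    cases hs : s i <;> cases hr : r i <;> simp_all [Test.Holds]
  | pos i => simp [Test.Holds, top_eq_of_take_eq (h i)]

theorem take_pushOn {s r : Mem} {k : ℕ} (h : ∀ i, (s i).take (k + 1) = (r i).take (k + 1))
    (j : ℕ) (c : ℚ) (i : ℕ) : (pushOn s j c i).take k = (pushOn r j c i).take k := by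
  have hi := take_eq_of_take_eq_add (h i)
  rcases eq_or_ne i j with rfl | hij
  · cases k with
    | zero => simp
    | succ k => simpa [pushOn] using take_eq_of_take_eq_add hi
  · simpa [pushOn, hij] using hi

/-- In `t` steps a program sees at most the `t` topmost cells of every stack. -/
theorem Exec.locality {p : Prog} {s s' : Mem} {t : ℕ} (h : Exec ℓ p s t s') :
    ∀ (k : ℕ) (r : Mem), (∀ i, (s i).take (k + t) = (r i).take (k + t)) →
      ∃ r', Exec ℓ p r t r' ∧ ∀ i, (s' i).take k = (r' i).take k := by
  induction h with
  | push c j s => exact fun k r hr => ⟨_, .push c j r, take_pushOn hr j c⟩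
  | pop j s =>
    refine fun k r hr => ⟨_, .pop j r, fun i => ?_⟩
    rcases eq_or_ne i j with rfl | hij
    · have := hr i
      cases hs : s i <;> cases hr' : r i <;> simp_all [popOff]
    · simpa [popOff, hij] using take_eq_of_take_eq_add (hr i)
  | copy j' j s =>
    exact fun k r hr => ⟨_, .copy j' j r, by
      rw [top_eq_of_take_eq (hr j')]; exact take_pushOn hr _ _⟩
  | arith o j' j'' j s =>
    exact fun k r hr => ⟨_, .arith o j' j'' j r, by
      rw [top_eq_of_take_eq (hr j'), top_eq_of_take_eq (hr j'')]; exact take_pushOn hr _ _⟩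
  | loss j' j s =>
    exact fun k r hr => ⟨_, .loss j' j r, by
      rw [top_eq_of_take_eq (hr j')]; exact take_pushOn hr _ _⟩
  | @seq _ _ _ _ _ t₁ t₂ _ _ ih₁ ih₂ =>
    intro k r hr
    obtain ⟨r₁, h₁, hr₁⟩ := ih₁ (k + t₂) r (by simpa [add_assoc, add_comm t₁] using hr)
    obtain ⟨r₂, h₂, hr₂⟩ := ih₂ k r₁ hr₁
    exact ⟨r₂, .seq h₁ h₂, hr₂⟩
  | @branch_true _ _ _ _ _ t hb _ ih =>
    intro k r hr
    obtain ⟨r', h, hr'⟩ := ih k r fun i => take_eq_of_take_eq_add (l := 1) (hr i)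
    exact ⟨r', .branch_true ((Test.holds_congr_of_take (k := k + t) hr).1 hb) h, hr'⟩
  | @branch_false _ _ _ _ _ t hb _ ih =>
    intro k r hr
    obtain ⟨r', h, hr'⟩ := ih k r fun i => take_eq_of_take_eq_add (l := 1) (hr i)
    exact ⟨r', .branch_false (mt (Test.holds_congr_of_take (k := k + t) hr).2 hb) h, hr'⟩
  | @loop_true _ _ _ _ _ t₁ t₂ hb _ _ ih₁ ih₂ =>
    intro k r hr
    have ht : k + (t₁ + t₂ + 1) = k + t₂ + t₁ + 1 := by omega
    have hr0 := ht ▸ hr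
    obtain ⟨r₁, h₁, hr₁⟩ := ih₁ (k + t₂) r fun i => take_eq_of_take_eq_add (hr0 i)
    obtain ⟨r₂, h₂, hr₂⟩ := ih₂ k r₁ hr₁
    exact ⟨r₂, .loop_true ((Test.holds_congr_of_take hr0).1 hb) h₁ h₂, hr₂⟩
  | loop_false hb =>
    exact fun k r hr => ⟨r, .loop_false (mt (Test.holds_congr_of_take hr).2 hb),
      fun i => take_eq_of_take_eq_add (hr i)⟩

/-- Identifies the run obtained from `Exec.locality` with the run whose output is known to be
optimal. -/
theorem Exec.deterministic {p : Prog} {s s₁ s₂ : Mem} {t₁ t₂ : ℕ} (h₁ : Exec ℓ p s t₁ s₁)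
    (h₂ : Exec ℓ p s t₂ s₂) : s₁ = s₂ := by
  induction h₁ generalizing t₂ s₂ with
  | push | pop | copy | arith | loss => cases h₂; rfl
  | seq _ _ ih₁ ih₂ =>
    cases h₂ with
    | seq h h' => cases ih₁ h; exact ih₂ h'
  | branch_true hb _ ih =>
    cases h₂ with
    | branch_true _ h => exact ih h
    | branch_false hb' _ => exact absurd hb hb'
  | branch_false hb _ ih =>
    cases h₂ with
    | branch_true hb' _ => exact absurd hb' hb
    | branch_false _ h => exact ih h
  | loop_true hb _ _ ih₁ ih₂ =>
    cases h₂ with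
    | loop_true _ h h' => cases ih₁ h; exact ih₂ h'
    | loop_false hb' => exact absurd hb hb'
  | loop_false hb =>
    cases h₂ with
    | loop_true hb' _ _ => exact absurd hb' hb
    | loop_false _ => rfl

/-! ### Specifications with step bounds -/

/-- Started in `s`, the program `p` halts after at most `B` steps in a memory satisfying `Q`. -/
def Runs (ℓ : ℚ → ℚ) (p : Prog) (s : Mem) (B : ℕ) (Q : Mem → Prop) : Prop :=
  ∃ t s', Exec ℓ p s t s' ∧ t ≤ B ∧ Q s'

namespace Runs

variable {p q : Prog} {s : Mem} {B B₁ B₂ : ℕ} {Q Q₁ Q₂ : Mem → Prop}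

theorem mono (h : Runs ℓ p s B₁ Q₁) (hB : B₁ ≤ B₂) (hQ : ∀ s', Q₁ s' → Q₂ s') :
    Runs ℓ p s B₂ Q₂ := by
  obtain ⟨t, s', he, ht, hs⟩ := h
  exact ⟨t, s', he, ht.trans hB, hQ s' hs⟩

theorem imp (h : Runs ℓ p s B Q₁) (hQ : ∀ s', Q₁ s' → Q₂ s') : Runs ℓ p s B Q₂ :=
  h.mono le_rfl hQ

theorem le (h : Runs ℓ p s B₁ Q) (hB : B₁ ≤ B₂) : Runs ℓ p s B₂ Q :=
  h.mono hB fun _ => id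

theorem frame (h : Runs ℓ p s B Q) : Runs ℓ p s B fun s' => Q s' ∧ ∀ i ∉ p.mods, s' i = s i := by
  obtain ⟨t, s', he, ht, hs⟩ := h
  exact ⟨t, s', he, ht, hs, fun i hi => he.eq_of_notMem_mods hi⟩

theorem seq (h : Runs ℓ p s B₁ fun s' => Runs ℓ q s' B₂ Q) : Runs ℓ (.seq p q) s (B₁ + B₂) Q := by
  obtain ⟨t₁, s₁, he₁, ht₁, t₂, s₂, he₂, ht₂, hQ⟩ := h
  exact ⟨t₁ + t₂, s₂, .seq he₁ he₂, add_le_add ht₁ ht₂, hQ⟩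

/-- Sequential composition, where the first program is described by its own specification and the
stacks it leaves alone. -/
theorem andThen (hp : Runs ℓ p s B₁ Q₁)
    (hq : ∀ s', Q₁ s' → (∀ i ∉ p.mods, s' i = s i) → Runs ℓ q s' B₂ Q₂) :
    Runs ℓ (.seq p q) s (B₁ + B₂) Q₂ :=
  seq (hp.frame.imp fun s' h => hq s' h.1 h.2)

theorem branch {b : Test} (h₁ : b.Holds s → Runs ℓ p s B Q) (h₂ : ¬ b.Holds s → Runs ℓ q s B Q) :
    Runs ℓ (.branch b p q) s (B + 1) Q := by
  by_cases hb : b.Holds s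
  · obtain ⟨t, s', he, ht, hQ⟩ := h₁ hb
    exact ⟨t + 1, s', .branch_true hb he, by omega, hQ⟩
  · obtain ⟨t, s', he, ht, hQ⟩ := h₂ hb
    exact ⟨t + 1, s', .branch_false hb he, by omega, hQ⟩

theorem loop_false {b : Test} (hb : ¬ b.Holds s) (hQ : Q s) : Runs ℓ (.loop b p) s 1 Q :=
  ⟨1, s, .loop_false hb, le_rfl, hQ⟩

theorem loop_true {b : Test} (hb : b.Holds s)
    (h : Runs ℓ p s B₁ fun s' => Runs ℓ (.loop b p) s' B₂ Q) :
    Runs ℓ (.loop b p) s (B₁ + B₂ + 1) Q := by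
  obtain ⟨t₁, s₁, he₁, ht₁, t₂, s₂, he₂, ht₂, hQ⟩ := h
  exact ⟨t₁ + t₂ + 1, s₂, .loop_true hb he₁ he₂, by omega, hQ⟩

/-- A loop which consumes a list: `I l` says that the list `l` is still to be processed. -/
theorem loop_list {α : Type*} {b : Test} (I : List α → Mem → Prop)
    (hnil : ∀ s, I [] s → ¬ b.Holds s)
    (hcons : ∀ a l s, I (a :: l) s → b.Holds s ∧ Runs ℓ p s B (I l)) (l : List α) :
    ∀ s, I l s → Runs ℓ (.loop b p) s (l.length * (B + 1) + 1) (I []) := by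
  induction l with
  | nil => exact fun s hs => (loop_false (hnil s hs) hs).le (by simp)
  | cons a l ih =>
    intro s hs
    obtain ⟨hb, hr⟩ := hcons a l s hs
    refine (loop_true hb (hr.imp fun s' hs' => ih s' hs')).le ?_
    simp only [List.length_cons]; ring_nf; omega

theorem push (c : ℚ) (i : ℕ) (h : Q (pushOn s i c)) : Runs ℓ (.push c i) s 1 Q :=
  ⟨1, _, .push c i s, le_rfl, h⟩

theorem pop (i : ℕ) (h : Q (popOff s i)) : Runs ℓ (.pop i) s 1 Q :=
  ⟨1, _, .pop i s, le_rfl, h⟩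

theorem copy (i j : ℕ) (h : Q (pushOn s j (top s i))) : Runs ℓ (.copy i j) s 1 Q :=
  ⟨1, _, .copy i j s, le_rfl, h⟩

theorem arith (o : Op) (i j k : ℕ) (h : Q (pushOn s k (o.eval (top s i) (top s j)))) :
    Runs ℓ (.arith o i j k) s 1 Q :=
  ⟨1, _, .arith o i j k s, le_rfl, h⟩

theorem loss (i j : ℕ) (h : Q (pushOn s j (ℓ (top s i)))) : Runs ℓ (.loss i j) s 1 Q :=
  ⟨1, _, .loss i j s, le_rfl, h⟩

end Runs

@[simp] theorem pushOn_self (s : Mem) (i : ℕ) (c : ℚ) : pushOn s i c i = c :: s i := by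
  simp [pushOn]

theorem pushOn_of_ne (s : Mem) {i j : ℕ} (c : ℚ) (h : i ≠ j) : pushOn s j c i = s i := by
  simp [pushOn, h]

@[simp] theorem top_pushOn_self (s : Mem) (i : ℕ) (c : ℚ) : top (pushOn s i c) i = c := by
  simp [top]

theorem top_congr {s r : Mem} {i : ℕ} (h : s i = r i) : top s i = top r i := by
  simp [top, h]

@[simp] theorem popOff_self (s : Mem) (i : ℕ) : popOff s i i = (s i).tail := by
  simp [popOff]

theorem popOff_of_ne (s : Mem) {i j : ℕ} (h : i ≠ j) : popOff s j i = s i := by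
  simp [popOff, h]

/-! ### Memory blocks -/

/-- Stack `i` of block `a`.  The blocks `1, 2, …` partition the stacks `≥ K`, except that block `0`
is reserved for the stacks `< K`. -/
def addr (K a i : ℕ) : ℕ := K + Nat.pair a i

/-- The block of a stack. -/
def blk (K i : ℕ) : ℕ := if i < K then 0 else (i - K).unpair.1

@[simp] theorem blk_addr (K a i : ℕ) : blk K (addr K a i) = a := by
  simp [blk, addr]

theorem blk_of_lt {K i : ℕ} (h : i < K) : blk K i = 0 := by simp [blk, h]

@[simp] theorem addr_inj {K a i b j : ℕ} : addr K a i = addr K b j ↔ a = b ∧ i = j := by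
  simp [addr]

theorem lt_addr {K i : ℕ} (h : i < K) (a j : ℕ) : i ≠ addr K a j := by
  unfold addr; omega

/-- The two memories agree outside the blocks in `A`. -/
def Same (K : ℕ) (A : Set ℕ) (s s' : Mem) : Prop := ∀ i, blk K i ∉ A → s' i = s i

theorem Same.addr {K : ℕ} {A : Set ℕ} {s s' : Mem} (h : Same K A s s') {a : ℕ} (ha : a ∉ A)
    (i : ℕ) : s' (addr K a i) = s (addr K a i) := h _ (by simpa using ha)

theorem Same.top {K : ℕ} {A : Set ℕ} {s s' : Mem} (h : Same K A s s') {a : ℕ} (ha : a ∉ A)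
    (i : ℕ) : top s' (PWA.addr K a i) = top s (PWA.addr K a i) := top_congr (h.addr ha i)

theorem Same.low {K : ℕ} {A : Set ℕ} {s s' : Mem} (h : Same K A s s') (hA : 0 ∉ A) {i : ℕ}
    (hi : i < K) : s' i = s i := h _ (by simpa [blk_of_lt hi] using hA)

theorem Same.mono {K : ℕ} {A B : Set ℕ} {s s' : Mem} (h : Same K A s s') (hAB : A ⊆ B) :
    Same K B s s' := fun i hi => h i fun h => hi (hAB h)

theorem Same.refl (K : ℕ) (A : Set ℕ) (s : Mem) : Same K A s s := fun _ _ => rfl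

theorem Same.trans {K : ℕ} {A : Set ℕ} {s s' s'' : Mem} (h : Same K A s s')
    (h' : Same K A s' s'') : Same K A s s'' := fun i hi => (h' i hi).trans (h i hi)

theorem same_pushOn {K : ℕ} {A : Set ℕ} {i : ℕ} (h : blk K i ∈ A) (s : Mem) (c : ℚ) :
    Same K A s (pushOn s i c) := by
  intro j hj
  rw [pushOn_of_ne]
  rintro rfl
  exact hj h

/-- The program changes only stacks of the blocks in `A`. -/
def Prog.Touches (K : ℕ) (p : Prog) (A : Set ℕ) : Prop := ∀ i ∈ p.mods, blk K i ∈ A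

namespace Prog.Touches

variable {K : ℕ} {p q : Prog} {A B : Set ℕ}

theorem mono (h : p.Touches K A) (hAB : A ⊆ B) : p.Touches K B := fun i hi => hAB (h i hi)

@[simp] theorem seq_iff : (Prog.seq p q).Touches K A ↔ p.Touches K A ∧ q.Touches K A := by
  simp [Touches, mods, or_imp, forall_and]

@[simp] theorem branch_iff {b : Test} :
    (Prog.branch b p q).Touches K A ↔ p.Touches K A ∧ q.Touches K A := by
  simp [Touches, mods, or_imp, forall_and]

@[simp] theorem loop_iff {b : Test} : (Prog.loop b p).Touches K A ↔ p.Touches K A := Iff.rfl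

@[simp] theorem push_iff {c : ℚ} {i : ℕ} : (Prog.push c i).Touches K A ↔ blk K i ∈ A := by
  simp [Touches, mods]

@[simp] theorem pop_iff {i : ℕ} : (Prog.pop i).Touches K A ↔ blk K i ∈ A := by
  simp [Touches, mods]

@[simp] theorem copy_iff {i j : ℕ} : (Prog.copy i j).Touches K A ↔ blk K j ∈ A := by
  simp [Touches, mods]

@[simp] theorem arith_iff {o : Op} {i j k : ℕ} :
    (Prog.arith o i j k).Touches K A ↔ blk K k ∈ A := by
  simp [Touches, mods]

@[simp] theorem loss_iff {i j : ℕ} : (Prog.loss i j).Touches K A ↔ blk K j ∈ A := by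
  simp [Touches, mods]

end Prog.Touches

theorem Prog.touches_low {K : ℕ} {p : Prog} (h : p.bound ≤ K) : p.Touches K {0} := by
  have key : ∀ p : Prog, ∀ i ∈ p.mods, i < p.bound := by
    intro p
    induction p with
    | seq p q hp hq =>
      rintro i (hi | hi)
      · exact lt_max_of_lt_left (hp i hi)
      · exact lt_max_of_lt_right (hq i hi)
    | branch b p q hp hq =>
      rintro i (hi | hi)
      · exact lt_max_of_lt_right (lt_max_of_lt_left (hp i hi))
      · exact lt_max_of_lt_right (lt_max_of_lt_right (hq i hi))
    | loop b p hp => exact fun i hi => lt_max_of_lt_right (hp i hi)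
    | _ => simp [mods, bound]
  exact fun i hi => blk_of_lt ((key p i hi).trans_le h)

namespace Runs

variable {K : ℕ} {p q : Prog} {s : Mem} {B B₁ B₂ : ℕ} {Q Q₁ Q₂ : Mem → Prop} {A : Set ℕ}

theorem same (h : Runs ℓ p s B Q) (hA : p.Touches K A) :
    Runs ℓ p s B fun s' => Q s' ∧ Same K A s s' :=
  h.frame.imp fun _ h => ⟨h.1, fun i hi => h.2 i fun h' => hi (hA i h')⟩

theorem next (hp : Runs ℓ p s B₁ Q₁) (hA : p.Touches K A)
    (hq : ∀ s', Q₁ s' → Same K A s s' → Runs ℓ q s' B₂ Q₂) : Runs ℓ (.seq p q) s (B₁ + B₂) Q₂ :=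
  seq ((hp.same hA).imp fun s' h => hq s' h.1 h.2)

end Runs

/-! ### Arithmetic expressions -/

/-- Arithmetic expressions over the tops of the stacks of the blocks `≥ 2`. -/
inductive Expr
  /-- the top of stack `i` of block `a + 2` -/
  | reg (a i : ℕ)
  /-- a constant -/
  | const (c : ℚ)
  /-- an arithmetic operation -/
  | op (o : Op) (e f : Expr)

namespace Expr

/-- The value of an expression. -/
def eval (K : ℕ) (s : Mem) : Expr → ℚ
  | reg a i => top s (addr K (a + 2) i)
  | const c => c
  | op o e f => o.eval (e.eval K s) (f.eval K s)

/-- A program which pushes the value of an expression onto stack `k` of block `1`. -/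
def compile (K : ℕ) : Expr → ℕ → Prog
  | reg a i, k => .copy (addr K (a + 2) i) (addr K 1 k)
  | const c, k => .push c (addr K 1 k)
  | op o e f, k => .seq (e.compile K k) (.seq (f.compile K (k + 1))
      (.arith o (addr K 1 k) (addr K 1 (k + 1)) (addr K 1 k)))

/-- The number of steps needed to evaluate an expression. -/
def cost : Expr → ℕ
  | reg _ _ => 1
  | const _ => 1
  | op _ e f => e.cost + (f.cost + 1)

/-- Stack discipline: a subexpression evaluated at scratch level k + 1 leaves level k alone, so the
left operand survives the evaluation of the right one. -/
theorem exists_of_mem_mods_compile {K : ℕ} (e : Expr) :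
    ∀ k, ∀ i ∈ (e.compile K k).mods, ∃ k' ≥ k, i = addr K 1 k' := by
  induction e with
  | reg a i => rintro k _ rfl; exact ⟨k, le_rfl, rfl⟩
  | const c => rintro k _ rfl; exact ⟨k, le_rfl, rfl⟩
  | op o e f he hf =>
    rintro k i (hi | hi | hi)
    · exact he k i hi
    · obtain ⟨k', hk, rfl⟩ := hf _ i hi
      exact ⟨k', by omega, rfl⟩
    · exact ⟨k, le_rfl, hi⟩

theorem touches_compile (K : ℕ) (e : Expr) (k : ℕ) : (e.compile K k).Touches K {1} := by
  intro i hi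
  obtain ⟨k', -, rfl⟩ := e.exists_of_mem_mods_compile k i hi
  simp

theorem eval_congr {K : ℕ} {s s' : Mem} (h : Same K {1} s s') (e : Expr) :
    e.eval K s' = e.eval K s := by
  induction e with
  | reg a i => exact h.top (by simp) i
  | const c => rfl
  | op o e f he hf => simp [eval, he, hf]

theorem runs_compile (K : ℕ) (e : Expr) : ∀ (k : ℕ) (s : Mem),
    Runs ℓ (e.compile K k) s e.cost fun s' => top s' (addr K 1 k) = e.eval K s := by
  induction e with
  | reg a i => exact fun k s => .copy _ _ (by simp [eval])
  | const c => exact fun k s => .push _ _ (by simp [eval])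
  | op o e f he hf =>
    intro k s
    refine (he k s).next (touches_compile K e k) fun s₁ h₁ hs₁ => ?_
    refine (hf (k + 1) s₁).andThen fun s₂ h₂ hs₂ => .arith _ _ _ _ ?_
    have hk : s₂ (addr K 1 k) = s₁ (addr K 1 k) := hs₂ _ fun h => by
      obtain ⟨k', hk', h⟩ := f.exists_of_mem_mods_compile _ _ h
      simp only [addr_inj] at h
      omega
    simp [h₂, top_congr hk, h₁, eval, eval_congr hs₁]

/-- The sum of a list of expressions. -/
def sum (l : List Expr) : Expr := l.foldr (op .add) (const 0)

/-- The product of a list of expressions. -/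
def prod (l : List Expr) : Expr := l.foldr (op .mul) (const 1)

variable {K : ℕ} {s : Mem}

@[simp] theorem eval_const (c : ℚ) : (const c).eval K s = c := rfl

@[simp] theorem eval_op (o : Op) (e f : Expr) :
    (op o e f).eval K s = o.eval (e.eval K s) (f.eval K s) := rfl

theorem eval_sum (l : List Expr) : (sum l).eval K s = (l.map (eval K s)).sum := by
  induction l with
  | nil => rfl
  | cons e l ih => simp [sum, Op.eval, ← ih]

theorem eval_prod (l : List Expr) : (prod l).eval K s = (l.map (eval K s)).prod := by
  induction l with
  | nil => rfl
  | cons e l ih => simp [prod, Op.eval, ← ih]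

/-- The sum of a finite family of expressions. -/
noncomputable def fsum {ι : Type*} [Fintype ι] (f : ι → Expr) : Expr :=
  sum (Finset.univ.toList.map f)

/-- The product of a finite family of expressions. -/
noncomputable def fprod {ι : Type*} [Fintype ι] (f : ι → Expr) : Expr :=
  prod (Finset.univ.toList.map f)

@[simp] theorem eval_fsum {ι : Type*} [Fintype ι] (f : ι → Expr) :
    (fsum f).eval K s = ∑ i, (f i).eval K s := by
  simp [fsum, eval_sum, Function.comp_def, Finset.sum_map_toList]

@[simp] theorem eval_fprod {ι : Type*} [Fintype ι] (f : ι → Expr) :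
    (fprod f).eval K s = ∏ i, (f i).eval K s := by
  simp [fprod, eval_prod, Function.comp_def, Finset.prod_map_toList]

/-- The determinant of a matrix of expressions. -/
noncomputable def det {n : ℕ} (M : Matrix (Fin n) (Fin n) Expr) : Expr :=
  fsum fun σ : Equiv.Perm (Fin n) =>
    op .mul (const ((Equiv.Perm.sign σ : ℤ) : ℚ)) (fprod fun i => M (σ i) i)

@[simp] theorem eval_det {n : ℕ} (M : Matrix (Fin n) (Fin n) Expr) :
    (det M).eval K s = (M.map (eval K s)).det := by
  simp [det, Matrix.det_apply', Op.eval]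

/-- The `i`-th coordinate of the solution of a linear system, by Cramer's rule. -/
noncomputable def solve {n : ℕ} (M : Matrix (Fin n) (Fin n) Expr) (b : Fin n → Expr) (i : Fin n) :
    Expr :=
  op .div (det (M.updateCol i b)) (det M)

/-- The top of stack `i` of block `b`, for `2 ≤ b`. -/
def cell (b i : ℕ) : Expr := reg (b - 2) i

theorem eval_cell {b : ℕ} (hb : 2 ≤ b) (i : ℕ) : (cell b i).eval K s = top s (addr K b i) := by
  simp [cell, eval, Nat.sub_add_cancel hb]

end Expr

/-- The solution of a linear system by Cramer's rule. -/
def cramerSol {n : ℕ} (M : Matrix (Fin n) (Fin n) ℚ) (b : Fin n → ℚ) (i : Fin n) : ℚ :=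
  (M.updateCol i b).det / M.det

theorem Expr.eval_solve {K : ℕ} {s : Mem} {n : ℕ} (M : Matrix (Fin n) (Fin n) Expr)
    (b : Fin n → Expr) (i : Fin n) : (Expr.solve M b i).eval K s =
      cramerSol (M.map (Expr.eval K s)) (fun j => (b j).eval K s) i := by
  simp only [Expr.solve, Expr.eval_op, Op.eval, Expr.eval_det, cramerSol]
  congr 3
  ext j k
  by_cases h : k = i
  · subst h; simp
  · simp [h]

/-! ### Sequences of instructions -/

/-- A step without relevant effect. -/
def skip (K : ℕ) : Prog := .push 0 (addr K 1 0)

@[simp] theorem touches_skip {K : ℕ} {A : Set ℕ} : (skip K).Touches K A ↔ 1 ∈ A := by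
  simp [skip]

theorem runs_skip {K : ℕ} {s : Mem} {Q : Mem → Prop} (h : ∀ s', Same K {1} s s' → Q s') :
    Runs ℓ (skip K) s 1 Q :=
  .push _ _ (h _ (same_pushOn (by simp) _ _))

/-- Run `f a` for all elements `a` of a list, in order. -/
def forList {α : Type*} (K : ℕ) (l : List α) (f : α → Prog) : Prog :=
  l.foldr (fun a p => .seq (f a) p) (skip K)

theorem touches_forList {α : Type*} {K : ℕ} {l : List α} {f : α → Prog} {A : Set ℕ} (h1 : 1 ∈ A)
    (h : ∀ a ∈ l, (f a).Touches K A) : (forList K l f).Touches K A := by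
  induction l with
  | nil => simpa [forList] using h1
  | cons a l ih =>
    exact Prog.Touches.seq_iff.2 ⟨h a (by simp), ih fun b hb => h b (by simp [hb])⟩

/-- The final `skip` pushes onto scratch block 1. Stating the conclusion through an intermediate
memory s₀ spares the invariant from being stable under changes of that block. -/
theorem runs_forList {α : Type*} {K : ℕ} {f : α → Prog} {B : ℕ} (I : List α → Mem → Prop)
    (hf : ∀ a l s, I (a :: l) s → Runs ℓ (f a) s B (I l)) (l : List α) :
    ∀ s, I l s → Runs ℓ (forList K l f) s (l.length * B + 1)
      (fun s' => ∃ s₀, I [] s₀ ∧ Same K {1} s₀ s') := by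
  induction l with
  | nil => exact fun s hs => (runs_skip fun s' h => ⟨s, hs, h⟩).le (by simp)
  | cons a l ih =>
    intro s hs
    refine ((hf a l s hs).imp fun s' hs' => ih s' hs').seq.le ?_
    simp only [List.length_cons]; ring_nf; omega

/-- Push the value of an expression onto stack `i` of block `b`. -/
def assign (K b i : ℕ) (e : Expr) : Prog := .seq (e.compile K 0) (.copy (addr K 1 0) (addr K b i))

theorem touches_assign {K b i : ℕ} {e : Expr} {A : Set ℕ} (h1 : 1 ∈ A) (hb : b ∈ A) :
    (assign K b i e).Touches K A := by
  simpa [assign, hb] using (e.touches_compile K 0).mono (by simpa using h1)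

theorem runs_assign {K b i : ℕ} (e : Expr) (s : Mem) : Runs ℓ (assign K b i e) s (e.cost + 1)
    fun s' => top s' (addr K b i) = e.eval K s ∧
      ∀ j, blk K j ≠ 1 → j ≠ addr K b i → s' j = s j := by
  refine (e.runs_compile K 0 s).next (e.touches_compile K 0) fun s₁ h₁ hs₁ => .copy _ _ ?_
  exact ⟨by simpa using h₁, fun j hj hj' => by rw [pushOn_of_ne _ _ hj', hs₁ j hj]⟩

/-- Push the values of a finite family of expressions onto stacks of block `b`. -/
noncomputable def assignAll {ι : Type*} [Fintype ι] (K b : ℕ) (idx : ι → ℕ) (e : ι → Expr) : Prog :=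
  forList K Finset.univ.toList fun i => assign K b (idx i) (e i)

theorem touches_assignAll {ι : Type*} [Fintype ι] {K b : ℕ} {idx : ι → ℕ} {e : ι → Expr}
    {A : Set ℕ} (h1 : 1 ∈ A) (hb : b ∈ A) : (assignAll K b idx e).Touches K A :=
  touches_forList h1 fun _ _ => touches_assign h1 hb

/-- The assignments are sequential, but act simultaneously: the expressions must not depend on block
1 or the target block, and distinct targets do not overwrite each other. The step bound C is chosen
before the memory, hence independent of the data. -/
theorem runs_assignAll {ι : Type*} [Fintype ι] (ℓ : ℚ → ℚ) (K : ℕ) {b : ℕ} (hb : b ≠ 1)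
    {idx : ι → ℕ} (hidx : idx.Injective) (e : ι → Expr) : ∃ C, ∀ s : Mem,
      (∀ s', Same K {1, b} s s' → ∀ i, (e i).eval K s' = (e i).eval K s) →
      Runs ℓ (assignAll K b idx e) s C fun s' =>
        ∀ i, top s' (addr K b (idx i)) = (e i).eval K s := by
  classical
  refine ⟨(Finset.univ : Finset ι).toList.length * ((Finset.univ : Finset ι).sup (fun i => (e i).cost) + 1) + 1,
    fun s he => ?_⟩
  let I : List ι → Mem → Prop := fun l s' => Same K {1, b} s s' ∧
    ∀ i, i ∉ l → top s' (addr K b (idx i)) = (e i).eval K s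
  have hstep : ∀ a l s', I (a :: l) s' → Runs ℓ (assign K b (idx a) (e a)) s'
      ((Finset.univ : Finset ι).sup (fun i => (e i).cost) + 1) (I l) := by
    rintro a l s' ⟨h1, h2⟩
    have := (runs_assign (ℓ := ℓ) (K := K) (b := b) (i := idx a) (e a) s').same
      (touches_assign (A := {1, b}) (by simp) (by simp))
    refine this.mono ?_ ?_
    · exact Nat.succ_le_succ (Finset.le_sup (f := fun i => (e i).cost) (Finset.mem_univ a))
    · rintro s'' ⟨⟨h3, h4⟩, h5⟩
      refine ⟨h1.trans h5, fun i hi => ?_⟩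
      by_cases hia : i = a
      · subst hia; rw [h3, he s' h1]
      · rw [top_congr (h4 _ (by simpa using hb) (by simpa using fun h => hia (hidx h)))]
        exact h2 i (by simp [hia, hi])
  refine (runs_forList I hstep _ s ⟨Same.refl _ _ _, fun i hi => by simp at hi⟩).imp ?_
  rintro s' ⟨s₀, ⟨-, h⟩, h'⟩ i
  rw [h'.top (by simpa using hb), h i (by simp)]

/-! ### Storing and traversing the data -/

/-- The vector in block `b`. -/
def vec (K b : ℕ) (d : ℕ) (s : Mem) : Fin (d + 1) → ℚ := fun c => top s (addr K b c)

theorem Same.vec {K : ℕ} {A : Set ℕ} {s s' : Mem} (h : Same K A s s') {b : ℕ} (hb : b ∉ A)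
    (d : ℕ) : vec K b d s' = vec K b d s := funext fun _ => h.top hb _

/-- A list of data points as a list of rational numbers. -/
def enc {d : ℕ} (Z : List (Fin (d + 1) → ℚ)) : List ℚ := (Z.map List.ofFn).flatten

@[simp] theorem enc_nil {d : ℕ} : enc ([] : List (Fin (d + 1) → ℚ)) = [] := rfl

@[simp] theorem enc_cons {d : ℕ} (z : Fin (d + 1) → ℚ) (Z : List (Fin (d + 1) → ℚ)) :
    enc (z :: Z) = List.ofFn z ++ enc Z := by simp [enc]

@[simp] theorem enc_append {d : ℕ} (Z Z' : List (Fin (d + 1) → ℚ)) :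
    enc (Z ++ Z') = enc Z ++ enc Z' := by simp [enc]

@[simp] theorem length_enc {d : ℕ} (Z : List (Fin (d + 1) → ℚ)) :
    (enc Z).length = Z.length * (d + 1) := by
  induction Z with
  | nil => simp
  | cons z Z ih => simp [ih]; ring

/-- Move the content of stack `i` to stacks `j` and `k`. -/
def move (i j k : ℕ) : Prog := .loop (.nonempty i) (.seq (.copy i j) (.seq (.copy i k) (.pop i)))

theorem runs_move {i j k : ℕ} (hij : i ≠ j) (hik : i ≠ k) (hjk : j ≠ k) (s : Mem) :
    Runs ℓ (move i j k) s ((s i).length * 4 + 1) fun s' =>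
      s' i = [] ∧ s' j = (s i).reverse ++ s j ∧ s' k = (s i).reverse ++ s k := by
  let I : List ℚ → Mem → Prop := fun l s' => s' i = l ∧ ∃ pre, s i = pre ++ l ∧
    s' j = pre.reverse ++ s j ∧ s' k = pre.reverse ++ s k
  refine ((Runs.loop_list (B := 3) I ?_ ?_ (s i) s ⟨rfl, [], by simp⟩).imp ?_)
  · rintro s' ⟨h, -⟩
    simp [Test.Holds, h]
  · rintro a l s' ⟨h, pre, h1, h2, h3⟩
    refine ⟨by simp [Test.Holds, h], ?_⟩
    refine (Runs.seq (.copy _ _ (.seq (.copy _ _ (.pop _ ?_)))) : Runs ℓ _ _ (1 + (1 + 1)) _)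
    have e1 : top s' i = a := by simp [top, h]
    have e2 : top (pushOn s' j (top s' i)) i = a := by
      rw [top_congr (pushOn_of_ne _ _ hij), e1]
    refine ⟨?_, pre ++ [a], by simpa using h1, ?_, ?_⟩
    · rw [popOff_self, pushOn_of_ne _ _ hik, pushOn_of_ne _ _ hij, h]; rfl
    · rw [popOff_of_ne _ hij.symm, pushOn_of_ne _ _ hjk, pushOn_self, h2, e1]; simp
    · rw [popOff_of_ne _ hik.symm, pushOn_self, pushOn_of_ne _ _ hjk.symm, h3, e2]; simp
  · rintro s' ⟨h, pre, h1, h2, h3⟩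
    simp only [List.append_nil] at h1
    subst h1
    exact ⟨h, h2, h3⟩

/-- Empty all stacks `< K`. -/
def clearLow (K : ℕ) : Prog := forList K (List.range K) fun i => .loop (.nonempty i) (.pop i)

theorem touches_clearLow (K : ℕ) : (clearLow K).Touches K {0, 1} := by
  refine touches_forList (by simp) fun i hi => ?_
  simp [blk_of_lt (List.mem_range.1 hi)]

theorem runs_clearLow {K L : ℕ} {s : Mem} (hs : ∀ i < K, (s i).length ≤ L) :
    Runs ℓ (clearLow K) s (K * (L * 2 + 1) + 1) fun s' => ∀ i < K, s' i = [] := by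
  let I : List ℕ → Mem → Prop := fun l s' => (∀ i < K, (s' i).length ≤ L) ∧ (∀ i ∈ l, i < K) ∧
    ∀ i < K, i ∉ l → s' i = []
  refine ((runs_forList (B := L * 2 + 1) I ?_ (List.range K) s
    ⟨hs, by simp, fun i hi h => absurd (List.mem_range.2 hi) h⟩).mono (by simp) ?_)
  · rintro j l s' ⟨h1, h2, h3⟩
    have hj : j < K := h2 j (by simp)
    have := Runs.loop_list (ℓ := ℓ) (b := .nonempty j) (p := .pop j) (B := 1)
      (fun l' s'' => s'' j = l') (by simp +contextual [Test.Holds])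
      (fun a l' s'' h => ⟨by simp [Test.Holds, h], .pop _ (by simp [h])⟩) (s' j) s' rfl
    refine this.frame.mono (by have := h1 j hj; simp; omega) ?_
    rintro s'' ⟨h4, h5⟩
    have h6 : ∀ i, i ≠ j → s'' i = s' i := fun i hi => h5 i (by simpa [Prog.mods] using hi)
    refine ⟨fun i hi => ?_, fun i hi => h2 i (by simp [hi]), fun i hi hil => ?_⟩
    · by_cases hij : i = j
      · subst hij; simp [h4]
      · rw [h6 i hij]; exact h1 i hi
    · by_cases hij : i = j
      · subst hij; exact h4
      · rw [h6 i hij]; exact h3 i hi (by simp [hij, hil])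
  · rintro s' ⟨s₀, ⟨-, -, h⟩, h'⟩ i hi
    rw [h'.low (by simp) hi, h i hi (by simp)]

/-- Move a data point from stack `i` to block `b` and to stack `j`. -/
def load (K d b i j : ℕ) : Prog := forList K (List.finRange (d + 1)) fun c =>
  .seq (.copy i (addr K b c)) (.seq (.copy i j) (.pop i))

theorem touches_load {K d b i j : ℕ} {A : Set ℕ} (h1 : 1 ∈ A) (hb : b ∈ A) (hi : blk K i ∈ A)
    (hj : blk K j ∈ A) : (load K d b i j).Touches K A :=
  touches_forList h1 fun _ _ => by simp [hb, hi, hj]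

theorem runs_load {K d b i j : ℕ} (hb : b ≠ 1) (hij : i ≠ j) (hi : blk K i ≠ b)
    (hj : blk K j ≠ b) (hi' : blk K i ≠ 1) (hj' : blk K j ≠ 1) {z : Fin (d + 1) → ℚ}
    {r : List ℚ} {s : Mem} (hs : s i = List.ofFn z ++ r) :
    Runs ℓ (load K d b i j) s ((d + 1) * 3 + 1) fun s' =>
      vec K b d s' = z ∧ s' i = r ∧ s' j = (List.ofFn z).reverse ++ s j := by
  have hib : ∀ c, addr K b c ≠ i := by rintro c rfl; simp at hi
  have hjb : ∀ c, addr K b c ≠ j := by rintro c rfl; simp at hj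
  let I : List (Fin (d + 1)) → Mem → Prop := fun l s' => s' i = l.map z ++ r ∧
    ∃ pre, List.finRange (d + 1) = pre ++ l ∧ s' j = (pre.map z).reverse ++ s j ∧
      ∀ c ∈ pre, top s' (addr K b c) = z c
  refine ((runs_forList (B := 1 + (1 + 1)) I ?_ (List.finRange (d + 1)) s
    ⟨by rw [hs, List.ofFn_eq_map], [], by simp⟩).mono (by simp) ?_)
  · rintro c l s' ⟨h1, pre, h2, h3, h4⟩
    refine Runs.seq (.copy _ _ (.seq (.copy _ _ (.pop _ ?_))))
    have e1 : top s' i = z c := by simp [top, h1]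
    have e2 : top (pushOn s' (addr K b c) (top s' i)) i = z c := by
      rw [top_congr (pushOn_of_ne _ _ (hib c).symm), e1]
    refine ⟨?_, pre ++ [c], by simpa using h2, ?_, ?_⟩
    · rw [popOff_self, pushOn_of_ne _ _ hij, pushOn_of_ne _ _ (hib c).symm, h1]; rfl
    · rw [popOff_of_ne _ hij.symm, pushOn_self, pushOn_of_ne _ _ (hjb c).symm, h3, e2]; simp
    · intro c' hc'
      rw [top_congr (popOff_of_ne _ (hib c')), top_congr (pushOn_of_ne _ _ (hjb c'))]
      by_cases h : c' = c
      · subst h; simp [e1]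
      · rw [top_congr (pushOn_of_ne _ _ (by simpa [Fin.ext_iff] using h))]
        exact h4 c' (by simpa [h] using hc')
  · rintro s' ⟨s₀, ⟨h1, pre, h2, h3, h4⟩, h'⟩
    simp only [List.append_nil] at h2
    refine ⟨funext fun c => ?_, ?_, ?_⟩
    · rw [vec, h'.top (by simpa using hb), h4 c (by simp [← h2])]
    · rw [h' i (by simpa using hi'), h1]; simp
    · rw [h' j (by simpa using hj'), h3, ← h2, List.ofFn_eq_map]

/-- Run `body` for every data point.  The data are kept in block `3`, the current point in
block `2`; block `4` is auxiliary. -/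
def pass (K d : ℕ) (body : Prog) : Prog :=
  .seq (.loop (.nonempty (addr K 3 0)) (.seq (load K d 2 (addr K 3 0) (addr K 4 0)) body))
    (move (addr K 4 0) (addr K 3 0) (addr K 1 0))

theorem touches_pass {K d : ℕ} {body : Prog} {A : Set ℕ} (h : body.Touches K A)
    (hA : {1, 2, 3, 4} ⊆ A) : (pass K d body).Touches K A := by
  simp only [Set.insert_subset_iff, Set.singleton_subset_iff] at hA
  obtain ⟨h1, h2, h3, h4⟩ := hA
  have := touches_load (K := K) (d := d) (i := addr K 3 0) (j := addr K 4 0) h1 h2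
    (by simpa using h3) (by simpa using h4)
  simp [pass, move, h, h1, h3, h4, this]

/-- The memory holds the data set `Z`. -/
def HasData (K : ℕ) {d : ℕ} (Z : List (Fin (d + 1) → ℚ)) (s : Mem) : Prop :=
  s (addr K 3 0) = enc Z ∧ s (addr K 4 0) = []

theorem HasData.congr {K d : ℕ} {Z : List (Fin (d + 1) → ℚ)} {s s' : Mem} {A : Set ℕ}
    (hs : HasData K Z s) (h : Same K A s s') (h3 : 3 ∉ A) (h4 : 4 ∉ A) : HasData K Z s' :=
  ⟨by rw [h.addr h3, hs.1], by rw [h.addr h4, hs.2]⟩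

/-- Per point: 3(d+1)+1 steps to load it, B for the body, one loop test, and 4(d+1) to move it back
afterwards. The invariant refers to the unprocessed suffix and must ignore the blocks used by the
traversal itself. -/
theorem runs_pass {K d B : ℕ} {body : Prog} {A : Set ℕ} (hbA : body.Touches K A)
    (hA : 3 ∉ A ∧ 4 ∉ A) {Z : List (Fin (d + 1) → ℚ)} {s : Mem}
    (I : List (Fin (d + 1) → ℚ) → Mem → Prop)
    (hI : ∀ l s s', I l s → Same K {1, 2, 3, 4} s s' → I l s')
    (hbody : ∀ z l s, z ∈ Z → I (z :: l) s → vec K 2 d s = z → Runs ℓ body s B (I l))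
    (hs : HasData K Z s) (hIs : I Z s) :
    Runs ℓ (pass K d body) s (Z.length * (B + 7 * d + 9) + 2) fun s' => HasData K Z s' ∧ I [] s' := by
  let J : List (Fin (d + 1) → ℚ) → Mem → Prop := fun l s' => I l s' ∧ s' (addr K 3 0) = enc l ∧
    ∃ pre, Z = pre ++ l ∧ s' (addr K 4 0) = (enc pre).reverse
  have hloop := Runs.loop_list (ℓ := ℓ) (b := .nonempty (addr K 3 0))
    (p := .seq (load K d 2 (addr K 3 0) (addr K 4 0)) body) (B := (d + 1) * 3 + 1 + B) J ?_ ?_ Z s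
    ⟨hIs, hs.1, [], by simp [hs.2]⟩
  · refine Runs.le (hloop.imp (Q₂ := fun s' => Runs ℓ _ s' (Z.length * (d + 1) * 4 + 1) _) ?_).seq
      (by ring_nf; omega)
    rintro s' ⟨h1, h2, pre, h3, h4⟩
    simp only [List.append_nil] at h3
    subst h3
    -- The traversal has left the data reversed in block 4; moving it back reverses it again and
    -- restores the original order. The second copy in block 1 is discarded.
    have hm := runs_move (ℓ := ℓ) (i := addr K 4 0) (j := addr K 3 0) (k := addr K 1 0)
      (by simp) (by simp) (by simp) s'
    refine (hm.same (K := K) (A := {1, 2, 3, 4}) (by simp [move])).mono (by simp [h4]) ?_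
    rintro s'' ⟨⟨h5, h6, -⟩, h7⟩
    exact ⟨⟨by rw [h6, h4, h2]; simp, h5⟩, hI _ _ _ h1 h7⟩
  · rintro s' ⟨-, h, -⟩
    simp [Test.Holds, h]
  · rintro z l s' ⟨h1, h2, pre, h3, h4⟩
    refine ⟨by simp [Test.Holds, h2, ← List.length_eq_zero_iff], ?_⟩
    have hl := runs_load (ℓ := ℓ) (K := K) (b := 2) (i := addr K 3 0) (j := addr K 4 0)
      (by simp) (by simp) (by simp) (by simp) (by simp) (by simp) (h2.trans (enc_cons z l))
    refine hl.next (touches_load (A := {1, 2, 3, 4}) (by simp) (by simp) (by simp) (by simp))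
      fun s₁ h5 h6 => ?_
    refine ((hbody z l s₁ (by simp [h3]) (hI _ _ _ h1 h6) h5.1).same hbA).imp ?_
    rintro s₂ ⟨h7, h8⟩
    refine ⟨h7, by rw [h8.addr hA.1, h5.2.1], pre ++ [z], by simpa using h3, ?_⟩
    rw [h8.addr hA.2, h5.2.2, h4]
    simp

/-! ### Classification and evaluation of a classifier -/

/-- The vector `[xᵀ, 1]ᵀ` belonging to the data point `z = [xᵀ, y]ᵀ`. -/
def bar {d : ℕ} (z : Fin (d + 1) → ℚ) : Fin (d + 1) → ℚ := Function.update z (Fin.last d) 1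

/-- The score of category `k` at a data point. -/
def score {d n : ℕ} (θ : Fin n → Fin (d + 1) → ℚ) (k : Fin n) (z : Fin (d + 1) → ℚ) : ℚ :=
  θ k ⬝ᵥ bar z

/-- The residual of an affine model at a data point. -/
def residual {d : ℕ} (v z : Fin (d + 1) → ℚ) : ℚ := z (Fin.last d) - v ⬝ᵥ bar z

theorem exists_isLeast_score {d n : ℕ} (θ : Fin (n + 1) → Fin (d + 1) → ℚ)
    (z : Fin (d + 1) → ℚ) : ∃ j, IsLeast {k | ∀ l, score θ l z ≤ score θ k z} j := by
  obtain ⟨k, hk⟩ := Finite.exists_max fun l => score θ l z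
  obtain ⟨j, hj, hmin⟩ := (Set.toFinite {k | ∀ l, score θ l z ≤ score θ k z}).exists_minimal
    ⟨k, hk⟩
  exact ⟨j, hj, fun l hl => (le_total j l).elim id fun h => hmin hl h⟩

/-- The category of a data point. -/
noncomputable def label {d n : ℕ} (θ : Fin (n + 1) → Fin (d + 1) → ℚ) (z : Fin (d + 1) → ℚ) :
    Fin (n + 1) := (exists_isLeast_score θ z).choose

theorem isLeast_label {d n : ℕ} (θ : Fin (n + 1) → Fin (d + 1) → ℚ) (z : Fin (d + 1) → ℚ) :
    IsLeast {k | ∀ l, score θ l z ≤ score θ k z} (label θ z) :=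
  (exists_isLeast_score θ z).choose_spec

/-- Turns the smallest-index rule for ties into independent pairwise comparisons, strict against
smaller indices and weak against larger ones; each is one positivity test. -/
theorem label_eq_iff {d n : ℕ} {θ : Fin (n + 1) → Fin (d + 1) → ℚ} {z : Fin (d + 1) → ℚ}
    {j : Fin (n + 1)} : label θ z = j ↔
      ∀ k, (k < j → score θ k z < score θ j z) ∧ (j < k → score θ k z ≤ score θ j z) := by
  have hl := isLeast_label θ z
  constructor
  · rintro rfl k
    refine ⟨fun hk => ?_, fun _ => hl.1 k⟩
    by_contra! h
    exact absurd (hl.2 fun l => (hl.1 l).trans h) (not_le.2 hk)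
  · intro h
    refine hl.unique ⟨fun l => ?_, fun k hk => ?_⟩
    · rcases lt_trichotomy l j with hlj | rfl | hlj
      · exact ((h l).1 hlj).le
      · exact le_rfl
      · exact (h l).2 hlj
    · by_contra! hkj
      exact absurd (hk j) (not_le.2 ((h k).1 hkj))

/-- The matrix in block `b`. -/
def mat (K b n d : ℕ) (s : Mem) : Fin n → Fin (d + 1) → ℚ :=
  fun k c => top s (addr K b (Nat.pair k c))

theorem Same.mat {K : ℕ} {A : Set ℕ} {s s' : Mem} (h : Same K A s s') {b : ℕ} (hb : b ∉ A)
    (n d : ℕ) : mat K b n d s' = mat K b n d s := funext fun _ => funext fun _ => h.top hb _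

/-- The coordinates of the vector `[xᵀ, 1]ᵀ` of the current point. -/
def barE (b : ℕ) {d : ℕ} (c : Fin (d + 1)) : Expr :=
  if c = Fin.last d then .const 1 else .cell b c

theorem eval_barE {K b d : ℕ} (hb : 2 ≤ b) {s : Mem} (c : Fin (d + 1)) :
    (barE b c).eval K s = bar (vec K b d s) c := by
  unfold barE bar
  by_cases h : c = Fin.last d
  · simp [h]
  · simp [h, Expr.eval_cell hb, vec]

/-- The score of category `k` at the current point. -/
noncomputable def scoreE {d n : ℕ} (k : Fin n) : Expr :=
  .fsum fun c : Fin (d + 1) => .op .mul (.cell 5 (Nat.pair k c)) (barE 2 c)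

@[simp] theorem eval_scoreE {K d n : ℕ} {s : Mem} (k : Fin n) :
    (scoreE (d := d) k).eval K s = score (mat K 5 n d s) k (vec K 2 d s) := by
  simp [scoreE, score, dotProduct, Op.eval, eval_barE, Expr.eval_cell, mat]

/-- Run `body` if category `j` passes the comparison with all categories in a list. -/
noncomputable def compareAll (K d : ℕ) {n : ℕ} (j : Fin n) (body : Prog) (l : List (Fin n)) :
    Prog :=
  l.foldr (fun k p =>
    if k < j then
      .seq (assign K 13 0 (.op .sub (scoreE (d := d) j) (scoreE (d := d) k)))
        (.branch (.pos (addr K 13 0)) p (skip K))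
    else if j < k then
      .seq (assign K 13 0 (.op .sub (scoreE (d := d) k) (scoreE (d := d) j)))
        (.branch (.pos (addr K 13 0)) (skip K) p)
    else p) body

theorem touches_compareAll {K d n : ℕ} {j : Fin n} {body : Prog} {l : List (Fin n)} {A : Set ℕ}
    (h : body.Touches K A) (h1 : 1 ∈ A) (h13 : 13 ∈ A) :
    (compareAll K d j body l).Touches K A := by
  induction l with
  | nil => exact h
  | cons k l ih =>
    have e : compareAll K d j body (k :: l) = (if k < j then
      .seq (assign K 13 0 (.op .sub (scoreE (d := d) j) (scoreE (d := d) k)))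
        (.branch (.pos (addr K 13 0)) (compareAll K d j body l) (skip K))
      else if j < k then
        .seq (assign K 13 0 (.op .sub (scoreE (d := d) k) (scoreE (d := d) j)))
          (.branch (.pos (addr K 13 0)) (skip K) (compareAll K d j body l))
      else compareAll K d j body l) := rfl
    rw [e]
    split_ifs
    · simp [touches_assign h1 h13, ih, h1]
    · simp [touches_assign h1 h13, ih, h1]
    · exact ih

/-- The body sits at the bottom of the nested branches, so both outcomes are described by a common
postcondition Q, and the overhead C does not depend on the bound B for the body. -/
theorem runs_compareAll (ℓ : ℚ → ℚ) (K d : ℕ) {n : ℕ} (j : Fin n) (body : Prog)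
    (l : List (Fin n)) : ∃ C, ∀ (B : ℕ) (Q : Mem → Prop) (s : Mem),
      (∀ s', Same K {1, 13} s s' →
        (∀ k ∈ l, (k < j → score (mat K 5 n d s) k (vec K 2 d s) <
            score (mat K 5 n d s) j (vec K 2 d s)) ∧
          (j < k → score (mat K 5 n d s) k (vec K 2 d s) ≤
            score (mat K 5 n d s) j (vec K 2 d s))) → Runs ℓ body s' B Q) →
      (∀ s', Same K {1, 13} s s' →
        (¬ ∀ k ∈ l, (k < j → score (mat K 5 n d s) k (vec K 2 d s) <
            score (mat K 5 n d s) j (vec K 2 d s)) ∧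
          (j < k → score (mat K 5 n d s) k (vec K 2 d s) ≤
            score (mat K 5 n d s) j (vec K 2 d s))) → Q s') →
      Runs ℓ (compareAll K d j body l) s (B + C) Q := by
  induction l with
  | nil => exact ⟨0, fun B Q s h1 h2 => h1 s (Same.refl _ _ _) (by simp)⟩
  | cons k l ih =>
    obtain ⟨C, ih⟩ := ih
    rcases lt_trichotomy k j with hkj | hkj | hkj
    · refine ⟨(Expr.op .sub (scoreE (d := d) j) (scoreE (d := d) k)).cost + 1 + (C + 2),
        fun B Q s h1 h2 => ?_⟩
      have e : compareAll K d j body (k :: l) =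
          .seq (assign K 13 0 (.op .sub (scoreE (d := d) j) (scoreE (d := d) k)))
          (.branch (.pos (addr K 13 0)) (compareAll K d j body l) (skip K)) := by
        simp [compareAll, hkj]
      rw [e]
      refine ((runs_assign _ s).next (touches_assign (A := {1, 13}) (by simp) (by simp))
        (B₂ := B + C + 1 + 1) ?_).le (by omega)
      rintro s₁ ⟨h3, -⟩ h4
      have hm := h4.mat (b := 5) (by simp) n d
      have hv := h4.vec (b := 2) (by simp) d
      refine Runs.branch (fun hb => ?_) (fun hb => (runs_skip fun s' h => ?_).le (by omega))
      · refine (ih B Q s₁ (fun s' h5 h6 => ?_) fun s' h5 h6 => ?_).le (by omega)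
        · rw [hm, hv] at h6
          refine h1 s' (h4.trans h5) fun k' hk' => ?_
          rcases List.mem_cons.1 hk' with rfl | hk'
          · refine ⟨fun _ => ?_, fun h => absurd h hkj.asymm⟩
            simpa [Test.Holds, h3, Op.eval] using hb
          · exact h6 k' hk'
        · rw [hm, hv] at h6
          exact h2 s' (h4.trans h5) fun h => h6 fun k' hk' => h k' (by simp [hk'])
      · refine h2 s' (h4.trans (h.mono (by simp))) fun h => hb ?_
        simpa [Test.Holds, h3, Op.eval] using (h k (by simp)).1 hkj
    · refine ⟨C, fun B Q s h1 h2 => ?_⟩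
      have e : compareAll K d j body (k :: l) = compareAll K d j body l := by
        simp [compareAll, hkj]
      have e' : ∀ p : Fin n → Prop, (∀ k' ∈ k :: l, (k' < j → p k') ∧
          (j < k' → score (mat K 5 n d s) k' (vec K 2 d s) ≤
            score (mat K 5 n d s) j (vec K 2 d s))) ↔ ∀ k' ∈ l, (k' < j → p k') ∧
          (j < k' → score (mat K 5 n d s) k' (vec K 2 d s) ≤
            score (mat K 5 n d s) j (vec K 2 d s)) := by
        simp [hkj]
      rw [e]
      rw [e'] at h1 h2
      exact ih B Q s h1 h2
    · refine ⟨(Expr.op .sub (scoreE (d := d) k) (scoreE (d := d) j)).cost + 1 + (C + 2),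
        fun B Q s h1 h2 => ?_⟩
      have e : compareAll K d j body (k :: l) =
          .seq (assign K 13 0 (.op .sub (scoreE (d := d) k) (scoreE (d := d) j)))
          (.branch (.pos (addr K 13 0)) (skip K) (compareAll K d j body l)) := by
        simp [compareAll, hkj, hkj.asymm]
      rw [e]
      refine ((runs_assign _ s).next (touches_assign (A := {1, 13}) (by simp) (by simp))
        (B₂ := B + C + 1 + 1) ?_).le (by omega)
      rintro s₁ ⟨h3, -⟩ h4
      have hm := h4.mat (b := 5) (by simp) n d
      have hv := h4.vec (b := 2) (by simp) d
      refine Runs.branch (fun hb => (runs_skip fun s' h => ?_).le (by omega)) (fun hb => ?_)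
      · refine h2 s' (h4.trans (h.mono (by simp))) fun h => ?_
        have h5 := (h k (by simp)).2 hkj
        simp only [Test.Holds, h3, Expr.eval_op, Op.eval, eval_scoreE] at hb
        linarith
      · refine (ih B Q s₁ (fun s' h5 h6 => ?_) fun s' h5 h6 => ?_).le (by omega)
        · rw [hm, hv] at h6
          refine h1 s' (h4.trans h5) fun k' hk' => ?_
          rcases List.mem_cons.1 hk' with rfl | hk'
          · refine ⟨fun h => absurd h hkj.asymm, fun _ => ?_⟩
            simpa [Test.Holds, h3, Op.eval] using hb
          · exact h6 k' hk'
        · rw [hm, hv] at h6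
          exact h2 s' (h4.trans h5) fun h => h6 fun k' hk' => h k' (by simp [hk'])

/-- Run `body` if the category of the current point is `j`. -/
noncomputable def ifLabel (K d : ℕ) {n : ℕ} (j : Fin n) (body : Prog) : Prog :=
  compareAll K d j body (List.finRange n)

theorem runs_ifLabel (ℓ : ℚ → ℚ) (K d : ℕ) {n : ℕ} (j : Fin (n + 1)) (body : Prog) :
    ∃ C, ∀ (B : ℕ) (Q : Mem → Prop) (s : Mem),
      (∀ s', Same K {1, 13} s s' → label (mat K 5 (n + 1) d s) (vec K 2 d s) = j →
        Runs ℓ body s' B Q) →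
      (∀ s', Same K {1, 13} s s' → label (mat K 5 (n + 1) d s) (vec K 2 d s) ≠ j → Q s') →
      Runs ℓ (ifLabel K d j body) s (B + C) Q := by
  obtain ⟨C, hC⟩ := runs_compareAll ℓ K d j body (List.finRange (n + 1))
  refine ⟨C, fun B Q s h1 h2 => hC B Q s (fun s' h3 h4 => h1 s' h3 ?_)
    fun s' h3 h4 => h2 s' h3 ?_⟩
  · exact label_eq_iff.2 fun k => h4 k (by simp)
  · exact fun h => h4 fun k _ => label_eq_iff.1 h k

/-! ### Optimal submodels for a fixed classifier -/

/-- Push the current point onto stack `0`. -/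
def pushPoint (K d : ℕ) : Prog :=
  forList K (List.finRange (d + 1)).reverse fun c => .copy (addr K 2 c) 0

theorem runs_pushPoint {K : ℕ} (hK : 0 < K) (d : ℕ) (s : Mem) :
    Runs ℓ (pushPoint K d) s (d + 2) fun s' => s' 0 = List.ofFn (vec K 2 d s) ++ s 0 ∧
      ∀ i < K, i ≠ 0 → s' i = s i := by
  have h0 : blk K 0 = 0 := blk_of_lt hK
  let I : List (Fin (d + 1)) → Mem → Prop := fun l s' => Same K {0} s s' ∧
    (∀ i < K, i ≠ 0 → s' i = s i) ∧ ∃ pre, (List.finRange (d + 1)).reverse = pre ++ l ∧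
      s' 0 = (pre.map (vec K 2 d s)).reverse ++ s 0
  refine (runs_forList (B := 1) I ?_ _ s ⟨Same.refl _ _ _, fun _ _ _ => rfl, [], by simp⟩).mono
    (by simp) ?_
  · rintro c l s' ⟨h1, h2, pre, h3, h4⟩
    refine .copy _ _ ⟨h1.trans (same_pushOn (by simp [h0]) _ _), fun i hi hi0 => ?_, pre ++ [c],
      by simpa using h3, ?_⟩
    · rw [pushOn_of_ne _ _ hi0, h2 i hi hi0]
    · simp [h4, h1.top, vec]
  · rintro s' ⟨s₀, ⟨-, h2, pre, h3, h4⟩, h'⟩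
    simp only [List.append_nil] at h3
    refine ⟨?_, fun i hi hi0 => by rw [h'.low (by simp) hi, h2 i hi hi0]⟩
    rw [h'.low (by simp) hK, h4, ← h3, List.ofFn_eq_map]
    simp

theorem touches_pushPoint {K : ℕ} (hK : 0 < K) (d : ℕ) : (pushPoint K d).Touches K {0, 1} :=
  touches_forList (by simp) fun _ _ => by simp [blk_of_lt hK]

/-- The data points of category `j`. -/
noncomputable def classOf {d n : ℕ} (θ : Fin (n + 1) → Fin (d + 1) → ℚ) (j : Fin (n + 1))
    (Z : List (Fin (d + 1) → ℚ)) : List (Fin (d + 1) → ℚ) :=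
  Z.filter fun z => label θ z = j

/-- The error of an affine model on a list of data points. -/
def error {d : ℕ} (ℓ : ℚ → ℚ) (v : Fin (d + 1) → ℚ) (Z : List (Fin (d + 1) → ℚ)) : ℚ :=
  (Z.map fun z => ℓ (residual v z)).sum

/-- The error of a PWA model on a list of data points. -/
noncomputable def modelError {d n : ℕ} (ℓ : ℚ → ℚ) (w : Fin (n + 1) → Fin (d + 1) → ℚ)
    (θ : Fin (n + 1) → Fin (d + 1) → ℚ) (Z : List (Fin (d + 1) → ℚ)) : ℚ :=
  (Z.map fun z => ℓ (residual (w (label θ z)) z)).sum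

/-- The decoupling: with θ fixed, each submodel enters only the summand of its own category, so
minimising over w is one regression per category. -/
theorem modelError_eq_sum {d n : ℕ} (ℓ : ℚ → ℚ) (w θ : Fin (n + 1) → Fin (d + 1) → ℚ)
    (Z : List (Fin (d + 1) → ℚ)) :
    modelError ℓ w θ Z = ∑ j, error ℓ (w j) (classOf θ j Z) := by
  induction Z with
  | nil => simp [modelError, error, classOf]
  | cons z Z ih =>
    have h : ∀ j, error ℓ (w j) (classOf θ j (z :: Z)) =
        (if j = label θ z then ℓ (residual (w j) z) else 0) + error ℓ (w j) (classOf θ j Z) := by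
      intro j
      by_cases hj : j = label θ z
      · simp [error, classOf, hj]
      · simp [error, classOf, hj, Ne.symm hj]
    simp only [h, Finset.sum_add_distrib, ← ih]
    simp [modelError]

/-- Needed because collecting a class by pushing its points reverses their order. -/
theorem error_reverse {d : ℕ} (ℓ : ℚ → ℚ) (v : Fin (d + 1) → ℚ) (Z : List (Fin (d + 1) → ℚ)) :
    error ℓ v Z.reverse = error ℓ v Z := by
  simp [error]

/-- The program `R` solves the regression problem for nonempty lists of data points satisfying
`P`. -/
def ListRegression {d : ℕ} (ℓ : ℚ → ℚ) (R : Prog) (T : ℕ → ℕ) (P : (Fin (d + 1) → ℚ) → Prop) :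
    Prop :=
  ∀ Z : List (Fin (d + 1) → ℚ), Z ≠ [] → (∀ z ∈ Z, P z) →
    ∃ v : Fin (d + 1) → ℚ, Runs ℓ R (Function.update (fun _ => []) 0 (enc Z)) (T Z.length)
      (fun s' => s' 1 = List.ofFn v) ∧ ∀ v', error ℓ v Z ≤ error ℓ v' Z

theorem Runs.length_le {p : Prog} {s : Mem} {B : ℕ} {Q : Mem → Prop} (h : Runs ℓ p s B Q) :
    Runs ℓ p s B fun s' => Q s' ∧ ∀ i, (s' i).length ≤ (s i).length + B := by
  obtain ⟨t, s', he, ht, hQ⟩ := h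
  exact ⟨t, s', he, ht, hQ, fun i => (he.length_le i).trans (by omega)⟩

theorem Runs.transport {p : Prog} {s r : Mem} {B K : ℕ} {Q : Mem → Prop} (h : Runs ℓ p s B Q)
    (hK : p.bound ≤ K) (hr : ∀ i < K, r i = s i) :
    Runs ℓ p r B fun r' => ∃ s', Q s' ∧ ∀ i < K, r' i = s' i := by
  obtain ⟨t, s', he, ht, hQ⟩ := h
  exact ⟨t, _, he.transport hK hr, ht, s', hQ, fun i hi => by simp [hi]⟩

theorem linear_bound {N M a b : ℕ} (hN : N ≤ M) (hM : 1 ≤ M) : N * a + b ≤ (a + b) * M := by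
  nlinarith [Nat.mul_le_mul_right a hN, Nat.mul_le_mul_left b hM]

/-- Copy the data points of category `j` to stack `0`. -/
noncomputable def collect (K d : ℕ) {n : ℕ} (j : Fin n) : Prog :=
  pass K d (ifLabel K d j (pushPoint K d))

theorem touches_collect {K d n : ℕ} (hK : 0 < K) (j : Fin n) :
    (collect K d j).Touches K {0, 1, 2, 3, 4, 13} := by
  refine touches_pass (touches_compareAll ((touches_pushPoint hK d).mono ?_)
    (by simp) (by simp)) ?_ <;> simp [Set.insert_subset_iff]

theorem runs_collect (ℓ : ℚ → ℚ) {K : ℕ} (hK : 0 < K) (d : ℕ) {n : ℕ} (j : Fin (n + 1)) :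
    ∃ C, ∀ (M : ℕ) (Z : List (Fin (d + 1) → ℚ)) (s : Mem), Z.length ≤ M → 1 ≤ M →
      HasData K Z s → (∀ i < K, s i = []) →
      Runs ℓ (collect K d j) s (C * M) fun s' => HasData K Z s' ∧
        s' 0 = enc (classOf (mat K 5 (n + 1) d s) j Z).reverse ∧ ∀ i < K, i ≠ 0 → s' i = [] := by
  obtain ⟨C, hC⟩ := runs_ifLabel ℓ K d j (pushPoint K d)
  refine ⟨(d + 2 + C + 7 * d + 9) + 2, fun M Z s hZ hM hs hlow => ?_⟩
  set θ := mat K 5 (n + 1) d s with hθ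
  let I : List (Fin (d + 1) → ℚ) → Mem → Prop := fun l s' => mat K 5 (n + 1) d s' = θ ∧
    (∀ i < K, i ≠ 0 → s' i = []) ∧ ∃ pre, Z = pre ++ l ∧ s' 0 = enc (classOf θ j pre).reverse
  refine (runs_pass (B := d + 2 + C) (A := {0, 1, 13}) ?_ (by simp) I ?_ ?_ hs
    ⟨rfl, fun i hi _ => hlow i hi, [], by simp [classOf, hlow 0 hK]⟩).mono
    (linear_bound hZ hM) ?_
  · exact touches_compareAll ((touches_pushPoint hK d).mono (by simp [Set.insert_subset_iff]))
      (by simp) (by simp)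
  · rintro l s₁ s₂ ⟨h1, h2, pre, h3, h4⟩ h
    exact ⟨(h.mat (by simp) _ _).trans h1, fun i hi hi0 => by rw [h.low (by simp) hi, h2 i hi hi0],
      pre, h3, by rw [h.low (by simp) hK, h4]⟩
  · rintro z l s₁ hz ⟨h1, h2, pre, h3, h4⟩ hv
    refine hC (d + 2) _ s₁ (fun s₂ h5 h6 => ?_) (fun s₂ h5 h6 => ?_)
    · refine ((runs_pushPoint hK d s₂).same (touches_pushPoint hK d)).imp ?_
      rintro s₃ ⟨⟨h7, h8⟩, h9⟩
      refine ⟨?_, fun i hi hi0 => ?_, pre ++ [z], by simpa using h3, ?_⟩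
      · rw [h9.mat (by simp), h5.mat (by simp), h1]
      · rw [h8 i hi hi0, h5.low (by simp) hi, h2 i hi hi0]
      · rw [h7, h5.vec (by simp), hv, h5.low (by simp) hK, h4]
        rw [h1, hv] at h6
        simp [classOf, h6]
    · refine ⟨?_, fun i hi hi0 => ?_, pre ++ [z], by simpa using h3, ?_⟩
      · rw [h5.mat (by simp), h1]
      · rw [h5.low (by simp) hi, h2 i hi hi0]
      · rw [h5.low (by simp) hK, h4]
        rw [h1, hv] at h6
        simp [classOf, h6]
  · rintro s' ⟨h1, -, h2, pre, h3, h4⟩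
    simp only [List.append_nil] at h3
    subst h3
    exact ⟨h1, h4, h2⟩

/-- Fit an affine model to the data points of category `j`. -/
noncomputable def fit (K d : ℕ) (R : Prog) {n : ℕ} (j : Fin n) : Prog :=
  .seq (.seq (collect K d j)
    (.branch (.nonempty 0) (.seq R (load K d (22 + 3 * j) 1 (addr K 14 0))) (skip K))) (clearLow K)

theorem touches_fit {K d n : ℕ} {R : Prog} (hK : 2 ≤ K) (hR : R.bound ≤ K) (j : Fin n) :
    (fit K d R j).Touches K {0, 1, 2, 3, 4, 13, 14, 22 + 3 * (j : ℕ)} := by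
  have h1 : (load K d (22 + 3 * j) 1 (addr K 14 0)).Touches K
      {0, 1, 2, 3, 4, 13, 14, 22 + 3 * (j : ℕ)} :=
    touches_load (by simp) (by simp) (by simp [blk_of_lt (show 1 < K by omega)]) (by simp)
  have h2 : (collect K d j).Touches K {0, 1, 2, 3, 4, 13, 14, 22 + 3 * (j : ℕ)} :=
    (touches_collect (by omega) j).mono (by simp [Set.insert_subset_iff])
  have h3 : R.Touches K {0, 1, 2, 3, 4, 13, 14, 22 + 3 * (j : ℕ)} :=
    (Prog.touches_low hR).mono (by simp)
  have h4 : (clearLow K).Touches K {0, 1, 2, 3, 4, 13, 14, 22 + 3 * (j : ℕ)} :=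
    (touches_clearLow K).mono (by simp [Set.insert_subset_iff])
  simp [fit, h1, h2, h3, h4]

/-- `R` mentions only stacks below K, so it behaves as in a memory containing nothing but its input,
provided these stacks are otherwise empty; they are cleared for the next call. A class is no larger
than the data set, so monotonicity of T bounds the call by T(N). The number M bounds both N and
T(N), and all costs are linear in it. -/
theorem runs_fit {K d n : ℕ} {R : Prog} {T : ℕ → ℕ} {P : (Fin (d + 1) → ℚ) → Prop} (hK : 2 ≤ K)
    (hRK : R.bound ≤ K) (hT : Monotone T) (hR : ListRegression ℓ R T P) (j : Fin (n + 1)) :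
    ∃ C, ∀ (M : ℕ) (Z : List (Fin (d + 1) → ℚ)) (s : Mem), Z.length ≤ M → T Z.length ≤ M →
      1 ≤ M → (∀ z ∈ Z, P z) → HasData K Z s → (∀ i < K, s i = []) →
      Runs ℓ (fit K d R j) s (C * M) fun s' => HasData K Z s' ∧ (∀ i < K, s' i = []) ∧
        ∀ v, error ℓ (vec K (22 + 3 * j) d s') (classOf (mat K 5 (n + 1) d s) j Z) ≤
          error ℓ v (classOf (mat K 5 (n + 1) d s) j Z) := by
  obtain ⟨C, hC⟩ := runs_collect ℓ (show 0 < K by omega) d j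
  refine ⟨C + (3 * d + 6) + (K * ((C + (3 * d + 6)) * 2 + 1) + 1),
    fun M Z s hZ hTM hM hP hs hlow => ?_⟩
  set F := classOf (mat K 5 (n + 1) d s) j Z with hF
  have b1 : blk K 1 = 0 := blk_of_lt (by omega)
  have hfirst : Runs ℓ (.seq (collect K d j)
      (.branch (.nonempty 0) (.seq R (load K d (22 + 3 * j) 1 (addr K 14 0))) (skip K))) s
      ((C + (3 * d + 6)) * M) fun s' => HasData K Z s' ∧
        ∀ v, error ℓ (vec K (22 + 3 * j) d s') F ≤ error ℓ v F := by
    refine ((hC M Z s hZ hM hs hlow).next (B₂ := M + (3 * d + 4) + 1) (touches_collect (by omega) j)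
      ?_).le (by nlinarith)
    rintro s₁ ⟨h1, h2, h3⟩ -
    refine Runs.branch (fun hb => ?_) (fun hb => (runs_skip fun s' hs' => ?_).le (by omega))
    · have hF0 : F.reverse ≠ [] := by
        rintro h
        simp [Test.Holds, h2, ← hF, h] at hb
      obtain ⟨v, hv, hopt⟩ := hR F.reverse hF0 fun z hz => hP z (List.mem_of_mem_filter
        (List.mem_reverse.1 hz))
      have hrun := hv.transport hRK (r := s₁) fun i hi => by
        by_cases hi0 : i = 0
        · subst hi0; simp [h2, hF]
        · simp [hi0, h3 i hi hi0]
      have hTF : T F.reverse.length ≤ M :=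
        (hT (by simpa [hF, classOf] using List.length_filter_le _ Z)).trans hTM
      refine ((hrun.le hTF).next (B₂ := 3 * d + 4) (Prog.touches_low hRK) ?_)
      rintro s₂ ⟨s₂', h4, h5⟩ h6
      have hl := runs_load (ℓ := ℓ) (K := K) (b := 22 + 3 * j) (i := 1) (j := addr K 14 0)
        (z := v) (r := []) (s := s₂) (by omega) (lt_addr (by omega) _ _) (by omega) (by simp; omega)
        (by omega) (by simp) (by rw [h5 1 (by omega), h4]; simp)
      refine (hl.same (touches_load (A := {0, 1, 14, 22 + 3 * (j : ℕ)}) (by simp) (by simp)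
        (by simp [b1]) (by simp))).mono (by omega) ?_
      rintro s₃ ⟨⟨h7, -⟩, h8⟩
      refine ⟨(h1.congr h6 (by simp) (by simp)).congr h8 ?_ ?_, fun v' => ?_⟩
      · simp; omega
      · simp; omega
      · rw [h7]
        simpa only [error_reverse] using hopt v'
    · refine ⟨h1.congr hs' (by simp) (by simp), fun v => ?_⟩
      -- `R` is specified for nonempty lists only, hence the branch; on an empty class all submodels
      -- have error 0, so whatever the block contains is optimal.
      have hF0 : F = [] := by
        have : (enc F.reverse).length = 0 := by
          rw [Test.Holds, not_not, h2] at hb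
          rw [hF, hb]; rfl
        simpa using this
      simp [hF0, error]
  -- The low stacks were empty at the start, so their lengths are at most the number of steps made,
  -- and clearing them is again linear in M.
  refine (Runs.seq (B₁ := (C + (3 * d + 6)) * M)
    (B₂ := K * ((C + (3 * d + 6)) * M * 2 + 1) + 1) (hfirst.length_le.imp ?_)).le ?_
  · rintro s₁ ⟨⟨h1, h2⟩, h3⟩
    refine ((runs_clearLow (L := (C + (3 * d + 6)) * M) fun i hi => ?_).same
      (touches_clearLow K)).imp ?_
    · simpa [hlow i hi] using h3 i
    · rintro s₂ ⟨h4, h5⟩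
      refine ⟨h1.congr h5 (by simp) (by simp), h4, ?_⟩
      rw [h5.vec (by simp; omega)]
      exact h2
  · nlinarith [Nat.mul_le_mul_left K hM]

/-- The residual of submodel `j` at the current point. -/
noncomputable def residualE (d j : ℕ) : Expr :=
  .op .sub (.cell 2 d) (.fsum fun c : Fin (d + 1) => .op .mul (.cell (22 + 3 * j) c) (barE 2 c))

theorem eval_residualE {K d j : ℕ} {s : Mem} :
    (residualE d j).eval K s = residual (vec K (22 + 3 * j) d s) (vec K 2 d s) := by
  have h : 2 ≤ 22 + 3 * j := by omega
  simp [residualE, residual, Op.eval, dotProduct, eval_barE, Expr.eval_cell, h, vec]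

/-- Add the loss of submodel `j` at the current point to the cost. -/
noncomputable def addLoss (K d j : ℕ) : Prog :=
  .seq (assign K 13 1 (residualE d j)) (.seq (.loss (addr K 13 1) (addr K 13 2))
    (.arith .add (addr K 8 0) (addr K 13 2) (addr K 8 0)))

theorem touches_addLoss (K d j : ℕ) : (addLoss K d j).Touches K {1, 8, 13} := by
  have := touches_assign (K := K) (b := 13) (i := 1) (e := residualE d j) (A := {1, 8, 13})
    (by simp) (by simp)
  simp [addLoss, this]

theorem runs_addLoss (K d j : ℕ) (s : Mem) :
    Runs ℓ (addLoss K d j) s ((residualE d j).cost + 3) fun s' => top s' (addr K 8 0) =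
      top s (addr K 8 0) + ℓ (residual (vec K (22 + 3 * j) d s) (vec K 2 d s)) := by
  refine (runs_assign _ s).next (B₂ := 1 + 1) (touches_assign (A := {1, 13}) (by simp) (by simp)) ?_
  rintro s₁ ⟨h1, -⟩ h2
  refine Runs.seq (.loss _ _ (.arith _ _ _ _ ?_))
  have h3 : top (pushOn s₁ (addr K 13 2) (ℓ (top s₁ (addr K 13 1)))) (addr K 8 0) =
      top s (addr K 8 0) := by
    rw [top_congr (pushOn_of_ne _ _ (by simp)), h2.top (by simp)]
  rw [top_pushOn_self, Op.eval, top_pushOn_self, h3, h1, eval_residualE]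

/-- Add the error of submodel `j` on the data points of category `j` to the cost. -/
noncomputable def addError (K d : ℕ) {n : ℕ} (j : Fin n) : Prog :=
  pass K d (ifLabel K d j (addLoss K d j))

theorem touches_addError {K d n : ℕ} (j : Fin n) :
    (addError K d j).Touches K {1, 2, 3, 4, 8, 13} := by
  refine touches_pass (touches_compareAll ((touches_addLoss K d j).mono ?_)
    (by simp) (by simp)) ?_ <;> simp [Set.insert_subset_iff]

theorem runs_addError (ℓ : ℚ → ℚ) (K d : ℕ) {n : ℕ} (j : Fin (n + 1)) :
    ∃ C, ∀ (M : ℕ) (Z : List (Fin (d + 1) → ℚ)) (s : Mem), Z.length ≤ M → 1 ≤ M →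
      HasData K Z s →
      Runs ℓ (addError K d j) s (C * M) fun s' => HasData K Z s' ∧
        top s' (addr K 8 0) = top s (addr K 8 0) +
          error ℓ (vec K (22 + 3 * j) d s) (classOf (mat K 5 (n + 1) d s) j Z) := by
  obtain ⟨C, hC⟩ := runs_ifLabel ℓ K d j (addLoss K d j)
  refine ⟨((residualE d j).cost + 3 + C + 7 * d + 9) + 2, fun M Z s hZ hM hs => ?_⟩
  set θ := mat K 5 (n + 1) d s with hθ
  set v := vec K (22 + 3 * j) d s with hv
  let I : List (Fin (d + 1) → ℚ) → Mem → Prop := fun l s' => mat K 5 (n + 1) d s' = θ ∧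
    vec K (22 + 3 * j) d s' = v ∧ ∃ pre, Z = pre ++ l ∧ top s' (addr K 8 0) =
      top s (addr K 8 0) + error ℓ v (classOf θ j pre)
  refine (runs_pass (B := (residualE d j).cost + 3 + C) (A := {1, 8, 13}) ?_ (by simp) I ?_ ?_ hs
    ⟨rfl, rfl, [], by simp [classOf, error]⟩).mono
    (linear_bound hZ hM) ?_
  · exact touches_compareAll (touches_addLoss K d j) (by simp) (by simp)
  · rintro l s₁ s₂ ⟨h1, h2, pre, h3, h4⟩ h
    exact ⟨(h.mat (by simp) _ _).trans h1, (h.vec (by simp; omega) _).trans h2,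
      pre, h3, by rw [h.top (by simp), h4]⟩
  · rintro z l s₁ hz ⟨h1, h2, pre, h3, h4⟩ hvz
    refine hC _ _ s₁ (fun s₂ h5 h6 => ?_) (fun s₂ h5 h6 => ?_)
    · refine ((runs_addLoss K d j s₂).same (touches_addLoss K d j)).imp ?_
      rintro s₃ ⟨h7, h9⟩
      refine ⟨?_, ?_, pre ++ [z], by simpa using h3, ?_⟩
      · rw [h9.mat (by simp), h5.mat (by simp), h1]
      · rw [h9.vec (by simp; omega), h5.vec (by simp; omega), h2]
      · rw [h7, h5.vec (by simp; omega), h5.vec (by simp), hvz, h5.top (by simp), h4, h2]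
        rw [h1, hvz] at h6
        simp [classOf, error, h6, add_assoc]
    · refine ⟨?_, ?_, pre ++ [z], by simpa using h3, ?_⟩
      · rw [h5.mat (by simp), h1]
      · rw [h5.vec (by simp; omega), h2]
      · rw [h5.top (by simp), h4]
        rw [h1, hvz] at h6
        simp [classOf, h6]
  · rintro s' ⟨h1, -, -, pre, h3, h4⟩
    simp only [List.append_nil] at h3
    subst h3
    exact ⟨h1, h4⟩

/-- Compute optimal submodels for the classifier in block `5` and the cost of the resulting
model. -/
noncomputable def evaluate (K d n : ℕ) (R : Prog) : Prog :=
  .seq (.push 0 (addr K 8 0)) (forList K (List.finRange n) fun j => .seq (fit K d R j)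
    (addError K d j))

/-- The blocks changed by `evaluate`. -/
def evalBlocks : Set ℕ := {0, 1, 2, 3, 4, 8, 13, 14} ∪ {a | ∃ j, a = 22 + 3 * j}

theorem touches_evaluate {K d n : ℕ} {R : Prog} (hK : 2 ≤ K) (hR : R.bound ≤ K) :
    (evaluate K d n R).Touches K evalBlocks := by
  refine Prog.Touches.seq_iff.2 ⟨by simp [evalBlocks], touches_forList (by simp [evalBlocks])
    fun j _ => Prog.Touches.seq_iff.2 ⟨(touches_fit hK hR j).mono ?_, (touches_addError j).mono ?_⟩⟩
  · simp [evalBlocks, Set.insert_subset_iff]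
  · simp [evalBlocks, Set.insert_subset_iff]

/-- The submodels in the blocks `22, 25, …`. -/
def submodels (K d n : ℕ) (s : Mem) : Fin n → Fin (d + 1) → ℚ := fun j => vec K (22 + 3 * j) d s

theorem runs_evaluate {K d : ℕ} {R : Prog} {T : ℕ → ℕ} {P : (Fin (d + 1) → ℚ) → Prop} (n : ℕ)
    (hK : 2 ≤ K) (hRK : R.bound ≤ K) (hT : Monotone T) (hR : ListRegression ℓ R T P) :
    ∃ C, ∀ (M : ℕ) (Z : List (Fin (d + 1) → ℚ)) (s : Mem), Z.length ≤ M → T Z.length ≤ M →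
      1 ≤ M → (∀ z ∈ Z, P z) → HasData K Z s → (∀ i < K, s i = []) →
      Runs ℓ (evaluate K d (n + 1) R) s (C * M) fun s' => HasData K Z s' ∧ (∀ i < K, s' i = []) ∧
        top s' (addr K 8 0) = modelError ℓ (submodels K d (n + 1) s') (mat K 5 (n + 1) d s) Z ∧
        ∀ w, top s' (addr K 8 0) ≤ modelError ℓ w (mat K 5 (n + 1) d s) Z := by
  choose C₁ hC₁ using fun j : Fin (n + 1) => runs_fit hK hRK hT hR j
  choose C₂ hC₂ using fun j : Fin (n + 1) => runs_addError ℓ K d j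
  set C := Finset.univ.sup (C₁ + C₂) with hC
  refine ⟨1 + ((n + 1) * C + 1), fun M Z s hZ hTM hM hP hs hlow => ?_⟩
  set θ := mat K 5 (n + 1) d s with hθ
  let I : List (Fin (n + 1)) → Mem → Prop := fun l s' => HasData K Z s' ∧ (∀ i < K, s' i = []) ∧
    mat K 5 (n + 1) d s' = θ ∧ ∃ pre, List.finRange (n + 1) = pre ++ l ∧
      top s' (addr K 8 0) = (pre.map fun j => error ℓ (submodels K d (n + 1) s' j)
        (classOf θ j Z)).sum ∧
      ∀ j ∈ pre, ∀ v, error ℓ (submodels K d (n + 1) s' j) (classOf θ j Z) ≤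
        error ℓ v (classOf θ j Z)
  have hrun : Runs ℓ (evaluate K d (n + 1) R) s (1 + ((n + 1) * (C * M) + 1)) fun s' =>
      ∃ s₀, I [] s₀ ∧ Same K {1} s₀ s' := by
    refine Runs.seq (.push _ _ ?_)
    have hsame : Same K {8} s (pushOn s (addr K 8 0) 0) := same_pushOn (by simp) _ _
    have hI : I (List.finRange (n + 1)) (pushOn s (addr K 8 0) 0) :=
      ⟨hs.congr hsame (by simp) (by simp), fun i hi => by rw [hsame.low (by simp) hi, hlow i hi],
        hsame.mat (by simp) _ _, [], by simp⟩
    refine (runs_forList (B := C * M) I ?_ _ _ hI).le (by simp)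
    rintro j l s₁ ⟨h1, h2, h3, pre, h4, h5, h6⟩
    have hCj : C₁ j + C₂ j ≤ C := Finset.le_sup (f := C₁ + C₂) (Finset.mem_univ j)
    -- Each category is treated once, so the submodels found earlier lie in other blocks and survive
    -- the fit for j.
    have hjpre : j ∉ pre := by
      have := List.nodup_finRange (n + 1)
      rw [h4, List.nodup_append] at this
      exact fun h => this.2.2 j h j (by simp) rfl
    refine ((hC₁ j M Z s₁ hZ hTM hM hP h1 h2).next (touches_fit hK hRK j) ?_).le
      ((add_mul _ _ _).symm.trans_le (Nat.mul_le_mul_right _ hCj))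
    rintro s₂ ⟨h7, h8, h9⟩ h10
    refine ((hC₂ j M Z s₂ hZ hM h7).same (touches_addError j)).imp ?_
    rintro s₃ ⟨⟨h11, h12⟩, h13⟩
    have e5 : mat K 5 (n + 1) d s₂ = θ := by rw [h10.mat (by simp; omega), h3]
    have ej : ∀ i, submodels K d (n + 1) s₃ i = submodels K d (n + 1) s₂ i := fun i =>
      h13.vec (by simp; omega) _
    have ep : ∀ i ∈ pre, submodels K d (n + 1) s₃ i = submodels K d (n + 1) s₁ i := fun i hi => by
      have hne : i ≠ j := fun h => hjpre (h ▸ hi)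
      have hne' : (i : ℕ) ≠ j := fun h => hne (Fin.ext h)
      rw [ej]
      exact h10.vec (by simp; omega) _
    rw [h3] at h9
    rw [e5] at h12
    refine ⟨h11, fun i hi => by rw [h13.low (by simp) hi, h8 i hi], ?_, pre ++ [j],
      by simpa using h4, ?_, ?_⟩
    · rw [h13.mat (by simp), e5]
    · have e8 : top s₂ (addr K 8 0) = top s₁ (addr K 8 0) := h10.top (by simp; omega) _
      rw [h12, e8, h5, List.map_append, List.sum_append]
      congr 1
      · congr 1
        exact List.map_congr_left fun i hi => by rw [ep i hi]
      · simp [ej]; rfl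
    · intro i hi v
      rcases List.mem_append.1 hi with hi | hi
      · rw [ep i hi]; exact h6 i hi v
      · obtain rfl : i = j := by simpa using hi
        rw [ej]; exact h9 v
  refine hrun.mono (by nlinarith) ?_
  rintro s' ⟨s₀, ⟨h1, h2, h3, pre, h4, h5, h6⟩, h7⟩
  simp only [List.append_nil] at h4
  subst h4
  have e8 := h7.top (a := 8) (by simp) 0
  have hsum : top s' (addr K 8 0) = ∑ j, error ℓ (submodels K d (n + 1) s₀ j) (classOf θ j Z) := by
    rw [e8, h5, Fin.sum_univ_def]
  have ew : submodels K d (n + 1) s' = submodels K d (n + 1) s₀ :=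
    funext fun j => h7.vec (by simp; omega) _
  refine ⟨h1.congr h7 (by simp) (by simp), fun i hi => by rw [h7.low (by simp) hi, h2 i hi],
    ?_, fun w => ?_⟩
  · rw [hsum, ew, modelError_eq_sum]
  · rw [hsum, modelError_eq_sum]
    exact Finset.sum_le_sum fun j _ => h6 j (by simp) _

/-! ### Polyhedra -/

/-- A nonempty polyhedron `{x | β r ≤ a r x}` has a point in a minimal face. -/
theorem exists_mem_minimal_face {V ι : Type*} [AddCommGroup V] [Module ℚ V] [Fintype ι]
    (a : ι → V →ₗ[ℚ] ℚ) (β : ι → ℚ) (x₀ : V) (h₀ : ∀ r, β r ≤ a r x₀) :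
    ∃ x, (∀ r, β r ≤ a r x) ∧
      ∀ w, (∀ r, a r x = β r → a r w = 0) → ∀ r, a r w = 0 := by
  classical
  let tight : V → Finset ι := fun x => Finset.univ.filter fun r => a r x = β r
  -- A feasible point with the largest number of tight constraints lies in a minimal face.
  obtain ⟨x, hx, hmax⟩ := (measure fun x => Fintype.card ι - (tight x).card).wf.has_min
    {x | ∀ r, β r ≤ a r x} ⟨x₀, h₀⟩
  refine ⟨x, hx, ?_⟩
  have key : ∀ w, (∀ r, a r x = β r → a r w = 0) → ∀ r, 0 ≤ a r w := by
    intro w hw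
    by_contra! hneg
    obtain ⟨r₀, hr₀⟩ := hneg
    obtain ⟨r₁, hr₁, hmin⟩ := (Finset.univ.filter fun r => a r w < 0).exists_min_image
      (fun r => (a r x - β r) / -(a r w)) ⟨r₀, by simpa using hr₀⟩
    simp only [Finset.mem_filter, Finset.mem_univ, true_and] at hr₁ hmin
    -- Ratio test: the largest step along w that stays feasible. The old tight constraints remain
    -- tight and r₁ becomes tight, contradicting maximality.
    set t := (a r₁ x - β r₁) / -(a r₁ w) with ht
    have ht0 : 0 ≤ t := div_nonneg (sub_nonneg.2 (hx r₁)) (by linarith)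
    have hfeas : ∀ r, β r ≤ a r (x + t • w) := by
      intro r
      simp only [map_add, map_smul, smul_eq_mul]
      by_cases hr : a r w < 0
      · have := (le_div_iff₀ (by linarith)).1 (hmin r hr)
        linarith
      · have := mul_nonneg ht0 (not_lt.1 hr)
        linarith [hx r]
    refine hmax _ hfeas ?_
    have hsub : tight x ⊂ tight (x + t • w) := by
      refine (Finset.ssubset_iff_of_subset fun r hr => ?_).2 ⟨r₁, ?_, ?_⟩
      · simp only [tight, Finset.mem_filter, Finset.mem_univ, true_and] at hr ⊢
        simp [hr, hw r hr]
      · simp only [tight, Finset.mem_filter, Finset.mem_univ, true_and, map_add, map_smul,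
          smul_eq_mul, ht]
        have : a r₁ w ≠ 0 := hr₁.ne
        field_simp
        ring
      · simp only [tight, Finset.mem_filter, Finset.mem_univ, true_and]
        exact fun h => hr₁.ne (hw r₁ h)
    have h1 := Finset.card_lt_card hsub
    have h2 := Finset.card_le_univ (tight (x + t • w))
    change Fintype.card ι - _ < Fintype.card ι - _
    omega
  intro w hw r
  -- The hypothesis on w is symmetric, so `key` also applies to -w.
  refine le_antisymm ?_ (key w hw r)
  have := key (-w) (fun r hr => by simp [hw r hr]) r
  simpa using this

/-- A pointed full-dimensional cone `{x | 0 ≤ a r x}` contains a line in whose points at infinity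
all constraints hold strictly, and which is determined by its tight constraints. -/
theorem exists_unbounded_edge {V ι : Type*} [AddCommGroup V] [Module ℚ V] [Fintype ι] [Nonempty ι]
    (a : ι → V →ₗ[ℚ] ℚ) (x₀ : V) (h₀ : ∀ r, 0 < a r x₀)
    (hfull : ∀ w, (∀ r, a r w = 0) → w = 0) :
    ∃ u x, u ≠ 0 ∧ (∀ r, 0 ≤ a r u) ∧ (∀ r, a r u = 0 → 1 ≤ a r x) ∧
      ∀ w, (∀ r, a r u = 0 → a r x = 1 → a r w = 0) → ∃ c : ℚ, w = c • u := by
  classical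
  -- The constraint φ ≥ 1 cuts off the apex, so that a minimal face of the truncated cone yields a
  -- nonzero extreme direction u.
  set φ : V →ₗ[ℚ] ℚ := ∑ r, a r with hφ
  have hφ0 : 0 < φ x₀ := by
    simpa [hφ] using Finset.sum_pos (fun r _ => h₀ r) Finset.univ_nonempty
  obtain ⟨u, hu, hu'⟩ := exists_mem_minimal_face (fun r : Option ι => r.elim φ a)
    (fun r => r.elim 1 fun _ => 0) ((φ x₀)⁻¹ • x₀) (by
      rintro (_ | r)
      · simp [hφ0.ne']
      · simpa using mul_nonneg (inv_nonneg.2 hφ0.le) (h₀ r).le)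
  have hφu : 1 ≤ φ u := hu none
  have hline : ∀ w, (∀ r, a r u = 0 → a r w = 0) → ∃ c : ℚ, w = c • u := by
    intro w hw
    refine ⟨φ w / φ u, sub_eq_zero.1 (hfull _ fun r => ?_)⟩
    -- Subtracting a multiple of u kills φ as well, whether or not φ is tight at u; the difference
    -- then vanishes on every row and is 0 by pointedness.
    refine hu' (w - (φ w / φ u) • u) ?_ (some r)
    rintro (_ | r) hr
    · have : φ u ≠ 0 := by positivity
      simp only [Option.elim_none, map_sub, map_smul, smul_eq_mul]
      field_simp
      ring
    · have hr' : a r u = 0 := hr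
      simp [hr', hw r hr']
  -- A scale large enough for c • x₀ to satisfy every a r ≥ 1, so the second polyhedron is nonempty.
  set c := ∑ r, (a r x₀)⁻¹ with hc
  obtain ⟨x, hx, hx'⟩ := exists_mem_minimal_face (fun r : {r // a r u = 0} => a r) (fun _ => 1)
    (c • x₀) (by
      rintro ⟨r, -⟩
      have : (a r x₀)⁻¹ ≤ c := Finset.single_le_sum (f := fun r => (a r x₀)⁻¹)
        (fun r _ => inv_nonneg.2 (h₀ r).le) (Finset.mem_univ r)
      have := mul_le_mul_of_nonneg_right this (h₀ r).le
      rw [inv_mul_cancel₀ (h₀ r).ne'] at this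
      simpa using this)
  refine ⟨u, x, ?_, fun r => hu (some r), fun r hr => hx ⟨r, hr⟩, fun w hw => hline w fun r hr => ?_⟩
  · rintro rfl
    simp at hφu
    linarith
  · exact hx' w (fun r' hr' => hw r' r'.2 hr') ⟨r, hr⟩

theorem mulVec_cramerSol {n : ℕ} {A : Matrix (Fin n) (Fin n) ℚ} (hA : A.det ≠ 0) (b : Fin n → ℚ) :
    A.mulVec (cramerSol A b) = b := by
  have h : cramerSol A b = A.det⁻¹ • A.cramer b := by
    funext i
    simp [cramerSol, Matrix.cramer_apply, div_eq_inv_mul]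
  rw [h, Matrix.mulVec_smul, Matrix.mulVec_cramer, smul_smul, inv_mul_cancel₀ hA, one_smul]

/-- The matrix with the given rows, followed by the `c`-th unit vector. -/
def edgeMatrix {D : ℕ} (a : Fin D → Fin (D + 1) → ℚ) (c : Fin (D + 1)) :
    Matrix (Fin (D + 1)) (Fin (D + 1)) ℚ :=
  Fin.snoc (α := fun _ => Fin (D + 1) → ℚ) a (Pi.single c 1)

/-- The base point of the line on which the given linear forms are `1`. -/
def edgePoint {D : ℕ} (a : Fin D → Fin (D + 1) → ℚ) (c : Fin (D + 1)) : Fin (D + 1) → ℚ :=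
  cramerSol (edgeMatrix a c) (Fin.snoc (α := fun _ => ℚ) (fun _ => 1) 0)

/-- The direction of the line on which the given linear forms are constant. -/
def edgeDir {D : ℕ} (a : Fin D → Fin (D + 1) → ℚ) (c : Fin (D + 1)) (ε : ℚ) : Fin (D + 1) → ℚ :=
  cramerSol (edgeMatrix a c) (Fin.snoc (α := fun _ => ℚ) (fun _ => 0) ε)

/-- Makes the line of `exists_unbounded_edge` computable. Its defining rows have rank D, so D of
them suffice; a unit vector in a coordinate where the direction is nonzero completes them to an
invertible matrix, and Cramer's rule gives a base point and a direction. The sign ε orients the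
direction into the cone. -/
theorem exists_edge {ι : Type*} [Fintype ι] {D : ℕ} (a : ι → Fin (D + 1) → ℚ)
    (x₀ : Fin (D + 1) → ℚ) (h₀ : ∀ r, 0 < a r ⬝ᵥ x₀)
    (hfull : ∀ w, (∀ r, a r ⬝ᵥ w = 0) → w = 0) :
    ∃ (B : Fin D → ι) (c : Fin (D + 1)) (ε : ℚ), (ε = 1 ∨ ε = -1) ∧ ∀ r,
      (a r ⬝ᵥ edgeDir (fun i => a (B i)) c ε = 0 ∧ 0 < a r ⬝ᵥ edgePoint (fun i => a (B i)) c) ∨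
        0 < a r ⬝ᵥ edgeDir (fun i => a (B i)) c ε := by
  classical
  have hne : Nonempty ι := by
    by_contra h
    rw [not_nonempty_iff] at h
    have := congrFun (hfull (Pi.single 0 1) fun r => h.elim r) 0
    simp at this
  obtain ⟨u, x, hu0, hu, hx, hline⟩ := exists_unbounded_edge
    (fun r => dotProductBilin ℚ ℚ (a r)) x₀ (by simpa using h₀) (by simpa using hfull)
  simp only [dotProductBilin_apply_apply] at hu hx hline
  -- The rows constant with value 1 along the line; by `hline` their common kernel is spanned by u.
  let J := {r // a r ⬝ᵥ u = 0 ∧ a r ⬝ᵥ x = 1}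
  let A₁ : Matrix J (Fin (D + 1)) ℚ := Matrix.of fun r => a r
  have hker : LinearMap.ker A₁.mulVecLin = Submodule.span ℚ {u} := by
    ext w
    rw [LinearMap.mem_ker, Submodule.mem_span_singleton]
    constructor
    · intro hw
      obtain ⟨c, hc⟩ := hline w fun r hr hr' => congrFun hw ⟨r, hr, hr'⟩
      exact ⟨c, hc.symm⟩
    · rintro ⟨c, rfl⟩
      funext r
      simp [A₁, Matrix.mulVec, r.2.1]
  have hrank : A₁.rank = D := by
    have h := A₁.mulVecLin.finrank_range_add_finrank_ker
    rw [hker, finrank_span_singleton hu0, Module.finrank_fin_fun] at h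
    exact Nat.succ_injective h
  rw [Matrix.rank_eq_finrank_span_row] at hrank
  -- By rank-nullity the row space has dimension D; select D of the given rows that span it.
  obtain ⟨f, hf, hspan, -⟩ := Submodule.exists_fun_fin_finrank_span_eq ℚ (Set.range A₁.row)
  have hB : ∀ i : Fin D, ∃ r : J, A₁.row r = f (Fin.cast hrank.symm i) := fun i => hf _
  choose B hB using hB
  have hrow : ∀ w, (∀ i, a (B i) ⬝ᵥ w = 0) → ∃ c : ℚ, w = c • u := by
    intro w hw
    refine hline w fun r hr hr' => ?_
    have hle : Submodule.span ℚ (Set.range f) ≤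
        LinearMap.ker ((dotProductBilin ℚ ℚ).flip w) := by
      rw [Submodule.span_le]
      rintro _ ⟨i, rfl⟩
      have := hw (Fin.cast hrank i)
      rw [show a (B (Fin.cast hrank i)) = f i from hB _] at this
      simpa using this
    rw [hspan] at hle
    have : A₁.row ⟨r, hr, hr'⟩ ⬝ᵥ w = 0 := by
      simpa using hle (Submodule.subset_span ⟨⟨r, hr, hr'⟩, rfl⟩)
    exact this
  obtain ⟨c, hc⟩ := Function.ne_iff.1 hu0
  have hc : u c ≠ 0 := hc
  set A := edgeMatrix (fun i => a (B i)) c with hA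
  have hmul : ∀ w, A.mulVec w = Fin.snoc (α := fun _ => ℚ) (fun i => a (B i) ⬝ᵥ w) (w c) := by
    intro w
    funext i
    refine Fin.lastCases ?_ (fun i => ?_) i
    · simp [Matrix.mulVec, hA, edgeMatrix]
    · simp [Matrix.mulVec, hA, edgeMatrix]
  have hinj : ∀ w, A.mulVec w = 0 → w = 0 := by
    intro w hw
    rw [hmul] at hw
    obtain ⟨t, rfl⟩ := hrow w fun i => by simpa using congrFun hw i.castSucc
    have := congrFun hw (Fin.last D)
    simp [hc] at this
    simp [this]
  have hdet : A.det ≠ 0 := fun h => by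
    obtain ⟨v, hv, hv'⟩ := Matrix.exists_mulVec_eq_zero_iff.2 h
    exact hv (hinj v hv')
  have hsol : ∀ b w, A.mulVec w = b → cramerSol A b = w := fun b w hw => by
    rw [← sub_eq_zero]
    exact hinj _ (by rw [Matrix.mulVec_sub, mulVec_cramerSol hdet, hw, sub_self])
  -- The base point is the point of the line with c-th coordinate 0. It differs from x by a multiple
  -- of u, which the rows vanishing on u do not see.
  have hp : edgePoint (fun i => a (B i)) c = x - (x c / u c) • u := by
    refine hsol _ _ ?_
    rw [hmul]
    congr 1
    · funext i
      simp [dotProduct_sub, (B i).2.1, (B i).2.2]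
    · simp [hc]
  -- The sign of u c is not known to the program, so both signs have to be tried.
  obtain ⟨ε, hε, hpos⟩ : ∃ ε : ℚ, (ε = 1 ∨ ε = -1) ∧ 0 < ε / u c := by
    rcases lt_or_gt_of_ne hc with h | h
    · exact ⟨-1, Or.inr rfl, div_pos_of_neg_of_neg (by norm_num) h⟩
    · exact ⟨1, Or.inl rfl, div_pos one_pos h⟩
  have hq : edgeDir (fun i => a (B i)) c ε = (ε / u c) • u := by
    refine hsol _ _ ?_
    rw [hmul]
    congr 1
    · funext i
      simp [(B i).2.1]
    · simp [hc]
  refine ⟨fun i => B i, c, ε, hε, fun r => ?_⟩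
  rw [hp, hq]
  simp only [dotProduct_sub, dotProduct_smul, smul_eq_mul]
  rcases (hu r).eq_or_lt with h | h
  · left
    rw [← h]
    exact ⟨by simp, by linarith [hx r h.symm]⟩
  · right
    exact mul_pos hpos h

/-! ### The candidate classifiers -/

/-- The parameters of a classifier whose last category has score `0`. -/
def expand {m d D : ℕ} (e : Fin m × Fin (d + 1) ≃ Fin (D + 1)) (t : Fin (D + 1) → ℚ) :
    Fin (m + 1) → Fin (d + 1) → ℚ :=
  Fin.snoc (α := fun _ => Fin (d + 1) → ℚ) (fun k c => t (e (k, c))) 0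

section expand

variable {m d D : ℕ} (e : Fin m × Fin (d + 1) ≃ Fin (D + 1))

@[simp] theorem expand_last (t : Fin (D + 1) → ℚ) : expand e t (Fin.last m) = 0 := by
  simp [expand]

@[simp] theorem expand_castSucc (t : Fin (D + 1) → ℚ) (k : Fin m) (c : Fin (d + 1)) :
    expand e t k.castSucc c = t (e (k, c)) := by
  simp [expand]

theorem expand_eq_sum (t : Fin (D + 1) → ℚ) (k : Fin (m + 1)) (c : Fin (d + 1)) :
    expand e t k c = ∑ i, t i * expand e (Pi.single i 1) k c := by
  refine Fin.lastCases ?_ (fun k => ?_) k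
  · simp
  · simp [Pi.single_apply]

/-- The linear form by which the scores of categories `k` and `l` at a data point differ. -/
def scoreForm (k l : Fin (m + 1)) (z : Fin (d + 1) → ℚ) (i : Fin (D + 1)) : ℚ :=
  ∑ c, (expand e (Pi.single i 1) k c - expand e (Pi.single i 1) l c) * bar z c

theorem scoreForm_dotProduct (k l : Fin (m + 1)) (z : Fin (d + 1) → ℚ) (t : Fin (D + 1) → ℚ) :
    scoreForm e k l z ⬝ᵥ t = score (expand e t) k z - score (expand e t) l z := by
  simp only [scoreForm, score, dotProduct, ← Finset.sum_sub_distrib, ← sub_mul, Finset.sum_mul]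
  rw [Finset.sum_comm]
  refine Finset.sum_congr rfl fun c _ => ?_
  rw [expand_eq_sum e t k c, expand_eq_sum e t l c, ← Finset.sum_sub_distrib, Finset.sum_mul]
  exact Finset.sum_congr rfl fun i _ => by ring

/-- Lowering the constant term of category k by ηk breaks ties in favour of the smallest index, and
for small η > 0 preserves the strict inequalities at the finitely many data points. This puts the
parameters in the interior of the cone. -/
theorem exists_strict {n : ℕ} (θ : Fin (n + 1) → Fin (d + 1) → ℚ) (Z : List (Fin (d + 1) → ℚ)) :
    ∃ θ' : Fin (n + 1) → Fin (d + 1) → ℚ,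
      ∀ z ∈ Z, ∀ l ≠ label θ z, score θ' l z < score θ' (label θ z) z := by
  let θ' : ℚ → Fin (n + 1) → Fin (d + 1) → ℚ := fun η k => θ k - Pi.single (Fin.last d) (η * k)
  have hsc : ∀ η k z, score (θ' η) k z = score θ k z - η * k := by
    intro η k z
    simp [θ', score, sub_dotProduct, bar]
  have key : ∀ i : Fin Z.length, ∀ l : Fin (n + 1), ∀ᶠ η in nhdsWithin (0 : ℚ) (Set.Ioi 0),
      l ≠ label θ (Z.get i) → score (θ' η) l (Z.get i) < score (θ' η) (label θ (Z.get i)) (Z.get i) := by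
    intro i l
    set z := Z.get i
    have hl := label_eq_iff.1 (rfl : label θ z = label θ z) l
    set j := label θ z
    rcases lt_trichotomy l j with h | h | h
    · have hg := sub_pos.2 (hl.1 h)
      -- The denominator j + 1 exceeds j, as the estimate needs, and is visibly positive.
      filter_upwards [Ioo_mem_nhdsGT (show (0 : ℚ) < (score θ j z - score θ l z) / (j + 1) by
        positivity)] with η hη _
      have h1 := (lt_div_iff₀ (by positivity)).1 hη.2
      rw [hsc, hsc]
      have h2 : 0 ≤ η * (l : ℚ) := mul_nonneg hη.1.le (by positivity)
      have h3 := hη.1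
      linarith
    · exact Filter.Eventually.of_forall fun η h' => absurd h h'
    · filter_upwards [self_mem_nhdsWithin] with η hη _
      rw [hsc, hsc]
      have h1 : (j : ℚ) < (l : ℚ) := by exact_mod_cast h
      have h2 := mul_lt_mul_of_pos_left h1 (Set.mem_Ioi.1 hη)
      linarith [hl.2 h]
  obtain ⟨η, hη⟩ := (Filter.eventually_all.2 fun i => Filter.eventually_all.2 (key i)).exists
  refine ⟨θ' η, fun z hz l hl => ?_⟩
  obtain ⟨i, rfl⟩ := List.get_of_mem hz
  exact hη i l hl

/-- On a data set which is not contained in a hyperplane, every classification by a linear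
classifier is obtained from one of the candidates. -/
theorem exists_candidate (Z : List (Fin (d + 1) → ℚ))
    (hZ : ∀ v : Fin (d + 1) → ℚ, (∀ z ∈ Z, v ⬝ᵥ bar z = 0) → v = 0)
    (θ : Fin (m + 1) → Fin (d + 1) → ℚ) :
    ∃ (κ : Fin D → Fin (m + 1) × Fin (m + 1)) (U : Fin D → Fin (d + 1) → ℚ) (c : Fin (D + 1))
      (ε : ℚ), (∀ i, U i ∈ Z) ∧ (ε = 1 ∨ ε = -1) ∧ ∀ p q : Fin (D + 1) → ℚ,
      p = edgePoint (fun i => scoreForm e (κ i).1 (κ i).2 (U i)) c →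
      q = edgeDir (fun i => scoreForm e (κ i).1 (κ i).2 (U i)) c ε → ∀ s : ℚ,
      (∀ z ∈ Z, ∀ k l, 1 + ((score (expand e p) k z - score (expand e p) l z) /
        (score (expand e q) k z - score (expand e q) l z)) ^ 2 ≤ s) →
      ∀ z ∈ Z, label (expand e p + s • expand e q) z = label θ z := by
  obtain ⟨θ', hθ'⟩ := exists_strict θ Z
  let ι := {r : Fin Z.length × Fin (m + 1) // r.2 ≠ label θ (Z.get r.1)}
  let a : ι → Fin (D + 1) → ℚ := fun r =>
    scoreForm e (label θ (Z.get r.1.1)) r.1.2 (Z.get r.1.1)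
  -- Subtracting the last category's parameters from all of them leaves score differences unchanged.
  let x₀ : Fin (D + 1) → ℚ := fun i =>
    θ' (e.symm i).1.castSucc (e.symm i).2 - θ' (Fin.last m) (e.symm i).2
  have hx₀ : ∀ k, expand e x₀ k = θ' k - θ' (Fin.last m) := by
    intro k
    funext c
    refine Fin.lastCases ?_ (fun k => ?_) k <;> simp [x₀]
  obtain ⟨B, c, ε, hε, hB⟩ := exists_edge a x₀
    (fun r => by
      have := hθ' _ (Z.get_mem r.1.1) _ r.2
      simp only [a, scoreForm_dotProduct, score, hx₀, sub_dotProduct] at this ⊢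
      linarith)
    -- Pointedness: if all forms vanish at w, then at every data point all scores equal that of the
    -- last category, which is 0. Since the data lie in no hyperplane, all parameters vanish.
    (fun w hw => by
      have h1 : ∀ i k, score (expand e w) k (Z.get i) =
          score (expand e w) (label θ (Z.get i)) (Z.get i) := by
        intro i k
        by_cases hk : k = label θ (Z.get i)
        · rw [← hk]
        · have := hw ⟨(i, k), hk⟩
          simp only [a, scoreForm_dotProduct] at this
          linarith
      have h2 : ∀ k, expand e w k = 0 := fun k => hZ _ fun z hz => by
        obtain ⟨i, rfl⟩ := List.get_of_mem hz
        have := (h1 i k).trans (h1 i (Fin.last m)).symm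
        simpa [score] using this
      funext i
      have := congrFun (h2 (e.symm i).1.castSucc) (e.symm i).2
      simpa using this)
  refine ⟨fun i => (label θ (Z.get (B i).1.1), (B i).1.2), fun i => Z.get (B i).1.1, c, ε,
    fun i => Z.get_mem _, hε, ?_⟩
  rintro p q hp hq s hs z hz
  obtain ⟨i, rfl⟩ := List.get_of_mem hz
  have hlt : ∀ k ≠ label θ (Z.get i), score (expand e p + s • expand e q) k (Z.get i) <
      score (expand e p + s • expand e q) (label θ (Z.get i)) (Z.get i) := by
    intro k hk
    have h1 := hB ⟨(i, k), hk⟩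
    have h2 := hs _ hz (label θ (Z.get i)) k
    simp only [a] at h1
    rw [← hp, ← hq, scoreForm_dotProduct, scoreForm_dotProduct] at h1
    have h3 : ∀ k, score (expand e p + s • expand e q) k (Z.get i) =
        score (expand e p) k (Z.get i) + s * score (expand e q) k (Z.get i) := by
      intro k
      simp [score, add_dotProduct]
    rw [h3, h3]
    set P := score (expand e p) (label θ (Z.get i)) (Z.get i) - score (expand e p) k (Z.get i)
      with hP
    set Q := score (expand e q) (label θ (Z.get i)) (Z.get i) - score (expand e q) k (Z.get i)
      with hQ
    have h4 : 0 < P + s * Q := by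
      rcases h1 with ⟨h5, h6⟩ | h5
      -- For Q = 0 the step length is irrelevant; the quotient P / Q is then 0 by convention and
      -- harmless.
      · rw [h5]; linarith
      -- With t = P / Q, s + t ≥ 1 + t² + t > 0; multiplying by Q > 0 gives the claim. This bound
      -- uses neither absolute values nor the labels, so the program can evaluate it without tests.
      · have h6 : 0 < s + P / Q := by nlinarith [sq_nonneg (P / Q + 1)]
        have h7 := mul_pos h6 h5
        rw [add_mul, div_mul_cancel₀ _ h5.ne'] at h7
        linarith
    have h5 : P + s * Q = (score (expand e p) (label θ (Z.get i)) (Z.get i) +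
        s * score (expand e q) (label θ (Z.get i)) (Z.get i)) -
        (score (expand e p) k (Z.get i) + s * score (expand e q) k (Z.get i)) := by
      rw [hP, hQ]; ring
    linarith
  exact label_eq_iff.2 fun k => ⟨fun h => hlt k h.ne, fun h => (hlt k h.ne').le⟩

end expand

/-! ### Trying a candidate -/

/-- The model in the blocks `6` and `7` has the cost in block `9`. -/
def HasBest (ℓ : ℚ → ℚ) (K d n : ℕ) (Z : List (Fin (d + 1) → ℚ)) (s : Mem) : Prop :=
  top s (addr K 9 0) = modelError ℓ (mat K 7 (n + 1) d s) (mat K 6 (n + 1) d s) Z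

/-- The memory holds the data and the best model found so far. -/
def Ready (ℓ : ℚ → ℚ) (K d n : ℕ) (Z : List (Fin (d + 1) → ℚ)) (s : Mem) : Prop :=
  HasData K Z s ∧ (∀ i < K, s i = []) ∧ HasBest ℓ K d n Z s

theorem pair_injective (n d : ℕ) :
    (fun i : Fin n × Fin d => Nat.pair i.1 i.2).Injective := by
  rintro ⟨i, j⟩ ⟨i', j'⟩ h
  simpa [Fin.ext_iff] using h

/-- Store the current model as the best one. -/
noncomputable def update (K d n : ℕ) : Prog :=
  .seq (assignAll K 6 (fun i : Fin n × Fin (d + 1) => Nat.pair i.1 i.2)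
      fun i => .cell 5 (Nat.pair i.1 i.2)) <|
    .seq (assignAll K 7 (fun i : Fin n × Fin (d + 1) => Nat.pair i.1 i.2)
      fun i => .cell (22 + 3 * i.1) i.2) (assign K 9 0 (.cell 8 0))

theorem touches_update (K d n : ℕ) : (update K d n).Touches K {1, 6, 7, 9} := by
  simp [update, touches_assignAll, touches_assign]

theorem runs_update (ℓ : ℚ → ℚ) (K d n : ℕ) : ∃ C, ∀ s : Mem,
    Runs ℓ (update K d n) s C fun s' => mat K 6 n d s' = mat K 5 n d s ∧
      mat K 7 n d s' = submodels K d n s ∧ top s' (addr K 9 0) = top s (addr K 8 0) := by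
  obtain ⟨C₁, h₁⟩ := runs_assignAll ℓ K (b := 6) (by simp) (pair_injective n (d + 1))
    fun i => .cell 5 (Nat.pair i.1 i.2)
  obtain ⟨C₂, h₂⟩ := runs_assignAll ℓ K (b := 7) (by simp) (pair_injective n (d + 1))
    fun i => .cell (22 + 3 * i.1) i.2
  refine ⟨C₁ + (C₂ + ((Expr.cell 8 0).cost + 1)), fun s => ?_⟩
  have hc : ∀ j : ℕ, 2 ≤ 22 + 3 * j := fun j => by omega
  refine (h₁ s fun s' h i => ?_).next (touches_assignAll (A := {1, 6}) (by simp) (by simp)) ?_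
  · simp [Expr.eval_cell, h.top]
  rintro s₁ h3 h4
  refine (h₂ s₁ fun s' h i => ?_).next (touches_assignAll (A := {1, 7}) (by simp) (by simp)) ?_
  · rw [Expr.eval_cell (hc _), Expr.eval_cell (hc _), h.top (by simp; omega)]
  rintro s₂ h5 h6
  refine ((runs_assign _ s₂).same (touches_assign (A := {1, 9}) (by simp) (by simp))).imp ?_
  rintro s₃ ⟨⟨h7, -⟩, h8⟩
  refine ⟨?_, ?_, ?_⟩
  · rw [h8.mat (by simp), h6.mat (by simp)]
    funext k c
    simpa [Expr.eval_cell, mat] using h3 (k, c)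
  · rw [h8.mat (by simp)]
    funext k c
    have := h5 (k, c)
    rw [Expr.eval_cell (hc _), h4.top (by simp; omega)] at this
    exact this
  · rw [h7, Expr.eval_cell (by simp), h6.top (by simp), h4.top (by simp)]

section candidate

variable {m d D : ℕ} (e : Fin m × Fin (d + 1) ≃ Fin (D + 1))

/-- The parameters of a classifier whose last category has score `0`, from block `b`. -/
noncomputable def expandE (b : ℕ) (k : Fin (m + 1)) (c : Fin (d + 1)) : Expr :=
  .fsum fun i : Fin (D + 1) => .op .mul (.cell b i) (.const (expand e (Pi.single i 1) k c))

theorem eval_expandE {K b : ℕ} (hb : 2 ≤ b) {s : Mem} (k : Fin (m + 1)) (c : Fin (d + 1)) :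
    (expandE e b k c).eval K s = expand e (vec K b D s) k c := by
  rw [expand_eq_sum]
  simp [expandE, Op.eval, Expr.eval_cell hb, vec]

/-- The difference of the scores of two categories at the current point. -/
noncomputable def diffE (b : ℕ) (k l : Fin (m + 1)) : Expr :=
  .fsum fun c => .op .mul (.op .sub (expandE e b k c) (expandE e b l c)) (barE 2 c)

theorem eval_diffE {K b : ℕ} (hb : 2 ≤ b) {s : Mem} (k l : Fin (m + 1)) :
    (diffE e b k l).eval K s = score (expand e (vec K b D s)) k (vec K 2 d s) -
      score (expand e (vec K b D s)) l (vec K 2 d s) := by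
  simp [diffE, Op.eval, eval_expandE e hb, eval_barE, score, dotProduct, sub_mul]

/-- The contribution of the current point to the step length along the edge. -/
noncomputable def stepE : Expr :=
  .fsum fun i : Fin (m + 1) × Fin (m + 1) => .op .add (.const 1)
    (.op .mul (.op .div (diffE e 11 i.1 i.2) (diffE e 12 i.1 i.2))
      (.op .div (diffE e 11 i.1 i.2) (diffE e 12 i.1 i.2)))

/-- The step length `σ` suffices to reach all signs at infinity. -/
def LongStep (p q : Fin (D + 1) → ℚ) (σ : ℚ) (z : Fin (d + 1) → ℚ) : Prop :=
  ∀ k l, 1 + ((score (expand e p) k z - score (expand e p) l z) /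
    (score (expand e q) k z - score (expand e q) l z)) ^ 2 ≤ σ

theorem longStep_stepE {K : ℕ} {s : Mem} :
    LongStep e (vec K 11 D s) (vec K 12 D s) ((stepE e).eval K s) (vec K 2 d s) := by
  intro k l
  simp only [stepE, Expr.eval_fsum, Expr.eval_op, Expr.eval_const, Op.eval,
    eval_diffE e (show 2 ≤ 11 by simp), eval_diffE e (show 2 ≤ 12 by simp), ← pow_two]
  exact Finset.single_le_sum (f := fun i : Fin (m + 1) × Fin (m + 1) =>
    1 + ((score (expand e (vec K 11 D s)) i.1 (vec K 2 d s) -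
      score (expand e (vec K 11 D s)) i.2 (vec K 2 d s)) /
    (score (expand e (vec K 12 D s)) i.1 (vec K 2 d s) -
      score (expand e (vec K 12 D s)) i.2 (vec K 2 d s))) ^ 2)
    (fun i _ => by positivity) (Finset.mem_univ (k, l))

theorem stepE_nonneg {K : ℕ} {s : Mem} : 0 ≤ (stepE e).eval K s := by
  simp only [stepE, Expr.eval_fsum, Expr.eval_op, Expr.eval_const, Op.eval, ← pow_two]
  positivity

/-- Compute the step length. -/
noncomputable def computeStep (K : ℕ) : Prog :=
  .seq (.push 0 (addr K 10 0)) (pass K d (assign K 10 0 (.op .add (.cell 10 0) (stepE e))))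

theorem touches_computeStep (K : ℕ) : (computeStep e K).Touches K {1, 2, 3, 4, 10} := by
  refine Prog.Touches.seq_iff.2 ⟨by simp, touches_pass (touches_assign (by simp) (by simp)) ?_⟩
  simp [Set.insert_subset_iff]

theorem runs_computeStep (ℓ : ℚ → ℚ) (K : ℕ) : ∃ C, ∀ (M : ℕ) (Z : List (Fin (d + 1) → ℚ))
    (s : Mem), Z.length ≤ M → 1 ≤ M → HasData K Z s →
    Runs ℓ (computeStep e K) s (C * M) fun s' => HasData K Z s' ∧
      ∀ z ∈ Z, LongStep e (vec K 11 D s) (vec K 12 D s) (top s' (addr K 10 0)) z := by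
  refine ⟨(Expr.op .add (.cell 10 0) (stepE e)).cost + 1 + 7 * d + 9 + 3,
    fun M Z s hZ hM hs => ?_⟩
  set p := vec K 11 D s with hp
  set q := vec K 12 D s with hq
  have hsame : Same K {10} s (pushOn s (addr K 10 0) 0) := same_pushOn (by simp) _ _
  let I : List (Fin (d + 1) → ℚ) → Mem → Prop := fun l s' => vec K 11 D s' = p ∧
    vec K 12 D s' = q ∧ 0 ≤ top s' (addr K 10 0) ∧
    ∃ pre, Z = pre ++ l ∧ ∀ z ∈ pre, LongStep e p q (top s' (addr K 10 0)) z
  refine (Runs.seq (B₁ := 1) (.push _ _ (runs_pass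
    (B := (Expr.op .add (.cell 10 0) (stepE e)).cost + 1) (A := {1, 10})
    (touches_assign (by simp) (by simp)) (by simp) I ?_ ?_ (hs.congr hsame (by simp) (by simp))
    ⟨hsame.vec (by simp) _, hsame.vec (by simp) _, by simp, [], by simp⟩))).mono ?_ ?_
  · rintro l s₁ s₂ ⟨h1, h2, h3, pre, h4, h5⟩ h
    rw [← h.top (a := 10) (by simp)] at h3 h5
    exact ⟨(h.vec (by simp) _).trans h1, (h.vec (by simp) _).trans h2, h3, pre, h4, h5⟩
  · rintro z l s₁ hz ⟨h1, h2, h3, pre, h4, h5⟩ hvz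
    refine ((runs_assign _ s₁).same (touches_assign (A := {1, 10}) (by simp) (by simp))).imp ?_
    rintro s₂ ⟨⟨h6, -⟩, h7⟩
    have h8 := stepE_nonneg e (K := K) (s := s₁)
    have h9 := longStep_stepE e (K := K) (s := s₁)
    rw [h1, h2, hvz] at h9
    rw [Expr.eval_op, Op.eval, Expr.eval_cell (by simp)] at h6
    refine ⟨(h7.vec (by simp) _).trans h1, (h7.vec (by simp) _).trans h2, by linarith,
      pre ++ [z], by simpa using h4, fun z' hz' => ?_⟩
    rcases List.mem_append.1 hz' with hz' | hz'
    -- Each contribution is nonnegative, so the sum only grows and stays long enough for the earlier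
    -- points.
    · exact fun k k' => (h5 z' hz' k k').trans (by linarith)
    · obtain rfl : z' = z := by simpa using hz'
      exact fun k k' => (h9 k k').trans (by linarith)
  · have := linear_bound (a := (Expr.op .add (.cell 10 0) (stepE e)).cost + 1 + 7 * d + 9) (b := 3)
      hZ hM
    omega
  · rintro s' ⟨h1, -, -, -, pre, h3, h4⟩
    simp only [List.append_nil] at h3
    subst h3
    exact ⟨h1, h4⟩

/-- A linear form by which two scores differ, at the point in block `20 + 3 * j`. -/
noncomputable def scoreFormE (j : ℕ) (k l : Fin (m + 1)) (i : Fin (D + 1)) : Expr :=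
  .fsum fun c => .op .mul (.const (expand e (Pi.single i 1) k c - expand e (Pi.single i 1) l c))
    (barE (20 + 3 * j) c)

theorem eval_scoreFormE {K j : ℕ} {s : Mem} (k l : Fin (m + 1)) (i : Fin (D + 1)) :
    (scoreFormE e j k l i).eval K s = scoreForm e k l (vec K (20 + 3 * j) d s) i := by
  simp [scoreFormE, scoreForm, Op.eval, eval_barE (show 2 ≤ 20 + 3 * j by omega)]

variable (κ : Fin D → Fin (m + 1) × Fin (m + 1)) (c : Fin (D + 1)) (ε : ℚ)

/-- The linear forms determined by points `U 0, U 1, …`. -/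
def forms (U : ℕ → Fin (d + 1) → ℚ) (j : Fin D) : Fin (D + 1) → ℚ :=
  scoreForm e (κ j).1 (κ j).2 (U j)

/-- The matrix determining an edge. -/
noncomputable def edgeMatrixE : Matrix (Fin (D + 1)) (Fin (D + 1)) Expr :=
  Fin.snoc (α := fun _ => Fin (D + 1) → Expr)
    (fun j : Fin D => scoreFormE e j (κ j).1 (κ j).2) fun i => .const (Pi.single (M := fun _ => ℚ) c 1 i)

/-- The points in the blocks `20, 23, …`. -/
def points (K d : ℕ) (s : Mem) (j : ℕ) : Fin (d + 1) → ℚ := vec K (20 + 3 * j) d s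

theorem map_edgeMatrixE {K : ℕ} {s : Mem} :
    (edgeMatrixE e κ c).map (Expr.eval K s) = edgeMatrix (forms e κ (points K d s)) c := by
  ext j i
  refine Fin.lastCases ?_ (fun j => ?_) j
  · change (edgeMatrixE e κ c (Fin.last D) i).eval K s = _
    simp [edgeMatrixE, edgeMatrix]
  · change (edgeMatrixE e κ c j.castSucc i).eval K s = _
    simp [edgeMatrixE, edgeMatrix, eval_scoreFormE, forms, points]

/-- Compute the base point and the direction of an edge. -/
noncomputable def computeEdge (K : ℕ) : Prog :=
  .seq (assignAll K 11 (fun i : Fin (D + 1) => (i : ℕ)) (Expr.solve (edgeMatrixE e κ c) fun j =>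
      .const (Fin.snoc (α := fun _ => ℚ) (fun _ => 1) 0 j)))
    (assignAll K 12 (fun i : Fin (D + 1) => (i : ℕ)) (Expr.solve (edgeMatrixE e κ c) fun j =>
      .const (Fin.snoc (α := fun _ => ℚ) (fun _ => 0) ε j)))

theorem touches_computeEdge (K : ℕ) : (computeEdge e κ c ε K).Touches K {1, 11, 12} := by
  simp [computeEdge, touches_assignAll]

theorem runs_computeEdge (ℓ : ℚ → ℚ) (K : ℕ) : ∃ C, ∀ s : Mem,
    Runs ℓ (computeEdge e κ c ε K) s C fun s' =>
      vec K 11 D s' = edgePoint (forms e κ (points K d s)) c ∧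
      vec K 12 D s' = edgeDir (forms e κ (points K d s)) c ε := by
  obtain ⟨C₁, h₁⟩ := runs_assignAll ℓ K (b := 11) (by simp) (Fin.val_injective (n := D + 1))
    (Expr.solve (edgeMatrixE e κ c) fun j =>
      .const (Fin.snoc (α := fun _ => ℚ) (fun _ => 1) 0 j))
  obtain ⟨C₂, h₂⟩ := runs_assignAll ℓ K (b := 12) (by simp) (Fin.val_injective (n := D + 1))
    (Expr.solve (edgeMatrixE e κ c) fun j =>
      .const (Fin.snoc (α := fun _ => ℚ) (fun _ => 0) ε j))
  have hpts : ∀ {A : Set ℕ} {s s' : Mem}, Same K A s s' → (∀ j, 20 + 3 * j ∉ A) →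
      points K d s' = points K d s := fun h hA => funext fun j => h.vec (hA j) _
  refine ⟨C₁ + C₂, fun s => ?_⟩
  refine (h₁ s fun s' h i => ?_).next (touches_assignAll (A := {1, 11}) (by simp) (by simp)) ?_
  · rw [Expr.eval_solve, Expr.eval_solve, map_edgeMatrixE, map_edgeMatrixE, hpts h]
    · rfl
    · intro j; simp; omega
  rintro s₁ h3 h4
  have e4 := hpts h4 (by intro j; simp; omega)
  refine ((h₂ s₁ fun s' h i => ?_).same (touches_assignAll (A := {1, 12}) (by simp) (by simp))).imp
    ?_
  · rw [Expr.eval_solve, Expr.eval_solve, map_edgeMatrixE, map_edgeMatrixE, hpts h]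
    · rfl
    · intro j; simp; omega
  rintro s₂ ⟨h5, h6⟩
  constructor
  · rw [h6.vec (by simp)]
    funext i
    rw [vec, h3 i, Expr.eval_solve, map_edgeMatrixE]
    rfl
  · funext i
    rw [vec, h5 i, Expr.eval_solve, map_edgeMatrixE, e4]
    rfl

/-- Compute the candidate classifier on an edge. -/
noncomputable def computeClassifier (K : ℕ) : Prog :=
  assignAll K 5 (fun i : Fin (m + 1) × Fin (d + 1) => Nat.pair i.1 i.2) fun i =>
    .op .add (expandE e 11 i.1 i.2) (.op .mul (.cell 10 0) (expandE e 12 i.1 i.2))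

theorem runs_computeClassifier (ℓ : ℚ → ℚ) (K : ℕ) : ∃ C, ∀ s : Mem,
    Runs ℓ (computeClassifier e K) s C fun s' => mat K 5 (m + 1) d s' =
      expand e (vec K 11 D s) + top s (addr K 10 0) • expand e (vec K 12 D s) := by
  obtain ⟨C, h⟩ := runs_assignAll ℓ K (b := 5) (by simp) (pair_injective (m + 1) (d + 1))
    fun i => .op .add (expandE e 11 i.1 i.2) (.op .mul (.cell 10 0) (expandE e 12 i.1 i.2))
  have heval : ∀ s k c, (Expr.op .add (expandE e 11 k c)
      (.op .mul (.cell 10 0) (expandE e 12 k c))).eval K s =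
      (expand e (vec K 11 D s) + top s (addr K 10 0) • expand e (vec K 12 D s)) k c := by
    intro s k c
    simp [Op.eval, eval_expandE, Expr.eval_cell]
  refine ⟨C, fun s => (h s fun s' h i => ?_).imp fun s' h => ?_⟩
  · rw [heval, heval, h.vec (by simp), h.vec (by simp), h.top (by simp)]
  · funext k c
    exact (h (k, c)).trans (heval s k c)

/-- Compute the candidate classifier determined by the current points and keep the resulting model
if it is better than all previous ones. -/
noncomputable def tryCandidate (K : ℕ) (R : Prog) : Prog :=
  .seq (computeEdge e κ c ε K) <| .seq (computeStep e K) <| .seq (computeClassifier e K) <|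
    .seq (evaluate K d (m + 1) R) <| .seq (assign K 13 0 (.op .sub (.cell 9 0) (.cell 8 0))) <|
      .branch (.pos (addr K 13 0)) (update K d (m + 1)) (skip K)

/-- The blocks changed by `tryCandidate`. -/
def tryBlocks : Set ℕ := evalBlocks ∪ {5, 6, 7, 9, 10, 11, 12}

theorem touches_tryCandidate {K : ℕ} {R : Prog} (hK : 2 ≤ K) (hR : R.bound ≤ K) :
    (tryCandidate e κ c ε K R).Touches K tryBlocks := by
  have h1 : (computeEdge e κ c ε K).Touches K tryBlocks :=
    (touches_computeEdge e κ c ε K).mono (by simp [tryBlocks, evalBlocks, Set.insert_subset_iff])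
  have h2 : (computeStep e K).Touches K tryBlocks :=
    (touches_computeStep e K).mono (by simp [tryBlocks, evalBlocks, Set.insert_subset_iff])
  have h3 : (computeClassifier e K).Touches K tryBlocks :=
    touches_assignAll (by simp [tryBlocks, evalBlocks]) (by simp [tryBlocks])
  have h4 : (evaluate K d (m + 1) R).Touches K tryBlocks :=
    (touches_evaluate hK hR).mono Set.subset_union_left
  have h5 : (assign K 13 0 (.op .sub (.cell 9 0) (.cell 8 0))).Touches K tryBlocks :=
    touches_assign (by simp [tryBlocks, evalBlocks]) (by simp [tryBlocks, evalBlocks])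
  have h6 : (update K d (m + 1)).Touches K tryBlocks :=
    (touches_update K d (m + 1)).mono (by simp [tryBlocks, evalBlocks, Set.insert_subset_iff])
  have h7 : 1 ∈ tryBlocks := by simp [tryBlocks, evalBlocks]
  simp [tryCandidate, h1, h2, h3, h4, h5, h6, h7]

/-- The cost `b` is at most that of all models with the candidate classifier determined by the
points `U`. -/
def Beats (ℓ : ℚ → ℚ) (Z : List (Fin (d + 1) → ℚ)) (U : ℕ → Fin (d + 1) → ℚ) (b : ℚ) : Prop :=
  ∃ σ, (∀ z ∈ Z, LongStep e (edgePoint (forms e κ U) c) (edgeDir (forms e κ U) c ε) σ z) ∧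
    ∀ w, b ≤ modelError ℓ w (expand e (edgePoint (forms e κ U) c) +
      σ • expand e (edgeDir (forms e κ U) c ε)) Z

theorem Beats.mono {Z : List (Fin (d + 1) → ℚ)} {U : ℕ → Fin (d + 1) → ℚ} {b b' : ℚ}
    (h : Beats e κ c ε ℓ Z U b) (hb : b' ≤ b) : Beats e κ c ε ℓ Z U b' := by
  obtain ⟨σ, h1, h2⟩ := h
  exact ⟨σ, h1, fun w => hb.trans (h2 w)⟩

/-- No validity check of the candidate is needed: a singular system still yields some classifier,
whose optimal model is a legitimate competitor. In `Beats` the step length is existentially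
quantified since any sufficiently long step gives the labelling sought. -/
theorem runs_tryCandidate {K : ℕ} {R : Prog} {T : ℕ → ℕ} {P : (Fin (d + 1) → ℚ) → Prop}
    (hK : 2 ≤ K) (hRK : R.bound ≤ K) (hT : Monotone T) (hR : ListRegression ℓ R T P) :
    ∃ C, ∀ (M : ℕ) (Z : List (Fin (d + 1) → ℚ)) (s : Mem), Z.length ≤ M → T Z.length ≤ M →
      1 ≤ M → (∀ z ∈ Z, P z) → Ready ℓ K d m Z s →
      Runs ℓ (tryCandidate e κ c ε K R) s (C * M) fun s' => Ready ℓ K d m Z s' ∧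
        top s' (addr K 9 0) ≤ top s (addr K 9 0) ∧
        Beats e κ c ε ℓ Z (points K d s) (top s' (addr K 9 0)) := by
  obtain ⟨C₁, h₁⟩ := runs_computeEdge e κ c ε ℓ K
  obtain ⟨C₂, h₂⟩ := runs_computeStep e ℓ K
  obtain ⟨C₃, h₃⟩ := runs_computeClassifier e ℓ K
  obtain ⟨C₄, h₄⟩ := runs_evaluate m hK hRK hT hR
  obtain ⟨C₅, h₅⟩ := runs_update ℓ K d (m + 1)
  set a := (Expr.op .sub (.cell 9 0) (.cell 8 0)).cost + 1 with ha
  refine ⟨C₁ + C₂ + C₃ + C₄ + a + (C₅ + 2), fun M Z s hZ hTM hM hP ⟨hs, hlow, hbest⟩ => ?_⟩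
  suffices h : Runs ℓ (tryCandidate e κ c ε K R) s (C₁ + (C₂ * M + (C₃ + (C₄ * M + (a +
      (C₅ + 1 + 1)))))) fun s' => Ready ℓ K d m Z s' ∧
        top s' (addr K 9 0) ≤ top s (addr K 9 0) ∧
        Beats e κ c ε ℓ Z (points K d s) (top s' (addr K 9 0)) by
    refine h.le ?_
    nlinarith [Nat.mul_le_mul_left (C₁ + C₃ + a + C₅ + 2) hM]
  refine (h₁ s).next (touches_computeEdge e κ c ε K) ?_
  rintro s₁ ⟨e11, e12⟩ q1
  refine (h₂ M Z s₁ hZ hM (hs.congr q1 (by simp) (by simp))).next (touches_computeStep e K) ?_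
  rintro s₂ ⟨d2, hlong⟩ q2
  refine (h₃ s₂).next (touches_assignAll (A := {1, 5}) (by simp) (by simp)) ?_
  rintro s₃ e5 q3
  rw [q2.vec (by simp), q2.vec (by simp), e11, e12] at e5
  rw [e11, e12] at hlong
  refine (h₄ M Z s₃ hZ hTM hM hP (d2.congr q3 (by simp) (by simp)) fun i hi => ?_).next
    (touches_evaluate hK hRK) ?_
  · rw [q3.low (by simp) hi, q2.low (by simp) hi, q1.low (by simp) hi, hlow i hi]
  rintro s₄ ⟨d4, low4, e8, hopt⟩ q4
  refine (runs_assign _ s₄).next (touches_assign (A := {1, 13}) (by simp) (by simp)) ?_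
  rintro s₅ ⟨e13, -⟩ q5
  rw [Expr.eval_op, Op.eval, Expr.eval_cell (by simp), Expr.eval_cell (by simp)] at e13
  have n6 : (6 : ℕ) ∉ evalBlocks := by simp [evalBlocks]; omega
  have n7 : (7 : ℕ) ∉ evalBlocks := by simp [evalBlocks]; omega
  have n9 : (9 : ℕ) ∉ evalBlocks := by simp [evalBlocks]; omega
  have n5 : (5 : ℕ) ∉ evalBlocks := by simp [evalBlocks]; omega
  have b9 : top s₄ (addr K 9 0) = top s (addr K 9 0) := by
    rw [q4.top n9, q3.top (by simp), q2.top (by simp), q1.top (by simp)]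
  have b6 : mat K 6 (m + 1) d s₄ = mat K 6 (m + 1) d s := by
    rw [q4.mat n6, q3.mat (by simp), q2.mat (by simp), q1.mat (by simp)]
  have b7 : mat K 7 (m + 1) d s₄ = mat K 7 (m + 1) d s := by
    rw [q4.mat n7, q3.mat (by simp), q2.mat (by simp), q1.mat (by simp)]
  have hbeats : ∀ b, b ≤ top s₄ (addr K 8 0) → Beats e κ c ε ℓ Z (points K d s) b := by
    intro b hb
    refine ⟨top s₂ (addr K 10 0), hlong, fun w => hb.trans ?_⟩
    rw [← e5]
    exact hopt w
  -- The test is positive exactly when the stored cost exceeds the new one; in either case the cost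
  -- kept is at most both.
  refine Runs.branch (fun hb => ?_) (fun hb => (runs_skip fun s₆ q6 => ?_).le (by omega))
  · refine (((h₅ s₅).same (touches_update K d (m + 1))).imp ?_).le (by omega)
    rintro s₆ ⟨⟨f6, f7, f9⟩, q6⟩
    have f9' : top s₆ (addr K 9 0) = top s₄ (addr K 8 0) := by rw [f9, q5.top (by simp)]
    refine ⟨⟨(d4.congr q5 (by simp) (by simp)).congr q6 (by simp) (by simp), fun i hi => ?_, ?_⟩,
      ?_, hbeats _ f9'.le⟩
    · rw [q6.low (by simp) hi, q5.low (by simp) hi, low4 i hi]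
    · have hsub : submodels K d (m + 1) s₅ = submodels K d (m + 1) s₄ :=
        funext fun j => q5.vec (by simp; omega) _
      rw [HasBest, f9', e8, f6, f7, hsub, q5.mat (by simp), q4.mat n5]
    · rw [Test.Holds, e13] at hb
      rw [f9', ← b9]
      linarith
  · have g9 : top s₆ (addr K 9 0) = top s (addr K 9 0) := by
      rw [q6.top (by simp), q5.top (by simp), b9]
    refine ⟨⟨(d4.congr q5 (by simp) (by simp)).congr q6 (by simp) (by simp), fun i hi => ?_, ?_⟩,
      g9.le, hbeats _ ?_⟩
    · rw [q6.low (by simp) hi, q5.low (by simp) hi, low4 i hi]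
    · rw [HasBest, g9, hbest, q6.mat (by simp), q5.mat (by simp), b7, q6.mat (by simp),
        q5.mat (by simp), b6]
    · rw [Test.Holds, e13] at hb
      rw [g9, ← b9]
      linarith

end candidate

/-! ### Enumeration of tuples of data points -/

/-- Copy the data to stack `0` of block `b`. -/
def copyData (K b : ℕ) : Prog :=
  .seq (move (addr K 3 0) (addr K 4 0) (addr K 1 0)) (move (addr K 4 0) (addr K 3 0) (addr K b 0))

theorem runs_copyData {K b d : ℕ} (h1 : b ≠ 1) (h3 : b ≠ 3) (h4 : b ≠ 4)
    {Z : List (Fin (d + 1) → ℚ)} {s : Mem} (hs : HasData K Z s) :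
    Runs ℓ (copyData K b) s (Z.length * ((d + 1) * 8) + 2) fun s' => Same K {1, b} s s' ∧
      s' (addr K b 0) = enc Z ++ s (addr K b 0) := by
  refine ((runs_move (i := addr K 3 0) (j := addr K 4 0) (k := addr K 1 0) (by simp) (by simp)
    (by simp) s).andThen (B₂ := Z.length * ((d + 1) * 4) + 1) ?_).le ?_
  · rintro s₁ ⟨e1, e2, -⟩ e3
    refine (runs_move (i := addr K 4 0) (j := addr K 3 0) (k := addr K b 0) (by simp)
      (by simp [h4.symm]) (by simp [h3.symm]) s₁).frame.mono ?_ ?_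
    · rw [e2, hs.1, hs.2]; simp [mul_assoc]
    · rintro s₂ ⟨⟨f1, f2, f3⟩, f4⟩
      rw [e2, hs.1, hs.2, List.append_nil, List.reverse_reverse] at f2 f3
      rw [e3 _ (by simp [move, Prog.mods, h1, h3, h4])] at f3
      refine ⟨fun i hi => ?_, f3⟩
      by_cases hi3 : i = addr K 3 0
      · subst hi3; rw [f2, e1, hs.1]; simp
      by_cases hi4 : i = addr K 4 0
      · subst hi4; rw [f1, hs.2]
      have hi1 : i ≠ addr K 1 0 := by rintro rfl; simp at hi
      have hib : i ≠ addr K b 0 := by rintro rfl; simp at hi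
      rw [f4 i (by simp [move, Prog.mods, hi3, hi4, hib]),
        e3 i (by simp [move, Prog.mods, hi3, hi4, hi1])]
  · rw [hs.1, length_enc]; ring_nf; omega

/-- Run `body` for all tuples of `k` data points; the `j`-th of them is kept in block
`20 + 3 * j`. -/
def forTuples (K d : ℕ) (body : Prog) : ℕ → Prog
  | 0 => body
  | k + 1 => .seq (copyData K (21 + 3 * k)) (.loop (.nonempty (addr K (21 + 3 * k) 0))
      (.seq (load K d (20 + 3 * k) (addr K (21 + 3 * k) 0) (addr K 14 0)) (forTuples K d body k)))

/-- The blocks used by the first `k` loops. -/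
def loopBlocks (k : ℕ) : Set ℕ := {1, 14} ∪ {a | ∃ j < k, a = 20 + 3 * j ∨ a = 21 + 3 * j}

theorem loopBlocks_mono {k l : ℕ} (h : k ≤ l) : loopBlocks k ⊆ loopBlocks l := by
  rintro a (ha | ⟨j, hj, ha⟩)
  · exact Or.inl ha
  · exact Or.inr ⟨j, by omega, ha⟩

theorem touches_forTuples {K d : ℕ} {body : Prog} {A : Set ℕ} (hbody : body.Touches K A) (k : ℕ) :
    (forTuples K d body k).Touches K (A ∪ {3, 4} ∪ loopBlocks k) := by
  induction k with
  | zero => exact hbody.mono (by intro a ha; exact Or.inl (Or.inl ha))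
  | succ k ih =>
    have h1 : (load K d (20 + 3 * k) (addr K (21 + 3 * k) 0) (addr K 14 0)).Touches K
        (A ∪ {3, 4} ∪ loopBlocks (k + 1)) := by
      refine touches_load (Or.inr (Or.inl (by simp))) (Or.inr (Or.inr ⟨k, by simp⟩)) ?_ ?_
      · rw [blk_addr]; exact Or.inr (Or.inr ⟨k, by simp⟩)
      · rw [blk_addr]; exact Or.inr (Or.inl (by simp))
    have h2 := ih.mono (Set.union_subset_union_right (A ∪ {3, 4})
      (loopBlocks_mono (Nat.le_succ k)))
    have h3 : 1 ∈ A ∪ {3, 4} ∪ loopBlocks (k + 1) := Or.inr (Or.inl (by simp))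
    have h4 : 21 + 3 * k ∈ A ∪ {3, 4} ∪ loopBlocks (k + 1) := Or.inr (Or.inr ⟨k, by simp⟩)
    have h5 : 3 ∈ A ∪ {3, 4} ∪ loopBlocks (k + 1) := Or.inl (Or.inr (by simp))
    have h6 : 4 ∈ A ∪ {3, 4} ∪ loopBlocks (k + 1) := Or.inl (Or.inr (by simp))
    generalize A ∪ {3, 4} ∪ loopBlocks (k + 1) = A' at *
    simp [forTuples, copyData, move, h1, h2, h3, h4, h5, h6]

/-- Nested loops, the k-th point being chosen outside the loops for the smaller indices. The
quantity `val` never increases and Φ is stable under decreasing it, so what a tuple has established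
persists. Points with index at least k belong to enclosing loops and are fixed; this is why U is
indexed by ℕ and prescribed there. -/
theorem runs_forTuples {K d : ℕ} {body : Prog} {A : Set ℕ} (hbody : body.Touches K A)
    (hA : ∀ j, 20 + 3 * j ∉ A ∧ 21 + 3 * j ∉ A) {Z : List (Fin (d + 1) → ℚ)} (hZ : 1 ≤ Z.length)
    {B : ℕ} (hB : 1 ≤ B) (I : Mem → Prop) (val : Mem → ℚ)
    (Φ : (ℕ → Fin (d + 1) → ℚ) → ℚ → Prop) (hΦ : ∀ U b b', Φ U b → b' ≤ b → Φ U b')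
    (hdata : ∀ s, I s → HasData K Z s)
    (hI : ∀ k s s', Same K (loopBlocks k) s s' → I s → I s' ∧ val s' = val s)
    (hrun : ∀ s, I s → Runs ℓ body s B fun s' => I s' ∧ val s' ≤ val s ∧
      Φ (points K d s) (val s')) (k : ℕ) :
    ∀ s, I s → (∀ j < k, s (addr K (21 + 3 * j) 0) = []) →
      Runs ℓ (forTuples K d body k) s ((11 * d + 17) ^ k * Z.length ^ k * B) fun s' =>
        I s' ∧ val s' ≤ val s ∧ (∀ j < k, s' (addr K (21 + 3 * j) 0) = []) ∧
        ∀ U : ℕ → Fin (d + 1) → ℚ, (∀ j < k, U j ∈ Z) → (∀ j, k ≤ j → U j = points K d s j) →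
          Φ U (val s') := by
  induction k with
  | zero =>
    intro s hs _
    refine (hrun s hs).mono (by simp) ?_
    rintro s' ⟨h1, h2, h3⟩
    refine ⟨h1, h2, by simp, fun U _ hU => ?_⟩
    rwa [show U = points K d s from funext fun j => hU j (by omega)]
  | succ k ih =>
    intro s hs hempty
    set N := Z.length with hN
    set Bk := (11 * d + 17) ^ k * N ^ k * B with hBk
    have hBk1 : 1 ≤ Bk := Nat.one_le_iff_ne_zero.2 (by positivity)
    have hloop : ∀ j, (20 + 3 * j ∉ A ∪ {3, 4} ∪ loopBlocks k ↔ k ≤ j) ∧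
        (21 + 3 * j ∉ A ∪ {3, 4} ∪ loopBlocks k ↔ k ≤ j) := by
      intro j
      have := hA j
      simp only [loopBlocks, Set.mem_union, Set.mem_insert_iff, Set.mem_singleton_iff,
        Set.mem_ofPred_eq, this.1, this.2, false_or, not_or, not_exists, not_and]
      constructor
      · refine ⟨fun h => ?_, fun h => ⟨by omega, by omega, fun i hi => by omega⟩⟩
        by_contra! hk
        exact (h.2.2 j hk).1 rfl
      · refine ⟨fun h => ?_, fun h => ⟨by omega, by omega, fun i hi => by omega⟩⟩
        by_contra! hk
        exact (h.2.2 j hk).2 rfl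
    -- The prefix `pre` lists the values already tried for the k-th point; Φ is known for all tuples
    -- whose k-th entry is among them.
    let J : List (Fin (d + 1) → ℚ) → Mem → Prop := fun l s' => I s' ∧ val s' ≤ val s ∧
      (∀ j < k, s' (addr K (21 + 3 * j) 0) = []) ∧ s' (addr K (21 + 3 * k) 0) = enc l ∧
      (∀ j, k + 1 ≤ j → points K d s' j = points K d s j) ∧
      ∃ pre, Z = pre ++ l ∧ ∀ U : ℕ → Fin (d + 1) → ℚ, U k ∈ pre → (∀ j < k, U j ∈ Z) →
        (∀ j, k + 1 ≤ j → U j = points K d s j) → Φ U (val s')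
    refine Runs.le (Runs.seq ((runs_copyData (b := 21 + 3 * k) (by omega) (by omega) (by omega)
      (hdata s hs)).imp (Q₂ := fun s' => Runs ℓ _ s' (N * ((d + 1) * 3 + 1 + Bk + 1) + 1) _) ?_)) ?_
    · rintro s₁ ⟨h1, h2⟩
      have h1' : Same K (loopBlocks (k + 1)) s s₁ := h1.mono (by
        rintro a (rfl | rfl)
        · exact Or.inl (by simp)
        · exact Or.inr ⟨k, by simp⟩)
      rw [hempty k (by omega), List.append_nil] at h2
      obtain ⟨g1, g2⟩ := hI _ _ _ h1' hs
      refine (Runs.loop_list (B := (d + 1) * 3 + 1 + Bk) J ?_ ?_ Z s₁ ⟨g1, g2.le, fun j hj => ?_,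
        h2, fun j hj => ?_, [], by simp⟩).imp ?_
      · rintro s' ⟨-, -, -, h, -⟩
        simp [Test.Holds, h]
      · rintro z l s₂ ⟨i1, i2, i3, i4, i5, pre, i6, i7⟩
        refine ⟨by simp [Test.Holds, i4, ← List.length_eq_zero_iff], ?_⟩
        have hl := runs_load (ℓ := ℓ) (K := K) (b := 20 + 3 * k) (i := addr K (21 + 3 * k) 0)
          (j := addr K 14 0) (by omega) (by simp; omega) (by simp) (by simp; omega)
          (by simp; omega) (by simp) (i4.trans (enc_cons z l))
        refine hl.next (touches_load (A := {1, 14, 20 + 3 * k, 21 + 3 * k}) (by simp) (by simp)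
          (by simp) (by simp)) fun s₃ ⟨j1, j2, _⟩ j3 => ?_
        have j3' : Same K (loopBlocks (k + 1)) s₂ s₃ := j3.mono (by
          rintro a (rfl | rfl | rfl | rfl)
          · exact Or.inl (by simp)
          · exact Or.inl (by simp)
          · exact Or.inr ⟨k, by simp⟩
          · exact Or.inr ⟨k, by simp⟩)
        obtain ⟨k1, k2⟩ := hI _ _ _ j3' i1
        have k3 : ∀ j < k, s₃ (addr K (21 + 3 * j) 0) = [] := fun j hj => by
          rw [j3.addr (by simp; omega), i3 j hj]
        have k4 : ∀ j, k + 1 ≤ j → points K d s₃ j = points K d s j := fun j hj => by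
          rw [← i5 j hj]
          exact j3.vec (by simp; omega) _
        refine ((ih s₃ k1 k3).same (touches_forTuples hbody k)).imp ?_
        rintro s₄ ⟨⟨l1, l2, l3, l4⟩, l5⟩
        refine ⟨l1, by linarith, l3, ?_, fun j hj => ?_, pre ++ [z], by simpa using i6,
          fun U hU1 hU2 hU3 => ?_⟩
        · rw [l5.addr ((hloop k).2.2 le_rfl), j2]
        · rw [← k4 j hj]
          exact l5.vec ((hloop j).1.2 (by omega)) _
        · rcases List.mem_append.1 hU1 with hU1 | hU1
          · exact hΦ _ _ _ (i7 U hU1 hU2 hU3) (by linarith)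
          · refine l4 U hU2 fun j hj => ?_
            rcases hj.eq_or_lt with rfl | hj
            · rw [List.mem_singleton.1 hU1, ← j1]; rfl
            · rw [hU3 j hj, k4 j hj]
      · rw [h1.addr (by simp; omega), hempty j (by omega)]
      · exact h1.vec (by simp; omega) _
      · rintro s' ⟨i1, i2, i3, i4, -, pre, i6, i7⟩
        simp only [List.append_nil] at i6
        subst i6
        refine ⟨i1, i2, fun j hj => ?_, fun U hU1 hU2 => i7 U (hU1 k (by omega))
          (fun j hj => hU1 j (by omega)) hU2⟩
        rcases (Nat.lt_succ_iff.1 hj).eq_or_lt with rfl | hj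
        · exact i4
        · exact i3 j hj
    · have e : (11 * d + 17) ^ (k + 1) * N ^ (k + 1) * B = (11 * d + 17) * (N * Bk) := by
        rw [hBk]; ring
      rw [e]
      -- Copying costs 8(d+1) and loading with its loop test 3(d+1)+2 steps per point, besides Bk
      -- for the inner loops and 3 steps once: 11d + 13 + 1 + 3 = 11d + 17.
      have h1 : N ≤ N * Bk := Nat.le_mul_of_pos_right _ hBk1
      nlinarith [Nat.mul_le_mul_left d h1]

/-! ### The complete program -/

/-- The parameters of a model as a list of rational numbers. -/
def encodeMat {d n : ℕ} (w : Fin n → Fin (d + 1) → ℚ) : List ℚ :=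
  (List.ofFn fun j => List.ofFn (w j)).flatten

/-- The stacks holding the matrix in block `b`. -/
def matStacks (K b n d : ℕ) : List ℕ :=
  (List.ofFn fun j : Fin n => List.ofFn fun c : Fin (d + 1) => addr K b (Nat.pair j c)).flatten

theorem map_top_matStacks (K b n d : ℕ) (s : Mem) :
    (matStacks K b n d).map (top s) = encodeMat (mat K b n d s) := by
  simp only [matStacks, encodeMat, List.map_flatten, List.map_ofFn, Function.comp_def]
  rfl

/-- Push the tops of the given stacks onto stack `1`, in reverse order. -/
def output (K : ℕ) (l : List ℕ) : Prog := forList K l.reverse fun r => .copy r 1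

theorem runs_output {K : ℕ} (hK : 2 ≤ K) (l : List ℕ) (hl : ∀ r ∈ l, blk K r ≠ 0 ∧ blk K r ≠ 1)
    (s : Mem) : Runs ℓ (output K l) s (l.length + 1) fun s' => s' 1 = l.map (top s) ++ s 1 := by
  have b1 : blk K 1 = 0 := blk_of_lt (by omega)
  let I : List ℕ → Mem → Prop := fun l' s' => Same K {0} s s' ∧ ∃ pre, l.reverse = pre ++ l' ∧
    s' 1 = (pre.map (top s)).reverse ++ s 1
  refine (runs_forList (B := 1) I ?_ _ s ⟨Same.refl _ _ _, [], by simp⟩).mono (by simp) ?_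
  · rintro r l' s' ⟨h1, pre, h2, h3⟩
    have hr := hl r (List.mem_reverse.1 (h2 ▸ by simp))
    refine .copy _ _ ⟨h1.trans (same_pushOn (by simp [b1]) _ _), pre ++ [r], by simpa using h2, ?_⟩
    have : top s' r = top s r := top_congr (h1 r (by simpa using hr.1))
    simp [h3, this]
  · rintro s' ⟨s₀, ⟨-, pre, h2, h3⟩, h'⟩
    simp only [List.append_nil] at h2
    rw [h'.low (by simp) (by omega), h3, ← h2]
    simp

/-- Move the input to the data block. -/
def readInput (K : ℕ) : Prog :=
  .seq (move 0 (addr K 4 0) (addr K 1 0)) (move (addr K 4 0) (addr K 3 0) (addr K 1 0))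

theorem runs_readInput {K d : ℕ} (hK : 0 < K) (Z : List (Fin (d + 1) → ℚ)) :
    Runs ℓ (readInput K) (Function.update (fun _ => []) 0 (enc Z)) (Z.length * ((d + 1) * 8) + 2)
      fun s' => HasData K Z s' ∧ (∀ i < K, s' i = []) ∧
        ∀ j, s' (addr K (21 + 3 * j) 0) = [] := by
  set s : Mem := Function.update (fun _ => []) 0 (enc Z) with hs
  have h0 : ∀ a i, addr K a i ≠ 0 := fun a i => (lt_addr hK a i).symm
  have hs0 : s 0 = enc Z := by simp [hs]
  have hsa : ∀ i, i ≠ 0 → s i = [] := fun i hi => by simp [hs, hi]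
  refine ((runs_move (i := 0) (j := addr K 4 0) (k := addr K 1 0) (h0 _ _).symm (h0 _ _).symm
    (by simp) s).andThen (B₂ := Z.length * ((d + 1) * 4) + 1) ?_).le ?_
  · rintro s₁ ⟨e1, e2, -⟩ e3
    rw [hs0, hsa _ (h0 _ _), List.append_nil] at e2
    refine (runs_move (i := addr K 4 0) (j := addr K 3 0) (k := addr K 1 0) (by simp)
      (by simp) (by simp) s₁).frame.mono ?_ ?_
    · rw [e2]; simp [mul_assoc]
    · rintro s₂ ⟨⟨f1, f2, -⟩, f4⟩
      rw [e2, e3 _ (by simp [move, Prog.mods, h0]), hsa _ (h0 _ _)] at f2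
      refine ⟨⟨by simpa using f2, f1⟩, fun i hi => ?_, fun j => ?_⟩
      · have hne := lt_addr hi
        rw [f4 i (by simp [move, Prog.mods, hne])]
        by_cases hi0 : i = 0
        · rw [hi0, e1]
        · rw [e3 i (by simp [move, Prog.mods, hne, hi0]), hsa i hi0]
      · rw [f4 _ (by simp [move, Prog.mods]; omega), e3 _ (by simp [move, Prog.mods, h0]; omega),
          hsa _ (h0 _ _)]
  · rw [hs0, length_enc]; ring_nf; omega

section solver

variable {m d D : ℕ} (e : Fin m × Fin (d + 1) ≃ Fin (D + 1))

/-- Start with the best model for the classifier with parameters `0`. -/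
noncomputable def startBest (K d m : ℕ) (R : Prog) : Prog :=
  .seq (assignAll K 5 (fun i : Fin (m + 1) × Fin (d + 1) => Nat.pair i.1 i.2) fun _ => .const 0) <|
    .seq (evaluate K d (m + 1) R) (update K d (m + 1))

theorem touches_startBest {K : ℕ} {R : Prog} (hK : 2 ≤ K) (hR : R.bound ≤ K) :
    (startBest K d m R).Touches K tryBlocks := by
  have h4 : (evaluate K d (m + 1) R).Touches K tryBlocks :=
    (touches_evaluate hK hR).mono Set.subset_union_left
  have h6 : (update K d (m + 1)).Touches K tryBlocks :=
    (touches_update K d (m + 1)).mono (by simp [tryBlocks, evalBlocks, Set.insert_subset_iff])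
  have h1 : 1 ∈ tryBlocks := by simp [tryBlocks, evalBlocks]
  have h5 : 5 ∈ tryBlocks := by simp [tryBlocks]
  simp [startBest, h4, h6, touches_assignAll h1 h5]

/-- Provides a genuine model, so that the stored cost is from the start the cost of the stored
model. -/
theorem runs_startBest {K : ℕ} {R : Prog} {T : ℕ → ℕ} {P : (Fin (d + 1) → ℚ) → Prop} (m : ℕ)
    (hK : 2 ≤ K) (hRK : R.bound ≤ K) (hT : Monotone T) (hR : ListRegression ℓ R T P) :
    ∃ C, ∀ (M : ℕ) (Z : List (Fin (d + 1) → ℚ)) (s : Mem), Z.length ≤ M → T Z.length ≤ M →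
      1 ≤ M → (∀ z ∈ Z, P z) → HasData K Z s → (∀ i < K, s i = []) →
      Runs ℓ (startBest K d m R) s (C * M) (Ready ℓ K d m Z) := by
  obtain ⟨C₁, h₁⟩ := runs_assignAll ℓ K (b := 5) (by simp) (pair_injective (m + 1) (d + 1))
    fun _ => .const 0
  obtain ⟨C₂, h₂⟩ := runs_evaluate m hK hRK hT hR
  obtain ⟨C₃, h₃⟩ := runs_update ℓ K d (m + 1)
  refine ⟨C₁ + C₂ + C₃, fun M Z s hZ hTM hM hP hs hlow => ?_⟩
  refine ((h₁ s fun _ _ _ => rfl).next (B₂ := C₂ * M + C₃)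
    (touches_assignAll (A := {1, 5}) (by simp) (by simp)) ?_).le
    (by nlinarith [Nat.mul_le_mul_left (C₁ + C₃) hM])
  rintro s₁ - q1
  refine (h₂ M Z s₁ hZ hTM hM hP (hs.congr q1 (by simp) (by simp)) fun i hi => ?_).next
    (touches_evaluate hK hRK) ?_
  · rw [q1.low (by simp) hi, hlow i hi]
  rintro s₂ ⟨d2, low2, e8, -⟩ q2
  refine ((h₃ s₂).same (touches_update K d (m + 1))).imp ?_
  rintro s₃ ⟨⟨f6, f7, f9⟩, q3⟩
  refine ⟨d2.congr q3 (by simp) (by simp), fun i hi => ?_, ?_⟩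
  · rw [q3.low (by simp) hi, low2 i hi]
  · rw [HasBest, f9, e8, f6, f7, q2.mat (by simp [evalBlocks]; omega)]

/-- The candidates' types: pairs of categories, a coordinate, and a sign. -/
abbrev Config (m D : ℕ) : Type := (Fin D → Fin (m + 1) × Fin (m + 1)) × Fin (D + 1) × Bool

/-- The sign encoded by a Boolean value. -/
def sgn (b : Bool) : ℚ := if b then 1 else -1

/-- Try all candidates. -/
noncomputable def search (K : ℕ) (R : Prog) : Prog :=
  forList K (Finset.univ : Finset (Config m D)).toList fun κ =>
    forTuples K d (tryCandidate e κ.1 κ.2.1 (sgn κ.2.2) K R) D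

theorem Ready.congr {K n : ℕ} {Z : List (Fin (d + 1) → ℚ)} {s s' : Mem} {A : Set ℕ}
    (h : Ready ℓ K d n Z s) (hs : Same K A s s') (hA : ∀ a ∈ A, a = 1 ∨ 10 ≤ a) :
    Ready ℓ K d n Z s' ∧ top s' (addr K 9 0) = top s (addr K 9 0) := by
  have hn : ∀ a, a ≠ 1 → a < 10 → a ∉ A := fun a h1 h2 h => by
    have := hA a h
    omega
  have h9 := hs.top (hn 9 (by simp) (by simp)) 0
  refine ⟨⟨h.1.congr hs (hn 3 (by simp) (by simp)) (hn 4 (by simp) (by simp)),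
    fun i hi => ?_, ?_⟩, h9⟩
  · rw [hs.low (hn 0 (by simp) (by simp)) hi, h.2.1 i hi]
  · rw [HasBest, h9, h.2.2, hs.mat (hn 7 (by simp) (by simp)), hs.mat (hn 6 (by simp) (by simp))]

theorem runs_search {K : ℕ} {R : Prog} {T : ℕ → ℕ} {P : (Fin (d + 1) → ℚ) → Prop}
    (hK : 2 ≤ K) (hRK : R.bound ≤ K) (hT : Monotone T) (hR : ListRegression ℓ R T P) :
    ∃ C, ∀ (M : ℕ) (Z : List (Fin (d + 1) → ℚ)) (s : Mem), Z.length ≤ M → T Z.length ≤ M →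
      1 ≤ Z.length → (∀ z ∈ Z, P z) → Ready ℓ K d m Z s →
      (∀ j, s (addr K (21 + 3 * j) 0) = []) →
      Runs ℓ (search e K R) s (C * (Z.length ^ D * M)) fun s' => Ready ℓ K d m Z s' ∧
        ∀ (κ : Config m D) (U : ℕ → Fin (d + 1) → ℚ), (∀ j < D, U j ∈ Z) →
          Beats e κ.1 κ.2.1 (sgn κ.2.2) ℓ Z U (top s' (addr K 9 0)) := by
  choose C hC using fun κ : Config m D =>
    runs_tryCandidate e κ.1 κ.2.1 (sgn κ.2.2) hK hRK hT hR
  -- The summand 1 only ensures that the bound for the loop body is at least 1.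
  set C₀ := Finset.univ.sup C + 1 with hC₀
  set L := (Finset.univ : Finset (Config m D)).toList with hL
  refine ⟨L.length * ((11 * d + 17) ^ D * C₀) + 1, fun M Z s hZ hTM hZ1 hP hs hempty => ?_⟩
  have hM : 1 ≤ M := hZ1.trans hZ
  have hA : ∀ j, 20 + 3 * j ∉ tryBlocks ∧ 21 + 3 * j ∉ tryBlocks := by
    intro j
    simp only [tryBlocks, evalBlocks, Set.mem_union, Set.mem_insert_iff, Set.mem_singleton_iff,
      Set.mem_ofPred_eq]
    constructor <;> rintro ((h | ⟨i, h⟩) | h) <;> omega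
  have hnl : ∀ j, D ≤ j → 21 + 3 * j ∉ tryBlocks ∪ {3, 4} ∪ loopBlocks D := by
    rintro j hj ((h | h) | h | ⟨i, hi, h⟩)
    · exact (hA j).2 h
    · simp at h; omega
    · simp at h; omega
    · omega
  let I : List (Config m D) → Mem → Prop := fun l s' => Ready ℓ K d m Z s' ∧
    (∀ j, s' (addr K (21 + 3 * j) 0) = []) ∧ ∀ κ, κ ∉ l → ∀ U : ℕ → Fin (d + 1) → ℚ,
      (∀ j < D, U j ∈ Z) → Beats e κ.1 κ.2.1 (sgn κ.2.2) ℓ Z U (top s' (addr K 9 0))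
  refine (runs_forList (B := (11 * d + 17) ^ D * Z.length ^ D * (C₀ * M)) I ?_ L s
    ⟨hs, hempty, fun κ hκ => absurd (by simp [hL]) hκ⟩).mono ?_ ?_
  · rintro κ l s₁ ⟨h1, h2, h3⟩
    have htouch := touches_tryCandidate (R := R) e κ.1 κ.2.1 (sgn κ.2.2) hK hRK
    refine ((runs_forTuples htouch hA hZ1 (B := C₀ * M) (Nat.mul_pos (by omega) (by omega))
      (Ready ℓ K d m Z)
      (fun s => top s (addr K 9 0)) (Beats e κ.1 κ.2.1 (sgn κ.2.2) ℓ Z)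
      (fun U b b' h hb => h.mono e κ.1 κ.2.1 (sgn κ.2.2) hb)
      (fun s h => h.1) ?_ ?_ D s₁ h1 (fun j _ => h2 j)).same (touches_forTuples htouch D)).imp ?_
    · intro k s s' hss' hs
      refine hs.congr hss' ?_
      rintro a (h | ⟨j, -, h⟩)
      · simp at h; omega
      · omega
    · intro s hs
      refine (hC κ M Z s hZ hTM hM hP hs).le (Nat.mul_le_mul_right _ ?_)
      exact (Finset.le_sup (Finset.mem_univ κ)).trans (Nat.le_succ _)
    · rintro s₂ ⟨⟨i1, i2, i3, i4⟩, i5⟩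
      refine ⟨i1, fun j => ?_, fun κ' hκ' U hU => ?_⟩
      · by_cases hj : j < D
        · exact i3 j hj
        · rw [i5.addr (hnl j (by omega)), h2 j]
      · by_cases hκ : κ' = κ
        · subst hκ
          -- Beyond index D the tuple must agree with the memory; the forms read only the first D
          -- points, so the change is immaterial.
          obtain ⟨σ, h4, h5⟩ := i4 (fun j => if j < D then U j else points K d s₁ j)
            (fun j hj => by simp [hj, hU j hj]) (fun j hj => by simp [not_lt.2 hj])
          have hf : forms e κ'.1 (fun j => if j < D then U j else points K d s₁ j) =
              forms e κ'.1 U := by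
            funext j
            simp [forms]
          rw [hf] at h4 h5
          exact ⟨σ, h4, h5⟩
        · exact (h3 κ' (by simp [hκ, hκ']) U hU).mono e _ _ _ i2
  · have h1 : 1 ≤ Z.length ^ D * M := Nat.mul_pos (pow_pos (by omega) _) (by omega)
    calc L.length * ((11 * d + 17) ^ D * Z.length ^ D * (C₀ * M)) + 1
        = L.length * ((11 * d + 17) ^ D * C₀) * (Z.length ^ D * M) + 1 := by ring
      _ ≤ _ := by rw [add_mul, one_mul]; omega
  · rintro s' ⟨s₀, ⟨h1, h2, h3⟩, h'⟩
    obtain ⟨g1, g2⟩ := h1.congr h' (by simp)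
    exact ⟨g1, fun κ U hU => by rw [g2]; exact h3 κ (by simp) U hU⟩

/-- The program solving the PWA regression problem. -/
noncomputable def solver (K : ℕ) (R : Prog) : Prog :=
  .seq (readInput K) <| .seq (startBest K d m R) <| .seq (search e K R) <|
    output K (matStacks K 7 (m + 1) d ++ matStacks K 6 (m + 1) d)

theorem modelError_congr {n : ℕ} {w θ θ' : Fin (n + 1) → Fin (d + 1) → ℚ}
    {Z : List (Fin (d + 1) → ℚ)} (h : ∀ z ∈ Z, label θ z = label θ' z) :
    modelError ℓ w θ Z = modelError ℓ w θ' Z := by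
  unfold modelError
  congr 1
  exact List.map_congr_left fun z hz => by rw [h z hz]

/-- Global optimality: a competing classifier θ' labels the data like one of the candidates tried,
whose optimal error is at least the stored cost; and the error depends on θ' only through the
labels. The bound is in terms of M, so that the comparison of N with T(N) stays separate. -/
theorem exists_solver (e : Fin m × Fin (d + 1) ≃ Fin (D + 1)) {R : Prog} {T : ℕ → ℕ} {P : (Fin (d + 1) → ℚ) → Prop}
    (hT : Monotone T) (hR : ListRegression ℓ R T P) :
    ∃ (S : Prog) (C : ℕ), ∀ (M : ℕ) (Z : List (Fin (d + 1) → ℚ)), Z.length ≤ M →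
      T Z.length ≤ M → 1 ≤ Z.length → (∀ z ∈ Z, P z) →
      (∀ v : Fin (d + 1) → ℚ, (∀ z ∈ Z, v ⬝ᵥ bar z = 0) → v = 0) →
      Runs ℓ S (Function.update (fun _ => []) 0 (enc Z)) (C * (Z.length ^ D * M)) fun s' =>
        ∃ w θ : Fin (m + 1) → Fin (d + 1) → ℚ, s' 1 = encodeMat w ++ encodeMat θ ∧
          ∀ w' θ' : Fin (m + 1) → Fin (d + 1) → ℚ, modelError ℓ w θ Z ≤ modelError ℓ w' θ' Z := by
  set K := R.bound + 2 with hKdef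
  have hK : 2 ≤ K := by omega
  have hRK : R.bound ≤ K := by omega
  obtain ⟨C₁, h₁⟩ := runs_startBest m hK hRK hT hR
  obtain ⟨C₂, h₂⟩ := runs_search e hK hRK hT hR
  set l := matStacks K 7 (m + 1) d ++ matStacks K 6 (m + 1) d with hl
  refine ⟨solver e K R, (d + 1) * 8 + 2 + C₁ + C₂ + (l.length + 1),
    fun M Z hZ hTM hZ1 hP hgen => ?_⟩
  have hM : 1 ≤ M := hZ1.trans hZ
  have hlb : ∀ r ∈ l, blk K r ≠ 0 ∧ blk K r ≠ 1 := by
    intro r hr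
    simp only [hl, matStacks, List.mem_append, List.mem_flatten, List.mem_ofFn] at hr
    obtain ⟨_, ⟨_, rfl⟩, hr⟩ | ⟨_, ⟨_, rfl⟩, hr⟩ := hr <;>
    · obtain ⟨_, rfl⟩ := List.mem_ofFn.1 hr
      simp
  have hA : ∀ j, 21 + 3 * j ∉ tryBlocks := by
    intro j
    simp only [tryBlocks, evalBlocks, Set.mem_union, Set.mem_insert_iff, Set.mem_singleton_iff,
      Set.mem_ofPred_eq]
    rintro ((h | ⟨i, h⟩) | h) <;> omega
  refine (Runs.seq (B₂ := C₁ * M + (C₂ * (Z.length ^ D * M) + (l.length + 1)))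
    ((runs_readInput (by omega) Z).imp ?_)).le ?_
  swap
  · have h1 : 1 ≤ Z.length ^ D := Nat.pow_pos (by omega)
    have h2 : M ≤ Z.length ^ D * M := Nat.le_mul_of_pos_left _ h1
    have h3 := linear_bound (a := (d + 1) * 8) (b := 2) hZ hM
    have h4 := Nat.mul_le_mul_left ((d + 1) * 8 + 2 + C₁) h2
    have h5 := Nat.mul_le_mul_left (l.length + 1) (hM.trans h2)
    simp only [add_mul, one_mul, mul_one] at h3 h4 h5 ⊢
    omega
  rintro s₁ ⟨d1, low1, emp1⟩
  refine (h₁ M Z s₁ hZ hTM hM hP d1 low1).next (touches_startBest hK hRK) ?_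
  rintro s₂ r2 q2
  refine Runs.seq ((h₂ M Z s₂ hZ hTM hZ1 hP r2 fun j => ?_).imp ?_)
  · rw [q2.addr (hA j), emp1 j]
  rintro s₃ ⟨r3, hbeats⟩
  refine (runs_output hK l hlb s₃).imp ?_
  rintro s₄ h4
  refine ⟨mat K 7 (m + 1) d s₃, mat K 6 (m + 1) d s₃, ?_, fun w' θ' => ?_⟩
  · rw [h4, r3.2.1 1 (by omega), hl, List.map_append, map_top_matStacks, map_top_matStacks,
      List.append_nil]
  · obtain ⟨κ, U, c, ε, hU, hε, hcand⟩ := exists_candidate e Z hgen θ'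
    obtain ⟨b, rfl⟩ : ∃ b, ε = sgn b := by
      rcases hε with rfl | rfl
      · exact ⟨true, rfl⟩
      · exact ⟨false, rfl⟩
    obtain ⟨σ, hσ, hopt⟩ := hbeats (κ, c, b) (fun j => if h : j < D then U ⟨j, h⟩ else 0)
      (fun j hj => by simpa [hj] using hU ⟨j, hj⟩)
    have hf : forms e κ (fun j => if h : j < D then U ⟨j, h⟩ else 0) =
        fun i => scoreForm e (κ i).1 (κ i).2 (U i) := by
      funext j
      simp [forms]
    simp only [hf] at hσ hopt
    rw [← modelError_congr (hcand _ _ rfl rfl σ hσ), ← r3.2.2]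
    exact hopt w'

end solver

/-! ### The number of steps of a regression program -/

/-- Taking a = b shows that ℓ is minimal at b. Taking a = b + δ with shift -δ bounds m times the
excess at b + δ by k times the excess at b - δ; using this for both signs with k < m forces both
excesses to be 0. -/
theorem eq_of_dominated {ℓ : ℚ → ℚ} {k m : ℕ} (hkm : k < m) (b : ℚ)
    (h : ∀ a δ : ℚ, m * (ℓ a - ℓ (a + δ)) ≤ k * (ℓ (b + δ) - ℓ b)) (x : ℚ) : ℓ x = ℓ b := by
  have hkm' : (k : ℚ) < m := by exact_mod_cast hkm
  have hk0 : (0 : ℚ) ≤ k := by positivity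
  have hmin : ∀ δ, 0 ≤ ℓ (b + δ) - ℓ b := fun δ => by
    have := h b δ
    by_contra! hneg
    nlinarith
  have hle : ∀ δ, m * (ℓ (b + δ) - ℓ b) ≤ k * (ℓ (b + -δ) - ℓ b) := fun δ => by
    have := h (b + δ) (-δ)
    rwa [add_neg_cancel_right] at this
  have h1 := hle (x - b)
  have h2 := hle (-(x - b))
  have h3 := hmin (x - b)
  have h4 := hmin (-(x - b))
  rw [neg_neg] at h2
  rw [add_sub_cancel] at h1 h2 h3
  by_contra hne
  have h5 : 0 < ℓ x - ℓ b := lt_of_le_of_ne h3 fun h => hne (by linarith)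
  nlinarith

/-! ### Data sets as lists of points; lower bound for T -/

/-- The data point `[xᵀ, y]ᵀ`. -/
def mkPoint {d : ℕ} (x : Fin d → ℚ) (y : ℚ) : Fin (d + 1) → ℚ := Fin.snoc (α := fun _ => ℚ) x y

theorem bar_mkPoint {d : ℕ} (x : Fin d → ℚ) (y : ℚ) : bar (mkPoint x y) = ext x := by
  funext c
  refine Fin.lastCases ?_ (fun c => ?_) c <;> simp [bar, mkPoint, ext]

theorem residual_mkPoint {d : ℕ} (v : Fin (d + 1) → ℚ) (x : Fin d → ℚ) (y : ℚ) :
    residual v (mkPoint x y) = y - v ⬝ᵥ ext x := by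
  rw [residual, bar_mkPoint]
  simp [mkPoint]

theorem ofFn_mkPoint {d : ℕ} (x : Fin d → ℚ) (y : ℚ) :
    List.ofFn (mkPoint x y) = List.ofFn x ++ [y] := by
  rw [List.ofFn_succ', List.concat_eq_append]
  simp [mkPoint]

theorem encodeData_eq_enc {d N : ℕ} (x : Fin N → Fin d → ℚ) (y : Fin N → ℚ) :
    encodeData x y = enc (List.ofFn fun i => mkPoint (x i) (y i)) := by
  simp only [encodeData, enc, List.map_ofFn, Function.comp_def, ofFn_mkPoint]

/-- The inputs of a data point belong to `X`. -/
def Admissible {d : ℕ} (X : Set (Fin d → ℚ)) (z : Fin (d + 1) → ℚ) : Prop := Fin.init z ∈ X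

theorem SolvesRegression.listRegression {d : ℕ} {X : Set (Fin d → ℚ)} {R : Prog} {T : ℕ → ℕ}
    (h : SolvesRegression X ℓ R T) : ListRegression ℓ R T (Admissible X) := by
  intro Z hZ hX
  obtain ⟨v, t, ⟨s', he, h1⟩, ht, hopt⟩ := h Z.length (List.length_pos_iff.2 hZ)
    (fun i => ⟨Fin.init (Z.get i), hX _ (Z.get_mem i)⟩) (fun i => Z.get i (Fin.last d))
  have hZ' : (List.ofFn fun i => mkPoint (Fin.init (Z.get i)) (Z.get i (Fin.last d))) = Z := by
    simp only [mkPoint, Fin.snoc_init_self]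
    exact List.ofFn_get Z
  have herr : ∀ v, error ℓ v Z = affineError ℓ (fun i => Fin.init (Z.get i))
      (fun i => Z.get i (Fin.last d)) v := by
    intro v
    conv_lhs => rw [← hZ']
    simp only [error, List.map_ofFn, List.sum_ofFn, affineError, Function.comp_def,
      residual_mkPoint]
  refine ⟨v, ⟨t, s', ?_, ht, h1⟩, fun v' => ?_⟩
  · rwa [encodeData_eq_enc, hZ'] at he
  · rw [herr, herr]
    exact hopt v'

theorem error_append {d : ℕ} (v : Fin (d + 1) → ℚ) (Z Z' : List (Fin (d + 1) → ℚ)) :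
    error ℓ v (Z ++ Z') = error ℓ v Z + error ℓ v Z' := by
  simp [error]

theorem error_replicate {d : ℕ} (v z : Fin (d + 1) → ℚ) (k : ℕ) :
    error ℓ v (List.replicate k z) = k * ℓ (residual v z) := by
  simp [error]

/-- A program which solves the regression problem reads a constant proportion of the input,
unless the loss function is constant. -/
theorem ListRegression.le_mul_steps {d : ℕ} {X : Set (Fin d → ℚ)} {R : Prog} {T : ℕ → ℕ}
    (h : ListRegression ℓ R T (Admissible X)) {x : Fin d → ℚ} (hx : x ∈ X)
    (hℓ : ∃ a b, ℓ a ≠ ℓ b) {N : ℕ} (hN : 1 ≤ N) : N ≤ 4 * T N := by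
  have hadm : ∀ y, Admissible X (mkPoint x y) := fun y => by simpa [Admissible, mkPoint] using hx
  by_contra! hlt
  have hT1 : 1 ≤ T N := by
    obtain ⟨v, ⟨t, s', he, ht, -⟩, -⟩ := h (List.replicate N (mkPoint x 0))
      (by simp; omega) (fun z hz => by rw [List.eq_of_mem_replicate hz]; exact hadm 0)
    rw [List.length_replicate] at ht
    exact he.one_le.trans ht
  -- The first k points fill k(d+1) ≥ T(N) + d + 1 cells, so neither the steps made nor the d + 1
  -- output cells compared can see beyond them. Since 1 ≤ T(N) and 4T(N) < N, fewer than half of the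
  -- points are among them.
  set k := T N + 1 with hk
  obtain ⟨m, hm⟩ : ∃ m, N = k + m := ⟨N - k, by omega⟩
  have hkm : k < m := by omega
  let Z : ℚ → List (Fin (d + 1) → ℚ) := fun a =>
    List.replicate k (mkPoint x 0) ++ List.replicate m (mkPoint x a)
  have hlen : ∀ a, (Z a).length = N := fun a => by simp [Z, hm]
  have hZ : ∀ a, Z a ≠ [] ∧ ∀ z ∈ Z a, Admissible X z := fun a => by
    refine ⟨fun h => ?_, fun z hz => ?_⟩
    · have := hlen a
      rw [h] at this
      simp at this
      omega
    · rcases List.mem_append.1 hz with hz | hz <;> rw [List.eq_of_mem_replicate hz] <;>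
        exact hadm _
  obtain ⟨v, ⟨t, s', he, ht, hv⟩, -⟩ := h (Z 0) (hZ 0).1 (hZ 0).2
  rw [hlen] at ht
  -- The responses a are never read, so the answer v for a = 0 is also the program's answer, hence
  -- optimal, for every a.
  have hopt : ∀ a v', error ℓ v (Z a) ≤ error ℓ v' (Z a) := by
    intro a
    obtain ⟨v₂, ⟨t₂, s₂, he₂, -, hv₂⟩, hopt⟩ := h (Z a) (hZ a).1 (hZ a).2
    obtain ⟨r', hr, hr'⟩ := he.locality (d + 1)
      (Function.update (fun _ => []) 0 (enc (Z a))) (fun i => by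
        by_cases hi : i = 0
        · subst hi
          have hle : d + 1 + t ≤ (enc (List.replicate k (mkPoint x 0))).length := by
            rw [length_enc, List.length_replicate, hk]
            nlinarith
          simp only [Function.update_self, Z, enc_append]
          rw [List.take_append_of_le_length hle, List.take_append_of_le_length hle]
        · simp [hi])
    have hs : r' = s₂ := hr.deterministic he₂
    have h1 := hr' 1
    rw [hs, hv, hv₂, List.take_of_length_le (by simp), List.take_of_length_le (by simp)] at h1
    rw [List.ofFn_injective h1]
    exact hopt
  have hres : ∀ u a, residual (Pi.single (Fin.last d) u) (mkPoint x a) = a - u := fun u a => by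
    rw [residual_mkPoint]
    simp [ext]
  set b := residual v (mkPoint x 0) with hb
  have hres' : ∀ a, residual v (mkPoint x a) = a + b := fun a => by
    rw [hb, residual_mkPoint, residual_mkPoint]; ring
  have hconst := eq_of_dominated (ℓ := ℓ) hkm b fun a δ => by
    -- Compare v with the constant model that shifts all residuals by δ: on the first k points from
    -- b to b + δ, on the others from a to a + δ.
    have := hopt (a - b) (Pi.single (Fin.last d) (-b - δ))
    simp only [Z, error_append, error_replicate, hres, hres'] at this
    rw [show 0 + b = b by ring, show a - b + b = a by ring, show 0 - (-b - δ) = b + δ by ring,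
      show a - b - (-b - δ) = a + δ by ring] at this
    linarith
  obtain ⟨a, a', hne⟩ := hℓ
  exact hne ((hconst a).trans (hconst a').symm)

/-! ### The main theorem -/

/-- With n = m + 1 modes, there is equality for n = 2, where both sides are d; the exponent saved by
using lines instead of vertices is therefore indispensable. -/
theorem exponent_le {d m D : ℕ} (hd : 1 ≤ d) (hm : 1 ≤ m) (hD : m * (d + 1) = D + 1) :
    D ≤ d * (m + 1) * (m + 1 - 1) / 2 := by
  rw [Nat.le_div_iff_mul_le (by norm_num), Nat.add_sub_cancel]
  obtain ⟨d, rfl⟩ := Nat.exists_eq_add_of_le hd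
  obtain ⟨m, rfl⟩ := Nat.exists_eq_add_of_le hm
  zify at hD ⊢
  have hD' : (D : ℤ) = (1 + m) * (1 + d + 1) - 1 := by linarith
  rw [hD']
  rcases m with _ | m
  · push_cast; nlinarith
  · push_cast
    nlinarith [mul_nonneg (Int.natCast_nonneg m) (Int.natCast_nonneg d),
      mul_nonneg (mul_nonneg (Int.natCast_nonneg m) (Int.natCast_nonneg d))
        (Int.natCast_nonneg m), sq_nonneg (m : ℤ)]

/-- If the linear part of v is nonzero, all N > d points lie on one hyperplane; if it is zero, the
constant term vanishes at any point. -/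
theorem eq_zero_of_generalPosition {d N : ℕ} {x : Fin N → Fin d → ℚ} (hN : d + 1 ≤ N)
    (h : GeneralPosition x) (v : Fin (d + 1) → ℚ) (hv : ∀ i, v ⬝ᵥ ext (x i) = 0) : v = 0 := by
  have hsplit : ∀ i, Fin.init v ⬝ᵥ x i + v (Fin.last d) = 0 := fun i => by
    have := hv i
    rw [dotProduct, Fin.sum_univ_castSucc] at this
    simpa [ext, dotProduct, Fin.init] using this
  have hg : (Fin.init v : Fin d → ℚ) = 0 := by
    by_contra hne
    have := h (Fin.init v) (v (Fin.last d)) hne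
    rw [Finset.filter_true_of_mem fun i _ => hsplit i, Finset.card_univ, Fintype.card_fin] at this
    omega
  have hb : v (Fin.last d) = 0 := by
    have := hsplit ⟨0, by omega⟩
    rwa [hg, zero_dotProduct, zero_add] at this
  funext c
  refine Fin.lastCases hb (fun c => congrFun hg c) c

theorem ext_eq_bar {d : ℕ} (x : Fin d → ℚ) (y : ℚ) : ext x = bar (mkPoint x y) :=
  (bar_mkPoint x y).symm

theorem exists_isArgmaxClassifier {d n : ℕ} {X : Set (Fin d → ℚ)}
    (θ : Fin (n + 1) → Fin (d + 1) → ℚ) :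
    IsArgmaxClassifier (fun k => Fin.init (θ k)) (fun k => θ k (Fin.last d))
      fun x : X => label θ (mkPoint x 0) := by
  intro x
  have : ∀ k, score θ k (mkPoint (x : Fin d → ℚ) 0) =
      (Fin.init (θ k) : Fin d → ℚ) ⬝ᵥ (x : Fin d → ℚ) + θ k (Fin.last d) := fun k => by
    rw [score, bar_mkPoint, dotProduct, Fin.sum_univ_castSucc]
    simp [ext, dotProduct, Fin.init]
  simpa only [this] using isLeast_label θ (mkPoint (x : Fin d → ℚ) 0)

theorem label_eq_of_isArgmaxClassifier {d n : ℕ} {X : Set (Fin d → ℚ)}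
    {g : Fin (n + 1) → Fin d → ℚ} {b : Fin (n + 1) → ℚ} {h : X → Fin (n + 1)}
    (hh : IsArgmaxClassifier g b h) (x : X) (y : ℚ) :
    label (fun k => mkPoint (g k) (b k)) (mkPoint x y) = h x := by
  refine (isLeast_label _ _).unique ?_
  have : ∀ k, score (fun k => mkPoint (g k) (b k)) k (mkPoint (x : Fin d → ℚ) y) =
      g k ⬝ᵥ (x : Fin d → ℚ) + b k := fun k => by
    rw [score, bar_mkPoint, dotProduct, Fin.sum_univ_castSucc]
    simp [ext, mkPoint, dotProduct]
  simpa only [this] using hh x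

theorem pwaCost_eq {d n N : ℕ} {X : Set (Fin d → ℚ)} (x : Fin N → X) (y : Fin N → ℚ)
    (w : Fin n → Fin (d + 1) → ℚ) (h : X → Fin n) :
    pwaCost ℓ x y w h = 1 / (N : ℚ) * ∑ i, ℓ (y i - w (h (x i)) ⬝ᵥ ext (x i : Fin d → ℚ)) := by
  simp [pwaCost]

theorem pwaCost_eq_modelError {d n N : ℕ} {X : Set (Fin d → ℚ)} {x : Fin N → X} {y : Fin N → ℚ}
    {w θ : Fin (n + 1) → Fin (d + 1) → ℚ} {h : X → Fin (n + 1)}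
    (hh : ∀ i, label θ (mkPoint (x i) (y i)) = h (x i)) :
    pwaCost ℓ x y w h =
      1 / (N : ℚ) * modelError ℓ w θ (List.ofFn fun i => mkPoint (x i) (y i)) := by
  rw [pwaCost_eq]
  simp only [modelError, List.map_ofFn, List.sum_ofFn, Function.comp_def, residual_mkPoint, hh]

theorem encodeMat_append_encodeMat {d n : ℕ} (w θ : Fin n → Fin (d + 1) → ℚ) :
    encodeMat w ++ encodeMat θ =
      encodeModel w (fun k => Fin.init (θ k)) fun k => θ k (Fin.last d) := by
  have : ∀ k, List.ofFn (θ k) = List.ofFn (Fin.init (θ k) : Fin d → ℚ) ++ [θ k (Fin.last d)] :=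
    fun k => by
      rw [← ofFn_mkPoint]
      simp [mkPoint, Fin.snoc_init_self]
  simp only [encodeMat, encodeModel, this]

/-- For a constant loss function every model is optimal. -/
theorem exists_solver_of_const {d n : ℕ} (X : Set (Fin d → ℚ)) (hℓ : ∀ a b, ℓ a = ℓ b) :
    ∃ (S : Prog) (C : ℕ), SolvesPWA X (n + 1) ℓ S fun _ => C := by
  set l := matStacks 2 7 (n + 1) d ++ matStacks 2 6 (n + 1) d with hl
  -- The blocks are still empty, so the program prints a fixed number of default zeros without
  -- reading the data.
  refine ⟨output 2 l, l.length + 1, fun N _ x y _ => ?_⟩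
  set s : Mem := Function.update (fun _ => []) 0 (encodeData (fun i => (x i : Fin d → ℚ)) y)
  obtain ⟨t, s', he, ht, hs'⟩ := runs_output (ℓ := ℓ) (K := 2) le_rfl l (fun r hr => by
    simp only [hl, matStacks, List.mem_append, List.mem_flatten, List.mem_ofFn] at hr
    obtain ⟨_, ⟨_, rfl⟩, hr⟩ | ⟨_, ⟨_, rfl⟩, hr⟩ := hr <;>
    · obtain ⟨_, rfl⟩ := List.mem_ofFn.1 hr
      simp) s
  refine ⟨mat 2 7 (n + 1) d s, _, _, _, t, ⟨s', he, ?_⟩, ht,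
    exists_isArgmaxClassifier (mat 2 6 (n + 1) d s),
    ⟨_, _, exists_isArgmaxClassifier (mat 2 6 (n + 1) d s)⟩, fun w' h' _ => le_of_eq ?_⟩
  · rw [hs', hl, List.map_append, map_top_matStacks, map_top_matStacks,
      encodeMat_append_encodeMat]
    simp [s]
  · rw [pwaCost_eq, pwaCost_eq]
    congr 1
    exact Finset.sum_congr rfl fun i _ => hℓ _ _

end PWA

theorem mainTheorem1 (d n : ℕ) (hd : 1 ≤ d) (hn : 2 ≤ n) (X : Set (Fin d → ℚ))
    (ℓ : ℚ → ℚ) (hℓ : ∀ e : ℚ, 0 ≤ ℓ e)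
    (T : ℕ → ℕ) (hTmono : Monotone T) (hTpoly : PWA.PolynomiallyBounded T)
    (hreg : ∃ R : PWA.Prog, PWA.SolvesRegression X ℓ R T) :
    ∃ (P : PWA.Prog) (τ : ℕ → ℕ),
      PWA.SolvesPWA X n ℓ P τ ∧
      (∃ C : ℕ, ∀ N : ℕ, τ N ≤ C * (T N * N ^ (d * n * (n - 1) / 2))) ∧
      PWA.PolynomiallyBounded τ := by
  obtain ⟨R, hR⟩ := hreg
  suffices h : ∃ (P : PWA.Prog) (C : ℕ),
      PWA.SolvesPWA X n ℓ P fun N => C * (T N * N ^ (d * n * (n - 1) / 2)) by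
    obtain ⟨P, C, hP⟩ := h
    obtain ⟨p, hp⟩ := hTpoly
    refine ⟨P, _, hP, ⟨C, fun N => le_rfl⟩,
      Polynomial.C C * (p * Polynomial.X ^ (d * n * (n - 1) / 2)), fun N => ?_⟩
    simpa using Nat.mul_le_mul_left C (Nat.mul_le_mul_right _ (hp N))
  obtain ⟨m, rfl⟩ : ∃ m, n = m + 1 := ⟨n - 1, by omega⟩
  have hR' := hR.listRegression
  have hT1 : ∀ {N : ℕ}, 1 ≤ N → (Fin N → X) → 1 ≤ T N := by
    intro N hN x
    obtain ⟨v, t, ⟨s', he, -⟩, ht, -⟩ := hR N hN x fun _ => 0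
    exact he.one_le.trans ht
  have hpos : ∀ {N : ℕ}, (m + 1) * (d + 1) ≤ N → 1 ≤ N := fun h =>
    (Nat.mul_pos (by omega) (by omega)).trans_le h
  by_cases hconst : ∀ a b, ℓ a = ℓ b
  · obtain ⟨S, C, hS⟩ := PWA.exists_solver_of_const (n := m) X hconst
    refine ⟨S, C, fun N hN x y hx => ?_⟩
    obtain ⟨w, g, b, h, t, h1, ht, h2⟩ := hS N hN x y hx
    refine ⟨w, g, b, h, t, h1, ht.trans (Nat.le_mul_of_pos_right _ (Nat.mul_pos ?_ ?_)), h2⟩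
    · exact hT1 (hpos hN) x
    · exact Nat.pow_pos (hpos hN)
  · push Not at hconst
    -- D + 1 is the number of parameters once the last of the m + 1 categories is normalised to 0.
    obtain ⟨D, hD⟩ : ∃ D, m * (d + 1) = D + 1 :=
      ⟨m * (d + 1) - 1, by have := Nat.mul_pos (show 0 < m by omega) (show 0 < d + 1 by omega); omega⟩
    have e : Fin m × Fin (d + 1) ≃ Fin (D + 1) := finProdFinEquiv.trans (finCongr hD)
    obtain ⟨S, C, hS⟩ := PWA.exists_solver e hTmono hR'
    refine ⟨S, C * 4, fun N hN x y hx => ?_⟩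
    have hN1 := hpos hN
    set Z := List.ofFn fun i => PWA.mkPoint (x i : Fin d → ℚ) (y i) with hZ
    have hlen : Z.length = N := by simp [hZ]
    have hmem : ∀ z ∈ Z, ∃ i, z = PWA.mkPoint (x i : Fin d → ℚ) (y i) := fun z hz => by
      obtain ⟨i, hi⟩ := List.mem_ofFn.1 hz
      exact ⟨i, hi.symm⟩
    have hNT : N ≤ 4 * T N := hR'.le_mul_steps (x ⟨0, hN1⟩).2 hconst hN1
    -- Since ℓ is not constant, N ≤ 4T(N), so M = 4T(N) bounds both N and T(N); this is the source
    -- of the factor 4.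
    obtain ⟨t, s', he, ht, w, θ, h1, hopt⟩ := hS (4 * T N) Z (by omega) (by rw [hlen]; omega)
      (by omega) (fun z hz => by
        obtain ⟨i, rfl⟩ := hmem z hz
        simp [PWA.Admissible, PWA.mkPoint])
      (fun v hv => by
        refine PWA.eq_zero_of_generalPosition ?_ hx v fun i => ?_
        · exact (Nat.le_mul_of_pos_left _ (by omega)).trans hN
        · rw [PWA.ext_eq_bar _ (y i)]
          exact hv _ (List.mem_ofFn.2 ⟨i, rfl⟩))
    -- Labels ignore the response coordinate, which `bar` overwrites with 1; hence they define a
    -- classifier on X.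
    have hlabel : ∀ i, PWA.label θ (PWA.mkPoint (x i : Fin d → ℚ) (y i)) =
        PWA.label θ (PWA.mkPoint (x i : Fin d → ℚ) 0) := fun i => by
      have := PWA.exists_isArgmaxClassifier (X := X) θ
      have h2 := PWA.label_eq_of_isArgmaxClassifier this (x i) (y i)
      simpa [PWA.mkPoint, Fin.snoc_init_self] using h2
    refine ⟨w, fun k => Fin.init (θ k), fun k => θ k (Fin.last d),
      fun x => PWA.label θ (PWA.mkPoint x 0), t, ⟨s', ?_, ?_⟩, ?_,
      PWA.exists_isArgmaxClassifier θ, ⟨_, _, PWA.exists_isArgmaxClassifier θ⟩, ?_⟩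
    · rwa [PWA.encodeData_eq_enc]
    · rw [h1, PWA.encodeMat_append_encodeMat]
    · rw [hlen] at ht
      calc t ≤ C * (N ^ D * (4 * T N)) := ht
        _ = C * 4 * (T N * N ^ D) := by ring
        _ ≤ _ := Nat.mul_le_mul_left _ (Nat.mul_le_mul_left _
          (Nat.pow_le_pow_right hN1 (PWA.exponent_le hd (by omega) hD)))
    · rintro w' h' ⟨g', b', hh'⟩
      rw [PWA.pwaCost_eq_modelError hlabel, PWA.pwaCost_eq_modelError
        (fun i => PWA.label_eq_of_isArgmaxClassifier hh' (x i) (y i))]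
      exact mul_le_mul_of_nonneg_left (hopt _ _) (by positivity)
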